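/- Let $d\in\mathbb N$, let $\Theta\in M_d(\mathbb R)$ be an invertible skew-symmetric matrix (so $d$ is even), and let $\tilde\Omega>0$. Put $\mathcal H=L^2(\mathbb R^d)\otimes\bigwedge(\mathbb C^d)$, let $b_\mu,b_\mu^*$ ($\mu=1,\dots,d$) be the fermionic annihilation and creation operators on $\bigwedge(\mathbb C^d)$, so that $\{b_\mu,b_\nu\}=0$ and $\{b_\mu,b_\nu^*\}=\delta_{\mu\nu}$, and let $a_\mu=\partial_\mu+\tilde\Omega x_\mu$, $a_\mu^*=-\partial_\mu+\tilde\Omega x_\mu$. Let $\mathcal D_1$ and $\mathcal D_2$ be the closures in $\mathcal H$ of the operators $$\sum_\mu\big(a_\mu\otimes b_\mu^*+a_\mu^*\otimes b_\mu\big)\qquad\text{and}\qquad \sum_\mu\big(i\,a_\mu\otimes b_\mu-i\,a_\mu^*\otimes b_\mu^*\big)$$ defined on $\mathcal S(\mathbb R^d)\otimes\bigwedge(\mathbb C^d)$. Let $\mathcal B_\star$ be the space of smooth functions $f:\mathbb R^d\to\mathbb C$ that are bounded together with all their partial derivatives, and for $f\in\mathcal B_\star$ and $\psi\in\mathcal S(\mathbb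 R^d)\otimes\bigwedge(\mathbb C^d)$ let $$(f\star\psi)(x)=\frac1{(2\pi)^d}\int_{\mathbb R^d}dk\,f\big(x+\tfrac12\Theta k\big)\int_{\mathbb R^d}dy\,\psi(x+y)\,e^{i\langle k,y\rangle}.$$ Then for every $f\in\mathcal B_\star$ the map $\psi\mapsto f\star\psi$ extends to a bounded operator $L_\star(f)$ on $\mathcal H$, and for $\bullet=1,2$ the following hold. The operator $\mathcal D_\bullet$ is self-adjoint; there is exactly one nonnegative self-adjoint operator $\langle\mathcal D_\bullet\rangle=(\mathcal D_\bullet^2+1)^{1/2}$ with $\langle\mathcal D_\bullet\rangle^2=\mathcal D_\bullet^2+1$ (with equality of domains); $L_\star(f)$ maps $\mathrm{dom}\,\mathcal D_\bullet$ into itself, and $[\mathcal D_\bullet,L_\star(f)]$, defined on $\mathrm{dom}\,\mathcal D_\bullet$, extends to a bounded operator on $\mathcal H$, denoted by the same symbol; and both $L_\star(f)$ and $[\mathcal D_\bullet,L_\star(f)]$ belong to $\bigcap_{n\ge1}\mathrm{dom}\,\delta_\bullet^n$. Here $\delta_\bullet(T)=[\langle\mathcal D_\bullet\rangle,T]$,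 the domain $\mathrm{dom}\,\delta_\bullet$ is the set of bounded operators $T$ on $\mathcal H$ that map $\mathrm{dom}\,\langle\mathcal D_\bullet\rangle$ into itself and for which $[\langle\mathcal D_\bullet\rangle,T]$ extends to a bounded operator $\delta_\bullet(T)$, and $T\in\mathrm{dom}\,\delta_\bullet^{n+1}$ means that $T\in\mathrm{dom}\,\delta_\bullet$ and $\delta_\bullet(T)\in\mathrm{dom}\,\delta_\bullet^{n}$. -/

import Mathlib

open scoped ContDiff SchwartzMap

noncomputable section

namespace MoyalOscillator

open MeasureTheory

/-! ### The Hilbert space `L²(ℝᵈ) ⊗ ⋀(ℂᵈ)` -/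

/-- The Euclidean space `ℝᵈ`. -/
abbrev Pt (d : ℕ) : Type := EuclideanSpace ℝ (Fin d)

/-- The exterior algebra `⋀(ℂᵈ)` with its standard inner product, in coordinates with respect to
the orthonormal basis `e_I = e_{i₁} ∧ ⋯ ∧ e_{iₖ}`, `I = {i₁ < ⋯ < iₖ} ⊆ {1, …, d}`. -/
abbrev Fock (d : ℕ) : Type := EuclideanSpace ℂ (Finset (Fin d))

/-- `L²(ℝᵈ) ⊗ ⋀(ℂᵈ)`, realised as the space of square integrable `⋀(ℂᵈ)`-valued functions. -/
abbrev Hilb (d : ℕ) : Type := Lp (Fock d) 2 (volume : Measure (Pt d))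

/-- Schwartz functions with values in `⋀(ℂᵈ)`. -/
abbrev Spinor (d : ℕ) : Type := 𝓢(Pt d, Fock d)

/-! ### Fermionic operators -/

/-- The sign `(-1)^{#{ν ∈ J : ν < μ}}`. -/
def fermiSign {d : ℕ} (μ : Fin d) (J : Finset (Fin d)) : ℂ :=
  (-1) ^ (J.filter (· < μ)).card

/-- The annihilation operator `b_μ` on `⋀(ℂᵈ)` (contraction with the `μ`-th basis vector):
`b_μ e_I = ± e_{I ∖ {μ}}` if `μ ∈ I`, and `b_μ e_I = 0` otherwise. -/
def annih {d : ℕ} (μ : Fin d) : Fock d →L[ℂ] Fock d :=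
  LinearMap.toContinuousLinearMap
    { toFun := fun v => WithLp.toLp 2 fun J =>
        if μ ∈ J then 0 else fermiSign μ J * v (insert μ J)
      map_add' := by
        intro v w
        ext J
        by_cases h : μ ∈ J <;> simp [h, mul_add]
      map_smul' := by
        intro c v
        ext J
        by_cases h : μ ∈ J <;> simp [h, mul_left_comm] }

/-- The creation operator `b_μ^*` on `⋀(ℂᵈ)` (exterior multiplication by the `μ`-th basis vector):
`b_μ^* e_I = ± e_{I ∪ {μ}}` if `μ ∉ I`, and `b_μ^* e_I = 0` otherwise. -/
def creat {d : ℕ} (μ : Fin d) : Fock d →L[ℂ] Fock d :=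
  LinearMap.toContinuousLinearMap
    { toFun := fun v => WithLp.toLp 2 fun J =>
        if μ ∈ J then fermiSign μ J * v (J.erase μ) else 0
      map_add' := by
        intro v w
        ext J
        by_cases h : μ ∈ J <;> simp [h, mul_add]
      map_smul' := by
        intro c v
        ext J
        by_cases h : μ ∈ J <;> simp [h, mul_left_comm] }

/-! ### Bosonic operators on Schwartz functions -/

/-- The partial derivative `∂_μ`. -/
def partialOp {d : ℕ} (μ : Fin d) : Spinor d →L[ℂ] Spinor d :=
  LineDeriv.lineDerivOpCLM ℂ (Spinor d) (EuclideanSpace.single μ (1 : ℝ))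

/-- Multiplication by the coordinate `x_μ`. -/
def positionOp {d : ℕ} (μ : Fin d) : Spinor d →L[ℂ] Spinor d :=
  SchwartzMap.smulLeftCLM (Fock d) (fun x : Pt d => ((x μ : ℝ) : ℂ))

/-- The operator `1 ⊗ B` for an operator `B` on `⋀(ℂᵈ)`. -/
def fiberOp {d : ℕ} (B : Fock d →L[ℂ] Fock d) : Spinor d →L[ℂ] Spinor d :=
  SchwartzMap.postcompCLM B

/-- `a_μ = ∂_μ + Ω x_μ`. -/
def bosonA {d : ℕ} (Ω : ℝ) (μ : Fin d) : Spinor d →L[ℂ] Spinor d :=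
  partialOp μ + (Ω : ℂ) • positionOp μ

/-- `a_μ^* = -∂_μ + Ω x_μ`. -/
def bosonAStar {d : ℕ} (Ω : ℝ) (μ : Fin d) : Spinor d →L[ℂ] Spinor d :=
  -partialOp μ + (Ω : ℂ) • positionOp μ

/-! ### The Dirac operators -/

/-- The operator `𝔔₁ + 𝔔₁^*` on Schwartz functions, where `𝔔₁ = ∑_μ a_μ ⊗ b_μ^*`. -/
def diracCore₁ {d : ℕ} (Ω : ℝ) : Spinor d →L[ℂ] Spinor d :=
  (∑ μ, bosonA Ω μ ∘L fiberOp (creat μ)) + ∑ μ, bosonAStar Ω μ ∘L fiberOp (annih μ)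

/-- The operator `i 𝔔₂ - i 𝔔₂^*` on Schwartz functions, where `𝔔₂ = ∑_μ a_μ ⊗ b_μ`. -/
def diracCore₂ {d : ℕ} (Ω : ℝ) : Spinor d →L[ℂ] Spinor d :=
  Complex.I • (∑ μ, bosonA Ω μ ∘L fiberOp (annih μ)) -
    Complex.I • ∑ μ, bosonAStar Ω μ ∘L fiberOp (creat μ)

/-- An operator on Schwartz functions, regarded as a densely defined operator on the Hilbert
space whose domain is the (image in `L²` of the) Schwartz space. -/
def ofCore {d : ℕ} (D : Spinor d →L[ℂ] Spinor d) : Hilb d →ₗ.[ℂ] Hilb d where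
  domain := LinearMap.range (SchwartzMap.toLpCLM ℂ (Fock d) 2 (volume : Measure (Pt d))).toLinearMap
  toFun := (SchwartzMap.toLpCLM ℂ (Fock d) 2 (volume : Measure (Pt d))).toLinearMap ∘ₗ
    D.toLinearMap ∘ₗ
    (LinearEquiv.ofInjective (SchwartzMap.toLpCLM ℂ (Fock d) 2 (volume : Measure (Pt d))).toLinearMap
      (SchwartzMap.injective_toLp 2 (volume : Measure (Pt d)))).symm.toLinearMap

/-- The Dirac operator `𝒟₁`: the closure of `𝔔₁ + 𝔔₁^*` defined on Schwartz functions. -/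
def dirac₁ {d : ℕ} (Ω : ℝ) : Hilb d →ₗ.[ℂ] Hilb d := (ofCore (diracCore₁ Ω)).closure

/-- The Dirac operator `𝒟₂`: the closure of `i 𝔔₂ - i 𝔔₂^*` defined on Schwartz functions. -/
def dirac₂ {d : ℕ} (Ω : ℝ) : Hilb d →ₗ.[ℂ] Hilb d := (ofCore (diracCore₂ Ω)).closure

/-! ### Left Moyal multiplication -/

/-- The space `ℬ_⋆` of smooth bounded functions all of whose derivatives are bounded. -/
def IsSmoothBounded {d : ℕ} (f : Pt d → ℂ) : Prop :=
  ContDiff ℝ ∞ f ∧ ∀ n : ℕ, ∃ C : ℝ, ∀ x, ‖iteratedFDeriv ℝ n f x‖ ≤ C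

/-- The Moyal product
`(f ⋆ ψ)(x) = (2π)^{-d} ∫ dk ∫ dy f(x + Θk/2) ψ(x + y) e^{i⟨k, y⟩}` of a bounded function with a
Schwartz function. The inner integral is, for each `x`, a Schwartz function of `k`, so for bounded
continuous `f` both integrals converge absolutely. -/
def moyal {d : ℕ} (Θ : Matrix (Fin d) (Fin d) ℝ) (f : Pt d → ℂ) (ψ : Spinor d) (x : Pt d) :
    Fock d :=
  (((2 * Real.pi) ^ d)⁻¹ : ℝ) •
    ∫ k : Pt d, f (x + (2⁻¹ : ℝ) • Matrix.toEuclideanLin Θ k) •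
      ∫ y : Pt d, Complex.exp (Complex.I * ((inner ℝ k y : ℝ) : ℂ)) • ψ (x + y)

/-- The bounded operator `T` is the operator `L_⋆(f)` of left Moyal multiplication by `f`, i.e. the
(necessarily unique) continuous extension of `ψ ↦ f ⋆ ψ` from Schwartz functions to the Hilbert
space. -/
def IsLeftMoyal {d : ℕ} (Θ : Matrix (Fin d) (Fin d) ℝ) (f : Pt d → ℂ)
    (T : Hilb d →L[ℂ] Hilb d) : Prop :=
  ∀ ψ : Spinor d, T (ψ.toLp 2 (volume : Measure (Pt d))) =ᵐ[volume] moyal Θ f ψ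

/-! ### Unbounded operators: `⟨D⟩`, commutators, the derivation `δ` -/

section Abstract

variable {V : Type*} [NormedAddCommGroup V] [InnerProductSpace ℂ V]

/-- `ψ ∈ dom (A²)` and `A² ψ = φ`, where `dom (A²) = {ψ ∈ dom A : A ψ ∈ dom A}`. -/
def SqRel (A : V →ₗ.[ℂ] V) (ψ φ : V) : Prop :=
  ∃ χ : V, (ψ, χ) ∈ A.graph ∧ (χ, φ) ∈ A.graph

/-- `A = ⟨D⟩ = (D² + 1)^{1/2}`: `A` is self-adjoint and nonnegative, and `A² = D² + 1` as unbounded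
operators (equality of domains included). -/
def IsBracket [CompleteSpace V] (D A : V →ₗ.[ℂ] V) : Prop :=
  IsSelfAdjoint A ∧ (∀ ψ : A.domain, 0 ≤ (inner ℂ (ψ : V) (A ψ)).re) ∧
    ∀ ψ φ : V, SqRel A ψ φ ↔ SqRel D ψ (φ - ψ)

/-- The bounded operator `S` is (the bounded extension of) the commutator `[A, T]`: the bounded
operator `T` maps `dom A` to itself, and `A T ψ - T A ψ = S ψ` for all `ψ ∈ dom A`. For densely
defined `A` such an `S` is unique. -/
def IsCommutator (A : V →ₗ.[ℂ] V) (T S : V →L[ℂ] V) : Prop :=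
  ∀ ψ : A.domain, ∃ h : T (ψ : V) ∈ A.domain, A ⟨T (ψ : V), h⟩ - T (A ψ) = S (ψ : V)

/-- `T ∈ dom (δⁿ)` for `δ(T) = [A, T]`, where `dom δ` consists of the bounded operators `T` such
that `[A, T]` is defined on `dom A` and extends to a bounded operator; `T ∈ dom (δⁿ⁺¹)` means
`T ∈ dom δ` and `δ(T) ∈ dom (δⁿ)`. -/
def MemDomDeltaPow (A : V →ₗ.[ℂ] V) : ℕ → (V →L[ℂ] V) → Prop
  | 0, _ => True
  | n + 1, T => ∃ S : V →L[ℂ] V, IsCommutator A T S ∧ MemDomDeltaPow A n S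

end Abstract

end MoyalOscillator

end

open scoped ContDiff SchwartzMap

namespace MoyalOscillator

open MeasureTheory

/-! ### Commutators with a square root -/

section SquareRootCommutator

set_option linter.unusedSectionVars false

open Set

/-! In Fourier variables `f ⋆ ·` is the pseudodifferential operator with symbol `f (x + B ξ)`, where
`B = -π Θ` (`moyal_eq_symbolOp`). All derivatives of `f` are bounded, so a Calderón–Vaillancourt
argument (`exists_local_bound`, `exists_quadratic_bound`) makes it bounded on `L²`. Its commutators
with `∂_μ` and `x_μ` have symbols of the same kind, with `f` replaced by multiples of directional
derivatives of `f` (`IsSymbolOp.exists_isWeakCommutator_gen`).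

Both Dirac operators have the form `D = ∑ X_k ⊗ Γ_k`, where the `X_k` are the operators `-i ∂_μ` and
`Ω x_μ` and the `Γ_k` are Clifford matrices. Since the commutators `[X_i, X_k]` are scalars, `D² = ∑
X_k² + N` with `N` a constant matrix (`diracOf_diracOf`). The space of Gaussians times polynomials
of degree at most `n` is finite dimensional and stable under `D²`, so `D² + 1`, being injective, is
onto there. These spaces span a dense subspace (`eq_zero_of_orthogonal_hermite`), so `D² + 1` has
dense range on the core. Self-adjointness follows, and `(D² + 1)⁻¹` is a bounded positive operator;
the inverse of its square root `S` is the unique bracket `A = ⟨D⟩`.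

Regularity is proved entirely with the bounded operator `S = A⁻¹`. The criterion is that all
iterates of `T ↦ A⁻¹ [A², T]` are bounded on `T`. The formula `S = (2/π) ∫ S² (1 + t² S²)⁻¹ dt` over
`t > 0` turns control of two such iterates into boundedness of `[A, T]`
(`exists_commutator_of_sq_commutators`), and `[A, T]` inherits the criterion
(`IsSmoothFor.exists_commutator`), so induction reaches every power of `δ`.

The criterion holds for the Moyal operators because `[X², T] = 2 X [X, T] - [X, [X, T]]`: up to
bounded terms, `A⁻¹ [A², T]` is a sum of products of the bounded operator `A⁻¹ X_k` with an operator
of the same family. The operators `A⁻¹ X_k` satisfy the criterion themselves, elements satisfying it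
form an algebra, and a family closed up to left coefficients in that algebra lies in it
(`isSmoothFor_of_mem_span`). Finally `[D, T] = ∑ [X_k, T] ⊗ Γ_k` lies in the span of the same
family. -/

theorem one_add_sq_mul_sq_pos (t s : ℝ) : 0 < 1 + t ^ 2 * s ^ 2 := by positivity

theorem continuous_inv_one_add_sq_mul_sq :
    Continuous fun p : ℝ × ℝ => (1 + p.1 ^ 2 * p.2 ^ 2)⁻¹ :=
  Continuous.inv₀ (by fun_prop) fun p => (one_add_sq_mul_sq_pos p.1 p.2).ne'

theorem tendsto_mul_div_one_add_sq_atTop (s : ℝ) :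
    Filter.Tendsto (fun t : ℝ => t * s ^ 2 * (1 + t ^ 2 * s ^ 2)⁻¹) Filter.atTop (nhds 0) := by
  refine squeeze_zero' ?_ ?_ tendsto_inv_atTop_zero
  · filter_upwards [Filter.eventually_ge_atTop 0] with t ht
    have := one_add_sq_mul_sq_pos t s
    positivity
  · filter_upwards [Filter.eventually_gt_atTop 0] with t ht
    rw [← div_eq_mul_inv, div_le_iff₀ (one_add_sq_mul_sq_pos t s), mul_add, mul_one]
    have : t⁻¹ * (t ^ 2 * s ^ 2) = t * s ^ 2 := by field_simp
    rw [this]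
    have := inv_pos.2 ht
    linarith

theorem tendsto_mul_arctan_atTop {s : ℝ} (hs : 0 ≤ s) :
    Filter.Tendsto (fun t : ℝ => s * Real.arctan (t * s)) Filter.atTop
      (nhds (s * (Real.pi / 2))) := by
  rcases hs.eq_or_lt with rfl | hs
  · simp
  · exact ((tendsto_nhds_of_tendsto_nhdsWithin Real.tendsto_arctan_atTop).comp
      (Filter.tendsto_id.atTop_mul_const hs)).const_mul s

theorem hasDerivAt_mul_arctan (s t : ℝ) :
    HasDerivAt (fun t : ℝ => s * Real.arctan (t * s)) (s ^ 2 * (1 + t ^ 2 * s ^ 2)⁻¹) t := by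
  have h := (((hasDerivAt_id t).mul_const s).arctan).const_mul s
  refine h.congr_deriv ?_
  simp only [id_eq, one_div]
  rw [mul_pow]
  ring

theorem hasDerivAt_mul_div_one_add_sq (s t : ℝ) :
    HasDerivAt (fun t : ℝ => t * s ^ 2 * (1 + t ^ 2 * s ^ 2)⁻¹)
      (2 * (s ^ 2 * (1 + t ^ 2 * s ^ 2)⁻¹ ^ 2) - s ^ 2 * (1 + t ^ 2 * s ^ 2)⁻¹) t := by
  have h0 := (one_add_sq_mul_sq_pos t s).ne'
  have h1 : HasDerivAt (fun t : ℝ => 1 + t ^ 2 * s ^ 2) (2 * t * s ^ 2) t := by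
    simpa using (((hasDerivAt_pow 2 t).mul_const (s ^ 2)).const_add 1)
  have h := ((hasDerivAt_id t).mul_const (s ^ 2)).mul (h1.inv h0)
  refine h.congr_deriv ?_
  simp only [id_eq, Pi.inv_apply]
  field_simp
  ring

theorem integral_sq_mul_inv_one_add_sq {s : ℝ} (hs : 0 ≤ s) :
    ∫ t in Ioi (0 : ℝ), s ^ 2 * (1 + t ^ 2 * s ^ 2)⁻¹ = Real.pi / 2 * s := by
  rw [integral_Ioi_of_hasDerivAt_of_nonneg' (fun t _ => hasDerivAt_mul_arctan s t)
    (fun t _ => ?_) (tendsto_mul_arctan_atTop hs)]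
  · simp [mul_comm]
  · have := one_add_sq_mul_sq_pos t s
    positivity

theorem integral_sq_mul_inv_one_add_sq_sq {s : ℝ} (hs : 0 ≤ s) :
    ∫ t in Ioi (0 : ℝ), s ^ 2 * (1 + t ^ 2 * s ^ 2)⁻¹ ^ 2 = Real.pi / 4 * s := by
  -- The derivative of `t s² / (1 + t² s²)` is twice the integrand minus the derivative of `s arctan
  -- (t s)`, so half the sum of the two functions is a primitive.
  have hd : ∀ t ∈ Ici (0 : ℝ), HasDerivAt (fun t : ℝ => (t * s ^ 2 * (1 + t ^ 2 * s ^ 2)⁻¹ +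
      s * Real.arctan (t * s)) / 2) (s ^ 2 * (1 + t ^ 2 * s ^ 2)⁻¹ ^ 2) t := fun t _ => by
    refine (((hasDerivAt_mul_div_one_add_sq s t).add (hasDerivAt_mul_arctan s t)).div_const
      2).congr_deriv ?_
    ring
  rw [integral_Ioi_of_hasDerivAt_of_nonneg' hd (fun t _ => ?_)
    (((tendsto_mul_div_one_add_sq_atTop s).add (tendsto_mul_arctan_atTop hs)).div_const 2)]
  · simp; ring
  · have := one_add_sq_mul_sq_pos t s
    positivity

/-- A majorant integrable in `t` and uniform for `s` in a bounded set such as the spectrum of `S`;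
every integral over `t` below is dominated by it. -/
theorem sq_mul_inv_one_add_sq_le {s M : ℝ} (hs : s ^ 2 ≤ M) (t : ℝ) :
    s ^ 2 * (1 + t ^ 2 * s ^ 2)⁻¹ ≤ (M + 1) * (1 + t ^ 2)⁻¹ := by
  rw [← div_eq_mul_inv, ← div_eq_mul_inv, div_le_div_iff₀ (by positivity) (by positivity)]
  have : 0 ≤ M := (sq_nonneg s).trans hs
  have h2 : 0 ≤ M * (t ^ 2 * s ^ 2) := by positivity
  nlinarith

theorem inv_one_add_sq_le_one (t s : ℝ) : (1 + t ^ 2 * s ^ 2)⁻¹ ≤ 1 :=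
  inv_le_one_of_one_le₀ (by nlinarith [mul_nonneg (sq_nonneg t) (sq_nonneg s)])

theorem abs_mul_inv_one_add_sq_le (t s : ℝ) : |t * s * (1 + t ^ 2 * s ^ 2)⁻¹| ≤ 1 := by
  have h := one_add_sq_mul_sq_pos t s
  rw [← div_eq_mul_inv, abs_div, abs_of_pos h, div_le_one h, abs_le]
  constructor <;> nlinarith [sq_nonneg (t * s - 1), sq_nonneg (t * s + 1)]

/-! ### Resolvents and the integral formula in a C⋆-algebra. -/

variable {𝔅 : Type*} [CStarAlgebra 𝔅] [PartialOrder 𝔅] [StarOrderedRing 𝔅]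

/-- The bounded operator `(1 + t² S²)⁻¹`. -/
noncomputable def resolv (S : 𝔅) (t : ℝ) : 𝔅 := cfc (fun s : ℝ => (1 + t ^ 2 * s ^ 2)⁻¹) S

theorem continuous_inv_one_add_sq (t : ℝ) :
    Continuous fun s : ℝ => (1 + t ^ 2 * s ^ 2)⁻¹ :=
  continuous_inv_one_add_sq_mul_sq.comp (Continuous.prodMk_right t)

theorem cfc_sq_mul_resolv {S : 𝔅} (hS : IsSelfAdjoint S) (t : ℝ) :
    cfc (fun s : ℝ => s ^ 2 * (1 + t ^ 2 * s ^ 2)⁻¹) S = S * S * resolv S t := by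
  have := (continuous_inv_one_add_sq t).continuousOn (s := spectrum ℝ S)
  rw [cfc_mul (fun s : ℝ => s ^ 2) (fun s : ℝ => (1 + t ^ 2 * s ^ 2)⁻¹) S (by fun_prop) this,
    cfc_pow_id S, sq]
  rfl

theorem resolv_eq {S : 𝔅} (hS : IsSelfAdjoint S) (t : ℝ) :
    resolv S t = 1 - t ^ 2 • (S * S * resolv S t) := by
  have hc := (continuous_inv_one_add_sq t).continuousOn (s := spectrum ℝ S)
  rw [← cfc_sq_mul_resolv hS, ← cfc_smul _ _ _ (by fun_prop), ← cfc_one ℝ S,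
    ← cfc_sub _ _ _ (by fun_prop) (by fun_prop), resolv]
  congr 1
  ext s
  have := (one_add_sq_mul_sq_pos t s).ne'
  simp only [Pi.one_apply, smul_eq_mul]
  field_simp
  ring

theorem commute_resolv {S : 𝔅} (hS : IsSelfAdjoint S) (t : ℝ) : S * resolv S t = resolv S t * S := by
  have hc := (continuous_inv_one_add_sq t).continuousOn (s := spectrum ℝ S)
  conv_lhs => enter [1]; rw [← cfc_id ℝ S]
  conv_rhs => enter [2]; rw [← cfc_id ℝ S]
  exact cfc_commute_cfc _ _ _

/-- The commutator of `T` with `S² (1 + t² S²)⁻¹`. -/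
theorem commutator_sq_mul_resolv {S : 𝔅} (hS : IsSelfAdjoint S) {T U : 𝔅}
    (h : T * (S * S) - S * S * T = S * U * (S * S)) (t : ℝ) :
    T * (S * S * resolv S t) - S * S * resolv S t * T =
      resolv S t * S * U * (S * S * resolv S t) := by
  have hE := resolv_eq hS t
  have hc : resolv S t * (S * S) = S * S * resolv S t := by
    rw [← mul_assoc, ← commute_resolv hS, mul_assoc, ← commute_resolv hS, mul_assoc]
  -- With `E` the resolvent, `E = 1 - t² S² E`. The two copies of `t² S² E T S² E` inserted here
  -- cancel, and the commutator becomes `E (T S² - S² T) E`.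
  calc T * (S * S * resolv S t) - S * S * resolv S t * T
      = (1 - t ^ 2 • (S * S * resolv S t)) * T * (S * S * resolv S t) -
        S * S * resolv S t * T * (1 - t ^ 2 • (S * S * resolv S t)) := by
        simp only [sub_mul, mul_sub, one_mul, mul_one, smul_mul_assoc, mul_smul_comm, mul_assoc]
        abel
    _ = resolv S t * (T * (S * S) - S * S * T) * resolv S t := by
        rw [← hE, ← hc]
        rw [hc]
        simp only [mul_sub, sub_mul]
        rw [← hc]
        simp only [mul_assoc]
        rw [← mul_assoc S S (resolv S t), ← hc]
    _ = _ := by rw [h]; simp only [mul_assoc]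

/-- In `E S U S² E` the left factor `E` obstructs integration: after splitting off `S` on both
sides, the norm estimate for `E U (S E)` decays only like `1/t`. Moving `E` past `U` gives a main
term whose integral is known exactly, and an error carrying `t²`, since `E = 1 - t² S² E`. That `t²`
is shared between two factors `S E`, because `t S E` is bounded uniformly in `t`. -/
theorem commutator_expansion {S : 𝔅} (hS : IsSelfAdjoint S) {T U V : 𝔅}
    (h : T * (S * S) - S * S * T = S * U * (S * S))
    (h' : U * (S * S) - S * S * U = S * V * (S * S)) (t : ℝ) :
    T * (S * S * resolv S t) - S * S * resolv S t * T =
      S * U * (S * S * resolv S t * resolv S t) +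
      S * ((t • (S * resolv S t)) * V *
        (t • (S * S * S * resolv S t * resolv S t))) * S := by
  have hE := resolv_eq hS t
  have hcS := commute_resolv hS t
  have hc : resolv S t * (S * S) = S * S * resolv S t := by
    rw [← mul_assoc, ← hcS, mul_assoc, ← hcS, mul_assoc]
  have h2 := commutator_sq_mul_resolv hS h' t
  have hEU : resolv S t * U = U * resolv S t +
      t ^ 2 • (resolv S t * S * V * (S * S * resolv S t)) := by
    rw [← h2, smul_sub]
    conv_lhs => rw [hE]
    conv_rhs => enter [1]; rw [hE]
    simp only [sub_mul, mul_sub, one_mul, mul_one, smul_mul_assoc, mul_smul_comm]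
    abel
  rw [commutator_sq_mul_resolv hS h t, ← hcS, mul_assoc S, hEU]
  have e1 : resolv S t * S = S * resolv S t := hcS.symm
  have e2 : ∀ x, resolv S t * (S * x) = S * (resolv S t * x) := fun x => by
    rw [← mul_assoc, e1, mul_assoc]
  simp only [mul_add, add_mul, smul_mul_assoc, mul_smul_comm, smul_smul, sq, mul_assoc, e1, e2]

theorem continuous_resolv (S : 𝔅) : Continuous (resolv S) := by
  refine continuous_iff_continuousAt.2 fun t => continuousAt_cfc_fun ?_
    (.of_forall fun t => (continuous_inv_one_add_sq t).continuousOn)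
  have hc : CompactSpace (spectrum ℝ S) := isCompact_iff_compactSpace.1 (spectrum.isCompact S)
  rw [tendstoUniformlyOn_iff_tendstoUniformly_comp_coe]
  refine Continuous.tendstoUniformly (fun t (s : spectrum ℝ S) => (1 + t ^ 2 * (s : ℝ) ^ 2)⁻¹) ?_ t
  exact continuous_inv_one_add_sq_mul_sq.comp
    (continuous_fst.prodMk (continuous_subtype_val.comp continuous_snd))

theorem norm_smul_mul_resolv_le {S : 𝔅} (hS : IsSelfAdjoint S) (t : ℝ) :
    ‖t • (S * resolv S t)‖ ≤ 1 := by
  have hc := (continuous_inv_one_add_sq t).continuousOn (s := spectrum ℝ S)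
  have : t • (S * resolv S t) = cfc (fun s : ℝ => t * s * (1 + t ^ 2 * s ^ 2)⁻¹) S := by
    rw [cfc_mul (fun s : ℝ => t * s) (fun s : ℝ => (1 + t ^ 2 * s ^ 2)⁻¹) S (by fun_prop) hc,
      cfc_const_mul_id t S, smul_mul_assoc]
    rfl
  rw [this]
  exact norm_cfc_le zero_le_one fun s _ => abs_mul_inv_one_add_sq_le t s

theorem sq_le_of_mem_spectrum {S : 𝔅} {s : ℝ} (hs : s ∈ spectrum ℝ S) :
    s ^ 2 ≤ (‖S‖ * ‖(1 : 𝔅)‖) ^ 2 := by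
  have := spectrum.norm_le_norm_mul_of_mem hs
  exact sq_le_sq' (by linarith [neg_abs_le s, Real.norm_eq_abs s]) ((le_abs_self s).trans this)

theorem norm_sq_mul_inv_le {S : 𝔅} {s : ℝ} (hs : s ∈ spectrum ℝ S) (t : ℝ) :
    ‖s ^ 2 * (1 + t ^ 2 * s ^ 2)⁻¹‖ ≤ ((‖S‖ * ‖(1 : 𝔅)‖) ^ 2 + 1) * (1 + t ^ 2)⁻¹ := by
  have := one_add_sq_mul_sq_pos t s
  rw [Real.norm_of_nonneg (by positivity)]
  exact sq_mul_inv_one_add_sq_le (sq_le_of_mem_spectrum hs) t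

theorem norm_sq_mul_resolv_le {S : 𝔅} (hS : IsSelfAdjoint S) (t : ℝ) :
    ‖S * S * resolv S t‖ ≤ ((‖S‖ * ‖(1 : 𝔅)‖) ^ 2 + 1) * (1 + t ^ 2)⁻¹ := by
  rw [← cfc_sq_mul_resolv hS]
  exact norm_cfc_le (by positivity) fun s hs => norm_sq_mul_inv_le hs t

theorem integrableOn_bound (c : ℝ) :
    HasFiniteIntegral (fun t : ℝ => c * (1 + t ^ 2)⁻¹) (volume.restrict (Ioi 0)) :=
  (integrable_inv_one_add_sq.const_mul c).restrict.2

/-- The functional calculus commutes with the integral, and the scalar integral is `(π/2) s` for `s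
≥ 0`; this is where positivity of `S` enters. -/
theorem integral_sq_mul_resolv {S : 𝔅} (hS : 0 ≤ S) :
    ∫ t in Ioi (0 : ℝ), S * S * resolv S t = (Real.pi / 2) • S := by
  have hS' := IsSelfAdjoint.of_nonneg hS
  simp_rw [← cfc_sq_mul_resolv hS']
  rw [← cfc_integral (fun t s : ℝ => s ^ 2 * (1 + t ^ 2 * s ^ 2)⁻¹) _ S
    (Continuous.continuousOn (by have := continuous_inv_one_add_sq_mul_sq; unfold Function.uncurry; fun_prop))
    (.of_forall fun t s hs => norm_sq_mul_inv_le hs t) (integrableOn_bound _),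
    ← cfc_const_mul_id (Real.pi / 2) S]
  exact cfc_congr fun s hs => integral_sq_mul_inv_one_add_sq (spectrum_nonneg_of_nonneg hS hs)

theorem cfc_sq_mul_resolv_sq {S : 𝔅} (hS : IsSelfAdjoint S) (t : ℝ) :
    cfc (fun s : ℝ => s ^ 2 * (1 + t ^ 2 * s ^ 2)⁻¹ ^ 2) S = S * S * resolv S t * resolv S t := by
  have hc := (continuous_inv_one_add_sq t).continuousOn (s := spectrum ℝ S)
  rw [← cfc_sq_mul_resolv hS, resolv, ← cfc_mul _ _ _ (by fun_prop) hc]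
  congr 1
  ext s
  ring

theorem norm_sq_mul_inv_sq_le {S : 𝔅} {s : ℝ} (hs : s ∈ spectrum ℝ S) (t : ℝ) :
    ‖s ^ 2 * (1 + t ^ 2 * s ^ 2)⁻¹ ^ 2‖ ≤ ((‖S‖ * ‖(1 : 𝔅)‖) ^ 2 + 1) * (1 + t ^ 2)⁻¹ := by
  refine le_trans ?_ (norm_sq_mul_inv_le hs t)
  have h := one_add_sq_mul_sq_pos t s
  rw [sq (1 + t ^ 2 * s ^ 2)⁻¹, ← mul_assoc, norm_mul]
  refine mul_le_of_le_one_right (norm_nonneg _) ?_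
  rw [Real.norm_of_nonneg (by positivity)]
  exact inv_one_add_sq_le_one t s

theorem integral_sq_mul_resolv_sq {S : 𝔅} (hS : 0 ≤ S) :
    ∫ t in Ioi (0 : ℝ), S * S * resolv S t * resolv S t = (Real.pi / 4) • S := by
  have hS' := IsSelfAdjoint.of_nonneg hS
  simp_rw [← cfc_sq_mul_resolv_sq hS']
  rw [← cfc_integral (fun t s : ℝ => s ^ 2 * (1 + t ^ 2 * s ^ 2)⁻¹ ^ 2) _ S
    (Continuous.continuousOn (by have := continuous_inv_one_add_sq_mul_sq; unfold Function.uncurry; fun_prop))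
    (.of_forall fun t s hs => norm_sq_mul_inv_sq_le hs t) (integrableOn_bound _),
    ← cfc_const_mul_id (Real.pi / 4) S]
  exact cfc_congr fun s hs => integral_sq_mul_inv_one_add_sq_sq (spectrum_nonneg_of_nonneg hS hs)

/-- If the commutators of `T` with `S²` are controlled to second order, then so is the commutator
of `T` with `S`. -/
theorem exists_commutator_of_sq_commutators {S : 𝔅} (hS : 0 ≤ S) {T U V : 𝔅}
    (h : T * (S * S) - S * S * T = S * U * (S * S))
    (h' : U * (S * S) - S * S * U = S * V * (S * S)) :
    ∃ C : 𝔅, T * S - S * T = S * C * S := by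
  have hS' := IsSelfAdjoint.of_nonneg hS
  have hcE := continuous_resolv S
  have hbd : Integrable (fun t : ℝ => ((‖S‖ * ‖(1 : 𝔅)‖) ^ 2 + 1) * (1 + t ^ 2)⁻¹)
      (volume.restrict (Ioi 0)) := (integrable_inv_one_add_sq.const_mul _).restrict
  have hi1 : Integrable (fun t : ℝ => S * S * resolv S t) (volume.restrict (Ioi 0)) :=
    hbd.mono' (by fun_prop) (.of_forall fun t => norm_sq_mul_resolv_le hS' t)
  have hi2 : Integrable (fun t : ℝ => S * S * resolv S t * resolv S t)
      (volume.restrict (Ioi 0)) := by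
    refine hbd.mono' (by fun_prop) (.of_forall fun t => ?_)
    rw [← cfc_sq_mul_resolv_sq hS']
    exact norm_cfc_le (by positivity) fun s hs => norm_sq_mul_inv_sq_le hs t
  -- Two factors `t S E` have norm at most one, and the remaining `S² E` has an integrable norm.
  have hi3 : Integrable (fun t : ℝ => (t • (S * resolv S t)) * V *
        (t • (S * S * S * resolv S t * resolv S t))) (volume.restrict (Ioi 0)) := by
    refine (hbd.const_mul ‖V‖).mono' (by fun_prop) (.of_forall fun t => ?_)
    have e : t • (S * S * S * resolv S t * resolv S t) =
        (t • (S * resolv S t)) * (S * S * resolv S t) := by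
      have e1 : resolv S t * S = S * resolv S t := (commute_resolv hS' t).symm
      have e2 : ∀ x, resolv S t * (S * x) = S * (resolv S t * x) := fun x => by
        rw [← mul_assoc, e1, mul_assoc]
      simp only [smul_mul_assoc, mul_assoc, e2]
    rw [e]
    refine (norm_mul_le _ _).trans (mul_le_mul ((norm_mul_le _ _).trans ?_)
      ((norm_mul_le _ _).trans ?_) (norm_nonneg _) (norm_nonneg _))
    · exact mul_le_of_le_one_left (norm_nonneg _) (norm_smul_mul_resolv_le hS' t)
    · exact (mul_le_of_le_one_left (norm_nonneg _) (norm_smul_mul_resolv_le hS' t)).trans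
        (norm_sq_mul_resolv_le hS' t)
  -- The integral of the left side of the expansion is `(π/2) (T S - S T)`, that of the main term is
  -- `(π/4) S U S`; dividing by `π/2` leaves `U / 2` and `2/π` times the error integral.
  refine ⟨(2⁻¹ : ℝ) • U + (2 / Real.pi) • ∫ t in Ioi (0 : ℝ), (t • (S * resolv S t)) * V *
        (t • (S * S * S * resolv S t * resolv S t)), ?_⟩
  have key : (Real.pi / 2) • (T * S - S * T) = S * U * ((Real.pi / 4) • S) +
      S * (∫ t in Ioi (0 : ℝ), (t • (S * resolv S t)) * V *
        (t • (S * S * S * resolv S t * resolv S t))) * S := by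
    rw [smul_sub, ← mul_smul_comm, ← smul_mul_assoc, ← integral_sq_mul_resolv hS,
      ← integral_sq_mul_resolv_sq hS, ← integral_const_mul_of_integrable hi1,
      ← integral_mul_const_of_integrable hi1, ← integral_sub (hi1.const_mul _)
      (hi1.mul_const _), ← integral_const_mul_of_integrable hi2,
      ← integral_const_mul_of_integrable hi3,
      ← integral_mul_const_of_integrable (hi3.const_mul _),
      ← integral_add (hi2.const_mul _) ((hi3.const_mul _).mul_const _)]
    exact integral_congr_ae (.of_forall fun t => commutator_expansion hS' h h' t)
  have hpi := Real.pi_ne_zero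
  have : T * S - S * T = (2 / Real.pi) • ((Real.pi / 2) • (T * S - S * T)) := by
    rw [smul_smul, div_mul_div_cancel₀ hpi, div_self two_ne_zero, one_smul]
  rw [this, key, smul_add, mul_add, add_mul]
  congr 1
  · simp only [mul_smul_comm, smul_mul_assoc, smul_smul]
    congr 1
    field_simp
    norm_num
  · simp only [mul_smul_comm, smul_mul_assoc]

end SquareRootCommutator

end MoyalOscillator

namespace MoyalOscillator

open MeasureTheory

/-! ### The algebra of elements that are smooth with respect to `S` -/

section SmoothAlgebra

set_option linter.unusedSectionVars false

variable {𝔅 : Type*} [CStarAlgebra 𝔅] [PartialOrder 𝔅] [StarOrderedRing 𝔅]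

/-- With `A = S⁻¹`, this says that `U = A⁻¹ [A², T]`. -/
def IsOrderOneCommutator (S T U : 𝔅) : Prop := T * (S * S) - S * S * T = S * U * (S * S)

/-- All iterates of `T ↦ A⁻¹ [A², T]` are defined on `T`, where `A = S⁻¹`. -/
def IsSmoothFor (S T : 𝔅) : Prop :=
  ∃ u : ℕ → 𝔅, u 0 = T ∧ ∀ k, IsOrderOneCommutator S (u k) (u (k + 1))

theorem IsSmoothFor.exists_next {S T : 𝔅} (h : IsSmoothFor S T) :
    ∃ U, IsOrderOneCommutator S T U ∧ IsSmoothFor S U := by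
  obtain ⟨u, rfl, hu⟩ := h
  exact ⟨u 1, hu 0, fun k => u (k + 1), rfl, fun k => hu (k + 1)⟩

/-- A set on which `T ↦ A⁻¹ [A², T]` is defined and which it preserves consists of smooth
elements. -/
theorem isSmoothFor_of_invariant {S : 𝔅} {𝒜 : Set 𝔅}
    (h𝒜 : ∀ T ∈ 𝒜, ∃ U ∈ 𝒜, IsOrderOneCommutator S T U) {T : 𝔅} (hT : T ∈ 𝒜) :
    IsSmoothFor S T := by
  choose! next hnext hcomm using h𝒜
  have hmem : ∀ k, next^[k] T ∈ 𝒜 := fun k => by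
    induction k with
    | zero => exact hT
    | succ k ih => rw [Function.iterate_succ_apply']; exact hnext _ ih
  refine ⟨fun k => next^[k] T, rfl, fun k => ?_⟩
  simp only [Function.iterate_succ_apply']
  exact hcomm _ (hmem k)

/-- The maps `[A, ·]` and `A⁻¹ [A², ·]` commute. Hence if `u` is the chain of iterates of `T`, the
elements `[A, u k]` form a chain for `[A, T]`. In terms of `S` the identity appears multiplied by
`S` on both sides, which is why cancellation is assumed. -/
theorem IsSmoothFor.exists_commutator {S T : 𝔅} (hS : 0 ≤ S)
    (hcan : ∀ X : 𝔅, S * X * S = 0 → X = 0) (h : IsSmoothFor S T) :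
    ∃ C, IsSmoothFor S C ∧ T * S - S * T = S * C * S := by
  obtain ⟨u, rfl, hu⟩ := h
  have hC := fun k => exists_commutator_of_sq_commutators hS (hu k) (hu (k + 1))
  choose C hC using hC
  refine ⟨C 0, ⟨C, rfl, fun k => ?_⟩, hC 0⟩
  rw [IsOrderOneCommutator, ← sub_eq_zero]
  apply hcan
  have h1 := hu k
  have h2 := hC k
  have h3 := hC (k + 1)
  rw [IsOrderOneCommutator] at h1
  have h2' : u k * S = S * u k + S * C k * S := by rw [← h2]; abel
  have h3' : u (k + 1) * S = S * u (k + 1) + S * C (k + 1) * S := by rw [← h3]; abel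
  calc S * (C k * (S * S) - S * S * C k - S * C (k + 1) * (S * S)) * S
      = (S * C k * S) * (S * S) - S * S * (S * C k * S) -
          S * (S * C (k + 1) * S) * (S * S) := by
        simp only [mul_sub, sub_mul, mul_assoc]
    _ = (u k * (S * S) - S * S * u k) * S - S * (u k * (S * S) - S * S * u k) -
          S * (u (k + 1) * S - S * u (k + 1)) * (S * S) := by
        rw [← h2, ← h3]
        simp only [mul_sub, sub_mul, mul_assoc]
        abel
    _ = 0 := by
        rw [h1]
        simp only [mul_sub, sub_mul, mul_assoc]
        abel

/-- The Leibniz rule. `[A², T T']` contains `T A U'`, and moving `A` to the left of `T` costs the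
first order commutator `C`; so `C` and `S` occur next to the expected terms `U T'` and `T U'`. -/
theorem IsOrderOneCommutator.mul {S T T' U U' C : 𝔅} (h : IsOrderOneCommutator S T U)
    (h' : IsOrderOneCommutator S T' U') (hC : T * S - S * T = S * C * S) :
    IsOrderOneCommutator S (T * T') (U * T' - U * S * U' + T * U' + C * S * U') := by
  rw [IsOrderOneCommutator] at *
  have e1 : S * S * T' = T' * (S * S) - S * U' * (S * S) := by rw [← h']; abel
  have e2 : T * S = S * T + S * C * S := by rw [← hC]; abel
  calc T * T' * (S * S) - S * S * (T * T')
      = T * (T' * (S * S) - S * S * T') + (T * (S * S) - S * S * T) * T' := by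
        simp only [mul_sub, sub_mul, mul_assoc]; abel
    _ = (T * S) * U' * (S * S) + S * U * (S * S * T') := by
        rw [h, h']; simp only [mul_assoc]
    _ = _ := by
        rw [e1, e2]
        simp only [mul_sub, sub_mul, mul_add, add_mul, mul_assoc]
        abel

theorem isOrderOneCommutator_of_commute {S T : 𝔅} (h : T * (S * S) = S * S * T) :
    IsOrderOneCommutator S T 0 := by
  simp [IsOrderOneCommutator, h]

theorem isSmoothFor_of_commute {S T : 𝔅} (h : T * (S * S) = S * S * T) : IsSmoothFor S T := by
  refine isSmoothFor_of_invariant (𝒜 := {T, 0}) ?_ (by simp)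
  rintro X (rfl | rfl)
  · exact ⟨0, by simp, isOrderOneCommutator_of_commute h⟩
  · exact ⟨0, by simp, by simp [IsOrderOneCommutator]⟩

theorem IsOrderOneCommutator.add {S T T' U U' : 𝔅} (h : IsOrderOneCommutator S T U)
    (h' : IsOrderOneCommutator S T' U') : IsOrderOneCommutator S (T + T') (U + U') := by
  rw [IsOrderOneCommutator] at *
  rw [mul_add S, add_mul (S * U), ← h, ← h']
  noncomm_ring

/-- Because of the terms with `C` and `S`, closure under products cannot be read off from the chains
of the two factors alone. Instead the whole generated algebra is shown to be stable, simultaneously,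
under `A⁻¹ [A², ·]` and `[A, ·]`: both properties hold on generators and pass to sums and products.
-/
theorem isSmoothFor_of_mem_adjoin {S T : 𝔅} (hS : 0 ≤ S)
    (hcan : ∀ X : 𝔅, S * X * S = 0 → X = 0)
    (h : T ∈ Algebra.adjoin ℂ {T : 𝔅 | IsSmoothFor S T}) : IsSmoothFor S T := by
  set 𝒦 := Algebra.adjoin ℂ {T : 𝔅 | IsSmoothFor S T}
  have hS𝒦 : S ∈ 𝒦 := Algebra.subset_adjoin (isSmoothFor_of_commute (mul_assoc S S S).symm)
  suffices ∀ T ∈ 𝒦, (∃ U ∈ 𝒦, IsOrderOneCommutator S T U) ∧ ∃ C ∈ 𝒦, T * S - S * T = S * C * S from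
    isSmoothFor_of_invariant (fun T hT => (this T hT).1) h
  intro T hT
  induction hT using Algebra.adjoin_induction with
  | mem T hT =>
    obtain ⟨U, hU, hU'⟩ := IsSmoothFor.exists_next hT
    obtain ⟨C, hC, hC'⟩ := IsSmoothFor.exists_commutator hS hcan hT
    exact ⟨⟨U, Algebra.subset_adjoin hU', hU⟩, C, Algebra.subset_adjoin hC, hC'⟩
  | algebraMap c =>
    refine ⟨⟨0, zero_mem _, isOrderOneCommutator_of_commute (Algebra.commutes _ _)⟩,
      0, zero_mem _, ?_⟩
    rw [Algebra.commutes]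
    simp
  | add T T' _ _ h h' =>
    obtain ⟨⟨U, hU, hTU⟩, C, hC, hTC⟩ := h
    obtain ⟨⟨U', hU', hTU'⟩, C', hC', hTC'⟩ := h'
    refine ⟨⟨U + U', add_mem hU hU', hTU.add hTU'⟩, C + C', add_mem hC hC', ?_⟩
    rw [mul_add S C, add_mul (S * C), ← hTC, ← hTC']
    noncomm_ring
  | mul T T' hT hT' h h' =>
    obtain ⟨⟨U, hU, hTU⟩, C, hC, hTC⟩ := h
    obtain ⟨⟨U', hU', hTU'⟩, C', hC', hTC'⟩ := h'
    refine ⟨⟨_, add_mem (add_mem (sub_mem (mul_mem hU hT')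
      (mul_mem (mul_mem hU hS𝒦) hU')) (mul_mem hT hU')) (mul_mem (mul_mem hC hS𝒦) hU'),
      hTU.mul hTU' hTC⟩, T * C' + C * T', add_mem (mul_mem hT hC') (mul_mem hC hT'), ?_⟩
    have e1 : T * S = S * T + S * C * S := by rw [← hTC]; abel
    calc T * T' * S - S * (T * T') = T * (T' * S - S * T') + (T * S - S * T) * T' := by
          noncomm_ring
      _ = (T * S) * C' * S + S * C * (S * T') := by rw [hTC, hTC']; noncomm_ring
      _ = (T * S) * C' * S + S * C * (T' * S - S * C' * S) := by rw [← hTC']; noncomm_ring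
      _ = _ := by rw [e1]; noncomm_ring

/-- The algebra of smooth elements. -/
def smoothSubalgebra {S : 𝔅} (hS : 0 ≤ S) (hcan : ∀ X : 𝔅, S * X * S = 0 → X = 0) :
    Subalgebra ℂ 𝔅 where
  carrier := {T | IsSmoothFor S T}
  mul_mem' ha hb := isSmoothFor_of_mem_adjoin hS hcan
    (mul_mem (Algebra.subset_adjoin ha) (Algebra.subset_adjoin hb))
  add_mem' ha hb := isSmoothFor_of_mem_adjoin hS hcan
    (add_mem (Algebra.subset_adjoin ha) (Algebra.subset_adjoin hb))
  algebraMap_mem' c := isSmoothFor_of_mem_adjoin hS hcan (Subalgebra.algebraMap_mem _ c)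

/-- A set `𝒢` such that `A⁻¹ [A², G]`, for `G ∈ 𝒢`, is a combination of elements of `𝒢` with smooth
coefficients on the left consists of smooth elements. -/
theorem isSmoothFor_of_mem_span {S : 𝔅} (hS : 0 ≤ S) (hcan : ∀ X : 𝔅, S * X * S = 0 → X = 0)
    {𝒢 : Set 𝔅} (h𝒢 : ∀ G ∈ 𝒢, ∃ U ∈ Submodule.span (smoothSubalgebra hS hcan) 𝒢,
      IsOrderOneCommutator S G U) {T : 𝔅}
    (hT : T ∈ Submodule.span (smoothSubalgebra hS hcan) 𝒢) : IsSmoothFor S T := by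
  have hS𝒦 : S ∈ smoothSubalgebra hS hcan := isSmoothFor_of_commute (mul_assoc S S S).symm
  have hmul : ∀ {K X : 𝔅}, K ∈ smoothSubalgebra hS hcan →
      X ∈ Submodule.span (smoothSubalgebra hS hcan) 𝒢 →
      K * X ∈ Submodule.span (smoothSubalgebra hS hcan) 𝒢 := fun {K X} hK hX =>
    Submodule.smul_mem _ (⟨K, hK⟩ : smoothSubalgebra hS hcan) hX
  refine isSmoothFor_of_invariant (fun T hT => ?_) hT
  induction hT using Submodule.span_induction with
  | mem T hT => exact h𝒢 T hT
  | zero => exact ⟨0, zero_mem _, by simp [IsOrderOneCommutator]⟩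
  | add T T' _ _ h h' =>
    obtain ⟨U, hU, hTU⟩ := h
    obtain ⟨U', hU', hTU'⟩ := h'
    exact ⟨U + U', add_mem hU hU', hTU.add hTU'⟩
  | smul K T hT h =>
    obtain ⟨U', hU', hTU'⟩ := h
    obtain ⟨U, hU, hU𝒦⟩ := IsSmoothFor.exists_next (S := S) K.2
    obtain ⟨C, hC, hKC⟩ := IsSmoothFor.exists_commutator hS hcan K.2
    -- Everything the Leibniz rule places to the left of `T` and `U'` is smooth, so the result stays
    -- in the span with left coefficients.
    exact ⟨_, add_mem (add_mem (sub_mem (hmul hU𝒦 hT) (hmul (mul_mem hU𝒦 hS𝒦) hU'))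
      (hmul K.2 hU')) (hmul (mul_mem hC hS𝒦) hU'), hU.mul hTU' hKC⟩

end SmoothAlgebra

end MoyalOscillator

namespace MoyalOscillator

open MeasureTheory

/-! ### Self-adjointness and the bracket of an operator given on a core -/

section CoreOperator

set_option linter.unusedSectionVars false

variable {V : Type*} [NormedAddCommGroup V] [InnerProductSpace ℂ V]

/-- Membership in the graph, as an equation. -/
theorem exists_domain_of_mem_graph {D : V →ₗ.[ℂ] V} {x y : V} (h : (x, y) ∈ D.graph) :
    ∃ hx : x ∈ D.domain, D ⟨x, hx⟩ = y := by
  obtain ⟨z, hz, hz'⟩ := (LinearPMap.mem_graph_iff D).1 h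
  simp only at hz hz'
  subst hz
  exact ⟨z.2, hz'⟩

variable [CompleteSpace V]

/-- A symmetric operator `D` such that `D + c` and `D + c̄` are surjective is self-adjoint. -/
theorem isSelfAdjoint_of_surjective {D : V →ₗ.[ℂ] V} (hdense : Dense (D.domain : Set V))
    (hsymm : ∀ x y x' y', (x, y) ∈ D.graph → (x', y') ∈ D.graph → inner ℂ y x' = inner ℂ x y')
    (c : ℂ) (h₁ : ∀ z, ∃ x y, (x, y) ∈ D.graph ∧ y + c • x = z)
    (h₂ : ∀ z, ∃ x y, (x, y) ∈ D.graph ∧ y + (starRingEnd ℂ) c • x = z) : IsSelfAdjoint D := by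
  have hle : D ≤ D.adjoint := LinearPMap.IsFormalAdjoint.le_adjoint hdense
    fun x y => hsymm _ _ _ _ (D.mem_graph x) (D.mem_graph y)
  refine le_antisymm (LinearPMap.le_of_le_graph ?_) hle
  rintro ⟨y, z⟩ hyz
  obtain ⟨hy, rfl⟩ := exists_domain_of_mem_graph hyz
  -- Here `(D + c) w = (D⋆ + c) y`. Then `y - w` is orthogonal to the range of `D + c̄`, which is
  -- everything; `x` is chosen so that `y - w` is tested against itself.
  obtain ⟨w, v, hwv, hw⟩ := h₁ (D.adjoint ⟨y, hy⟩ + c • y)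
  obtain ⟨x, u, hxu, hx⟩ := h₂ (y - w)
  obtain ⟨hx', rfl⟩ := exists_domain_of_mem_graph hxu
  have h3 : inner ℂ (D ⟨x, hx'⟩) y = inner ℂ x (D.adjoint ⟨y, hy⟩) := by
    have := LinearPMap.adjoint_isFormalAdjoint hdense ⟨y, hy⟩ ⟨x, hx'⟩
    rw [← inner_conj_symm, ← this, inner_conj_symm]
  have h4 := hsymm _ _ _ _ hxu hwv
  have hz : inner ℂ (y - w) (y - w) = 0 := by
    nth_rewrite 1 [← hx]
    have e : inner ℂ x (D.adjoint ⟨y, hy⟩ + c • y) = inner ℂ x (v + c • w) := by rw [hw]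
    simp only [inner_add_right, inner_smul_right] at e
    simp only [inner_add_left, inner_sub_right, inner_smul_left, h3, h4, RingHomCompTriple.comp_apply,
      RingHom.id_apply]
    linear_combination e
  have hyw : y = w := sub_eq_zero.1 (inner_self_eq_zero.1 hz)
  subst hyw
  have : v = D.adjoint ⟨y, hy⟩ := add_right_cancel hw
  exact this ▸ hwv

/-! ### Closures of symmetric core operators, their resolvents and brackets. -/

variable {𝒮 : Type*} [AddCommGroup 𝒮] [Module ℂ 𝒮]

/-- `D` is the closure of the symmetric operator `D₀`, which is defined on the space `𝒮` embedded
into `V` by `j`, and `D₀² + 1` has dense range. -/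
structure IsClosureOf (j : 𝒮 →ₗ[ℂ] V) (D₀ : 𝒮 →ₗ[ℂ] 𝒮) (D : V →ₗ.[ℂ] V) : Prop where
  dense : DenseRange j
  symm : ∀ φ ψ, inner ℂ (j (D₀ φ)) (j ψ) = inner ℂ (j φ) (j (D₀ ψ))
  dense_sq : DenseRange (j ∘ₗ (D₀ * D₀ + 1))
  graph_eq : (D.graph : Set (V × V)) = closure (Set.range fun ψ => (j ψ, j (D₀ ψ)))

/-- The bounded operator `(D² + 1)⁻¹`. -/
noncomputable def sqResolvent (j : 𝒮 →ₗ[ℂ] V) (D₀ : 𝒮 →ₗ[ℂ] 𝒮) : V →L[ℂ] V :=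
  j.extendOfNorm (j ∘ₗ (D₀ * D₀ + 1))

/-- The bounded operator `D (D² + 1)⁻¹`. -/
noncomputable def mulSqResolvent (j : 𝒮 →ₗ[ℂ] V) (D₀ : 𝒮 →ₗ[ℂ] 𝒮) : V →L[ℂ] V :=
  (j ∘ₗ D₀).extendOfNorm (j ∘ₗ (D₀ * D₀ + 1))

namespace IsClosureOf

variable {j : 𝒮 →ₗ[ℂ] V} {D₀ : 𝒮 →ₗ[ℂ] 𝒮} {D : V →ₗ.[ℂ] V}

theorem inner_sq_add_one (h : IsClosureOf j D₀ D) (ψ : 𝒮) :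
    inner ℂ (j ψ) (j (D₀ (D₀ ψ) + ψ)) = ((‖j (D₀ ψ)‖ ^ 2 + ‖j ψ‖ ^ 2 : ℝ) : ℂ) := by
  rw [map_add, inner_add_right, ← h.symm, inner_self_eq_norm_sq_to_K, inner_self_eq_norm_sq_to_K]
  push_cast
  rfl

/-- Symmetry evaluates `⟨ψ, (D² + 1) ψ⟩`, and Cauchy–Schwarz does the rest. The two a priori bounds
drawn from this let `(D² + 1)⁻¹` and `D (D² + 1)⁻¹` extend from the dense range of `D₀² + 1`. -/
theorem norm_sq_add_norm_sq_le (h : IsClosureOf j D₀ D) (ψ : 𝒮) :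
    ‖j (D₀ ψ)‖ ^ 2 + ‖j ψ‖ ^ 2 ≤ ‖j ψ‖ * ‖j (D₀ (D₀ ψ) + ψ)‖ := by
  have := norm_inner_le_norm (𝕜 := ℂ) (j ψ) (j (D₀ (D₀ ψ) + ψ))
  rw [h.inner_sq_add_one, Complex.norm_real, Real.norm_of_nonneg (by positivity)] at this
  exact this

theorem norm_le (h : IsClosureOf j D₀ D) (ψ : 𝒮) :
    ‖j ψ‖ ≤ 1 * ‖(j ∘ₗ (D₀ * D₀ + 1)) ψ‖ := by
  have := h.norm_sq_add_norm_sq_le ψ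
  change ‖j ψ‖ ≤ 1 * ‖j (D₀ (D₀ ψ) + ψ)‖
  by_contra! hlt
  nlinarith [sq_nonneg ‖j (D₀ ψ)‖, norm_nonneg (j ψ), norm_nonneg (j (D₀ (D₀ ψ) + ψ))]

theorem norm_apply_le (h : IsClosureOf j D₀ D) (ψ : 𝒮) :
    ‖(j ∘ₗ D₀) ψ‖ ≤ 1 * ‖(j ∘ₗ (D₀ * D₀ + 1)) ψ‖ := by
  have h1 := h.norm_sq_add_norm_sq_le ψ
  have h2 := h.norm_le ψ
  change ‖j (D₀ ψ)‖ ≤ 1 * ‖j (D₀ (D₀ ψ) + ψ)‖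
  change ‖j ψ‖ ≤ 1 * ‖j (D₀ (D₀ ψ) + ψ)‖ at h2
  rw [one_mul] at *
  refine le_of_sq_le_sq ?_ (norm_nonneg _)
  nlinarith [sq_nonneg ‖j ψ‖, norm_nonneg (j ψ), norm_nonneg (j (D₀ (D₀ ψ) + ψ))]

theorem sqResolvent_apply (h : IsClosureOf j D₀ D) (ψ : 𝒮) :
    sqResolvent j D₀ (j (D₀ (D₀ ψ) + ψ)) = j ψ :=
  LinearMap.extendOfNorm_eq h.dense_sq ⟨1, h.norm_le⟩ ψ

theorem mulSqResolvent_apply (h : IsClosureOf j D₀ D) (ψ : 𝒮) :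
    mulSqResolvent j D₀ (j (D₀ (D₀ ψ) + ψ)) = j (D₀ ψ) :=
  LinearMap.extendOfNorm_eq h.dense_sq ⟨1, h.norm_apply_le⟩ ψ

theorem dense_sq' (h : IsClosureOf j D₀ D) : DenseRange fun ψ => j (D₀ (D₀ ψ) + ψ) := h.dense_sq

theorem isClosed_graph (h : IsClosureOf j D₀ D) : IsClosed (D.graph : Set (V × V)) := by
  rw [h.graph_eq]; exact isClosed_closure

theorem mem_graph (h : IsClosureOf j D₀ D) (ψ : 𝒮) : (j ψ, j (D₀ ψ)) ∈ D.graph := by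
  rw [← SetLike.mem_coe, h.graph_eq]
  exact subset_closure ⟨ψ, rfl⟩

/-- A closed condition that holds for pairs `(ψ, D₀ ψ)` holds on the graph of `D`. -/
theorem graph_induction (h : IsClosureOf j D₀ D) {P : V → V → Prop}
    (hP : IsClosed {p : V × V | P p.1 p.2}) (hcore : ∀ ψ, P (j ψ) (j (D₀ ψ))) {x y : V}
    (hxy : (x, y) ∈ D.graph) : P x y := by
  rw [← SetLike.mem_coe, h.graph_eq] at hxy
  exact closure_minimal (s := Set.range fun ψ => (j ψ, j (D₀ ψ)))
    (by rintro _ ⟨ψ, rfl⟩; exact hcore ψ) hP hxy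

theorem mem_graph_resolvent (h : IsClosureOf j D₀ D) (φ : V) :
    (sqResolvent j D₀ φ, mulSqResolvent j D₀ φ) ∈ D.graph := by
  refine h.dense_sq'.induction_on
    (p := fun φ => (sqResolvent j D₀ φ, mulSqResolvent j D₀ φ) ∈ D.graph) φ ?_ fun ψ => ?_
  · exact h.isClosed_graph.preimage (by fun_prop)
  · rw [h.sqResolvent_apply, h.mulSqResolvent_apply]
    exact h.mem_graph ψ

theorem mem_graph_mulSqResolvent (h : IsClosureOf j D₀ D) (φ : V) :
    (mulSqResolvent j D₀ φ, φ - sqResolvent j D₀ φ) ∈ D.graph := by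
  refine h.dense_sq'.induction_on
    (p := fun φ => (mulSqResolvent j D₀ φ, φ - sqResolvent j D₀ φ) ∈ D.graph) φ ?_ fun ψ => ?_
  · exact h.isClosed_graph.preimage (by fun_prop)
  · rw [h.sqResolvent_apply, h.mulSqResolvent_apply, map_add, add_sub_cancel_right]
    exact h.mem_graph _

theorem inner_graph (h : IsClosureOf j D₀ D) {x y x' y' : V} (hxy : (x, y) ∈ D.graph)
    (hxy' : (x', y') ∈ D.graph) : inner ℂ y x' = inner ℂ x y' := by
  refine h.graph_induction (P := fun x y => inner ℂ y x' = inner ℂ x y')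
    (isClosed_eq (by fun_prop) (by fun_prop)) (fun ψ => ?_) hxy
  refine h.graph_induction (P := fun x' y' => inner ℂ (j (D₀ ψ)) x' = inner ℂ (j ψ) y')
    (isClosed_eq (by fun_prop) (by fun_prop)) (fun ψ' => h.symm ψ ψ') hxy'

theorem dense_domain (h : IsClosureOf j D₀ D) : Dense (D.domain : Set V) :=
  h.dense.mono (by
    rintro _ ⟨ψ, rfl⟩
    exact (exists_domain_of_mem_graph (h.mem_graph ψ)).1)

theorem isSelfAdjoint (h : IsClosureOf j D₀ D) : IsSelfAdjoint D := by
  have key : ∀ c : ℂ, c * c = -1 → ∀ z, ∃ x y, (x, y) ∈ D.graph ∧ y + c • x = z := by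
    intro c hc z
    -- Since `c² = -1`, the factorisation `(D + c) (D - c) = D² + 1` gives the preimage `(D - c) (D²
    -- + 1)⁻¹ z`.
    refine ⟨_, _, D.graph.sub_mem (h.mem_graph_mulSqResolvent z)
      (D.graph.smul_mem c (h.mem_graph_resolvent z)), ?_⟩
    simp only [Prod.smul_fst, Prod.smul_snd, smul_sub, smul_smul, hc]
    module
  refine isSelfAdjoint_of_surjective h.dense_domain
    (fun x y x' y' h1 h2 => h.inner_graph h1 h2) Complex.I (key _ Complex.I_mul_I) (key _ ?_)
  simp

/-- The point is uniqueness: two solutions differ by `v` with `D² v = -v`, and symmetry turns this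
into `‖D v‖² = -‖v‖²`. -/
theorem sqRel_iff (h : IsClosureOf j D₀ D) (ψ φ : V) :
    SqRel D ψ (φ - ψ) ↔ ψ = sqResolvent j D₀ φ := by
  constructor
  · rintro ⟨χ, h1, h2⟩
    have h3 := D.graph.sub_mem h1 (h.mem_graph_resolvent φ)
    have h4 := D.graph.sub_mem h2 (h.mem_graph_mulSqResolvent φ)
    have h5 := h.inner_graph h3 h4
    simp only [Prod.mk_sub_mk] at h3 h4 h5
    set v := ψ - sqResolvent j D₀ φ
    have e : φ - ψ - (φ - sqResolvent j D₀ φ) = -v := by simp only [v]; abel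
    rw [e, inner_neg_right, inner_self_eq_norm_sq_to_K, inner_self_eq_norm_sq_to_K] at h5
    have h6 : ‖χ - mulSqResolvent j D₀ φ‖ ^ 2 = -‖v‖ ^ 2 := by exact_mod_cast h5
    have h7 : ‖v‖ ^ 2 = 0 := by nlinarith [sq_nonneg ‖v‖, sq_nonneg ‖χ - mulSqResolvent j D₀ φ‖]
    exact sub_eq_zero.1 (norm_eq_zero.1 (pow_eq_zero_iff two_ne_zero |>.1 h7))
  · rintro rfl
    exact ⟨_, h.mem_graph_resolvent φ, h.mem_graph_mulSqResolvent φ⟩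

theorem sqResolvent_injective (h : IsClosureOf j D₀ D) :
    Function.Injective (sqResolvent j D₀) := by
  refine (injective_iff_map_eq_zero _).2 fun φ hφ => ?_
  have h1 := h.mem_graph_resolvent φ
  have h2 := h.mem_graph_mulSqResolvent φ
  have h3 : mulSqResolvent j D₀ φ = 0 := D.graph_fst_eq_zero_snd h1 hφ
  have h4 := D.graph_fst_eq_zero_snd h2 h3
  rwa [hφ, sub_zero] at h4

theorem sqResolvent_nonneg (h : IsClosureOf j D₀ D) : 0 ≤ sqResolvent j D₀ := by
  rw [ContinuousLinearMap.nonneg_iff_isPositive]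
  refine ⟨fun x y => ?_, fun x => ?_⟩
  · simp only [ContinuousLinearMap.coe_coe]
    have h1 := h.inner_graph (h.mem_graph_resolvent x) (h.mem_graph_mulSqResolvent y)
    have h2 := h.inner_graph (h.mem_graph_mulSqResolvent x) (h.mem_graph_resolvent y)
    rw [inner_sub_right] at h1
    rw [inner_sub_left] at h2
    linear_combination -h2 - h1
  · rw [ContinuousLinearMap.reApplyInnerSelf_apply]
    have h1 := h.inner_graph (h.mem_graph_resolvent x) (h.mem_graph_mulSqResolvent x)
    rw [inner_sub_right, eq_sub_iff_add_eq, inner_self_eq_norm_sq_to_K,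
      inner_self_eq_norm_sq_to_K] at h1
    rw [← h1]
    norm_cast
    positivity

end IsClosureOf

/-- The bounded operator `(D² + 1)^{-1/2}`. -/
noncomputable def bracketInv (j : 𝒮 →ₗ[ℂ] V) (D₀ : 𝒮 →ₗ[ℂ] 𝒮) : V →L[ℂ] V :=
  CFC.sqrt (sqResolvent j D₀)

namespace IsClosureOf

variable {j : 𝒮 →ₗ[ℂ] V} {D₀ : 𝒮 →ₗ[ℂ] 𝒮} {D : V →ₗ.[ℂ] V}

theorem bracketInv_nonneg : 0 ≤ bracketInv j D₀ := CFC.sqrt_nonneg _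

theorem bracketInv_mul_self (h : IsClosureOf j D₀ D) :
    bracketInv j D₀ * bracketInv j D₀ = sqResolvent j D₀ :=
  CFC.sqrt_mul_sqrt_self _ h.sqResolvent_nonneg

theorem bracketInv_apply_apply (h : IsClosureOf j D₀ D) (φ : V) :
    bracketInv j D₀ (bracketInv j D₀ φ) = sqResolvent j D₀ φ := by
  rw [← h.bracketInv_mul_self]; rfl

theorem inner_bracketInv (φ ψ : V) :
    inner ℂ (bracketInv j D₀ φ) ψ = inner ℂ φ (bracketInv j D₀ ψ) :=
  ((ContinuousLinearMap.nonneg_iff_isPositive _).1 bracketInv_nonneg).isSymmetric φ ψ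

theorem bracketInv_injective (h : IsClosureOf j D₀ D) : Function.Injective (bracketInv j D₀) := by
  intro x y hxy
  apply h.sqResolvent_injective
  rw [← h.bracketInv_apply_apply, ← h.bracketInv_apply_apply, hxy]

theorem denseRange_sqResolvent (h : IsClosureOf j D₀ D) : DenseRange (sqResolvent j D₀) :=
  h.dense.mono (by
    rintro _ ⟨ψ, rfl⟩
    exact ⟨_, h.sqResolvent_apply ψ⟩)

theorem denseRange_bracketInv (h : IsClosureOf j D₀ D) : DenseRange (bracketInv j D₀) :=
  h.denseRange_sqResolvent.mono (by
    rintro _ ⟨ψ, rfl⟩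
    exact ⟨_, h.bracketInv_apply_apply ψ⟩)

/-- The left factor cancels because `S` is injective, the right one because its range is dense. -/
theorem bracketInv_cancel (h : IsClosureOf j D₀ D) (X : V →L[ℂ] V)
    (hX : bracketInv j D₀ * X * bracketInv j D₀ = 0) : X = 0 := by
  refine ContinuousLinearMap.coeFn_injective
    (h.denseRange_bracketInv.equalizer (by fun_prop) (by fun_prop) (funext fun φ => ?_))
  apply h.bracketInv_injective
  simpa using congr($hX φ)

/-- The graph of `⟨D⟩` consists of the pairs `((D² + 1)^{-1/2} φ, φ)`. -/
theorem mem_graph_of_isBracket (h : IsClosureOf j D₀ D) {A : V →ₗ.[ℂ] V} (hA : IsBracket D A)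
    (φ : V) : (bracketInv j D₀ φ, φ) ∈ A.graph := by
  obtain ⟨hsa, hpos, hsq⟩ := hA
  simp_rw [h.sqRel_iff] at hsq
  have hsymm : ∀ {x y x' y'}, (x, y) ∈ A.graph → (x', y') ∈ A.graph →
      inner ℂ y x' = inner ℂ x y' := by
    intro x y x' y' h1 h2
    obtain ⟨hx, rfl⟩ := exists_domain_of_mem_graph h1
    obtain ⟨hx', rfl⟩ := exists_domain_of_mem_graph h2
    have := LinearPMap.adjoint_isFormalAdjoint hsa.dense_domain
    rw [LinearPMap.isSelfAdjoint_def.1 hsa] at this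
    exact this ⟨x, hx⟩ ⟨x', hx'⟩
  have hsurj : ∀ φ, ∃ χ, (sqResolvent j D₀ φ, χ) ∈ A.graph ∧ (χ, φ) ∈ A.graph := fun φ =>
    (hsq (sqResolvent j D₀ φ) φ).2 rfl
  have hinj : ∀ {x}, (x, (0 : V)) ∈ A.graph → x = 0 := fun {x} hx => by
    have := (hsq x 0).1 ⟨0, hx, A.graph.zero_mem⟩
    rwa [map_zero] at this
  have huniq : ∀ {x x' y : V}, (x, y) ∈ A.graph → (x', y) ∈ A.graph → x = x' := by
    intro x x' y h1 h2
    have := A.graph.sub_mem h1 h2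
    simp only [Prod.mk_sub_mk, sub_self] at this
    exact sub_eq_zero.1 (hinj this)
  -- Here `S φ = A (D² + 1)⁻¹ φ`. It turns out to be linear, bounded and nonnegative with square
  -- `(D² + 1)⁻¹`, so uniqueness of the positive square root identifies it.
  choose S hS1 hS2 using hsurj
  let S' : V →ₗ[ℂ] V :=
    { toFun := S
      map_add' := fun x y => huniq (hS2 _) (A.graph.add_mem (hS2 x) (hS2 y))
      map_smul' := fun c x => huniq (hS2 _) (A.graph.smul_mem c (hS2 x)) }
  have hbd : ∀ φ, ‖S φ‖ ^ 2 ≤ ‖sqResolvent j D₀‖ * ‖φ‖ ^ 2 := fun φ => by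
    have h1 := hsymm (hS1 φ) (hS2 φ)
    rw [inner_self_eq_norm_sq_to_K] at h1
    have h2 := norm_inner_le_norm (𝕜 := ℂ) (sqResolvent j D₀ φ) φ
    rw [← h1] at h2
    have h3 := (sqResolvent j D₀).le_opNorm φ
    have h4 : ‖((‖S φ‖ : ℂ)) ^ 2‖ = ‖S φ‖ ^ 2 := by simp
    calc ‖S φ‖ ^ 2 ≤ ‖sqResolvent j D₀ φ‖ * ‖φ‖ := by rw [← h4]; exact h2
      _ ≤ ‖sqResolvent j D₀‖ * ‖φ‖ * ‖φ‖ := by gcongr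
      _ = _ := by ring
  let S'' : V →L[ℂ] V := S'.mkContinuous (Real.sqrt ‖sqResolvent j D₀‖) fun φ => by
    refine le_of_sq_le_sq ?_ (by positivity)
    rw [mul_pow, Real.sq_sqrt (norm_nonneg _)]
    exact hbd φ
  have hS''nonneg : 0 ≤ S'' := by
    rw [ContinuousLinearMap.nonneg_iff_isPositive]
    refine ⟨fun x y => (hsymm (hS2 x) (hS2 y)).symm, fun x => ?_⟩
    rw [ContinuousLinearMap.reApplyInnerSelf_apply]
    obtain ⟨hx, hx'⟩ := exists_domain_of_mem_graph (hS2 x)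
    have := hpos ⟨S x, hx⟩
    rw [hx'] at this
    exact this
  have hsqrt : S'' = bracketInv j D₀ := by
    refine (CFC.sqrt_unique ?_ hS''nonneg).symm
    ext φ
    exact huniq (hS2 _) (hS1 φ)
  rw [← hsqrt]
  exact hS2 φ

theorem mem_graph_iff_of_isBracket (h : IsClosureOf j D₀ D) {A : V →ₗ.[ℂ] V} (hA : IsBracket D A)
    {x y : V} : (x, y) ∈ A.graph ↔ x = bracketInv j D₀ y := by
  refine ⟨fun hxy => ?_, fun hxy => hxy ▸ h.mem_graph_of_isBracket hA y⟩
  have h1 := A.graph.sub_mem hxy (h.mem_graph_of_isBracket hA y)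
  simp only [Prod.mk_sub_mk, sub_self] at h1
  have h2 := (hA.2.2 _ 0).1 ⟨0, h1, A.graph.zero_mem⟩
  rw [h.sqRel_iff, map_zero] at h2
  exact sub_eq_zero.1 h2

theorem existsUnique_isBracket (h : IsClosureOf j D₀ D) : ∃! A, IsBracket D A := by
  set S := bracketInv j D₀
  -- The bracket is defined as the inverse of `S`, through its graph of pairs `(S φ, φ)`.
  let G : Submodule ℂ (V × V) := LinearMap.range (S.toLinearMap.prod LinearMap.id)
  have hG : ∀ x y, (x, y) ∈ G ↔ x = S y := fun x y => by
    constructor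
    · rintro ⟨z, hz⟩
      obtain ⟨rfl, rfl⟩ := Prod.mk.inj hz
      rfl
    · rintro rfl
      exact ⟨y, rfl⟩
  have hgraph : G.toLinearPMap.graph = G := by
    refine Submodule.toLinearPMap_graph_eq G ?_
    rintro ⟨x, y⟩ hxy hx
    rw [hG] at hxy
    subst hxy
    exact h.bracketInv_injective (by rw [map_zero]; exact hx)
  have hA : ∀ x y, (x, y) ∈ G.toLinearPMap.graph ↔ x = S y := fun x y => by rw [hgraph, hG]
  have hdense : Dense (G.toLinearPMap.domain : Set V) := h.denseRange_bracketInv.mono (by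
    rintro _ ⟨ψ, rfl⟩
    exact (exists_domain_of_mem_graph ((hA _ _).2 rfl)).1)
  refine ⟨G.toLinearPMap, ⟨?_, fun ψ => ?_, fun ψ φ => ?_⟩, fun A hA' => ?_⟩
  -- The inverse of an everywhere defined operator is itself onto, so the surjectivity criterion
  -- applies with constant `0`.
  · refine isSelfAdjoint_of_surjective hdense ?_ 0 (fun z => ⟨S z, z, (hA _ _).2 rfl, by simp⟩)
      (fun z => ⟨S z, z, (hA _ _).2 rfl, by simp⟩)
    intro x y x' y' h1 h2
    rw [hA] at h1 h2
    rw [h1, h2, inner_bracketInv]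
  · have := (hA _ _).1 (G.toLinearPMap.mem_graph ψ)
    rw [this]
    exact ((ContinuousLinearMap.nonneg_iff_isPositive _).1 bracketInv_nonneg).2 _
  · rw [h.sqRel_iff]
    simp only [SqRel, hA]
    constructor
    · rintro ⟨χ, rfl, rfl⟩
      exact h.bracketInv_apply_apply φ
    · rintro rfl
      exact ⟨S φ, (h.bracketInv_apply_apply φ).symm, rfl⟩
  · refine LinearPMap.eq_of_eq_graph ?_
    ext ⟨x, y⟩
    rw [hA, h.mem_graph_iff_of_isBracket hA']

/-- The domain of `A` is the range of `S`, and on vectors `S φ` the identity `[A, T] = C` is exactly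
`T S - S T = S C S`. As `C` is smooth again, induction applies. -/
theorem memDomDeltaPow_of_isSmoothFor (h : IsClosureOf j D₀ D) {A : V →ₗ.[ℂ] V}
    (hA : IsBracket D A) (n : ℕ) {T : V →L[ℂ] V} (hT : IsSmoothFor (bracketInv j D₀) T) :
    MemDomDeltaPow A n T := by
  induction n generalizing T with
  | zero => trivial
  | succ n ih =>
    obtain ⟨C, hC, hTC⟩ := IsSmoothFor.exists_commutator (S := bracketInv j D₀) (T := T)
      bracketInv_nonneg h.bracketInv_cancel hT
    refine ⟨C, fun ψ => ?_, ih hC⟩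
    set S := bracketInv j D₀
    have h1 := (h.mem_graph_iff_of_isBracket hA).1 (A.mem_graph ψ)
    have h2 : T (S (A ψ)) = S (T (A ψ) + C (S (A ψ))) := by
      have := congr($hTC (A ψ))
      simp only [sub_apply, mul_apply_eq_comp] at this
      rw [map_add, ← this]
      abel
    rw [← h1] at h2
    obtain ⟨h3, h4⟩ := exists_domain_of_mem_graph ((h.mem_graph_iff_of_isBracket hA).2 h2)
    exact ⟨h3, by rw [h4]; abel⟩

/-- A bounded operator whose weak commutator with `D₀` on the core is bounded. -/
theorem isCommutator_of_core (h : IsClosureOf j D₀ D) {T C : V →L[ℂ] V}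
    (hTC : ∀ φ ψ, inner ℂ (j (D₀ φ)) (T (j ψ)) - inner ℂ (j φ) (T (j (D₀ ψ))) =
      inner ℂ (j φ) (C (j ψ))) : IsCommutator D T C := by
  intro ψ
  have h1 : ∀ {x y x' y'}, (x, y) ∈ D.graph → (x', y') ∈ D.graph →
      inner ℂ y (T x') - inner ℂ x (T y') = inner ℂ x (C x') := by
    intro x y x' y' hxy hxy'
    refine h.graph_induction (P := fun x y => inner ℂ y (T x') - inner ℂ x (T y') =
      inner ℂ x (C x')) (isClosed_eq (by fun_prop) (by fun_prop)) (fun φ => ?_) hxy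
    exact h.graph_induction (P := fun x' y' => inner ℂ (j (D₀ φ)) (T x') -
      inner ℂ (j φ) (T y') = inner ℂ (j φ) (C x')) (isClosed_eq (by fun_prop) (by fun_prop))
      (fun ψ => hTC φ ψ) hxy'
  -- Read against all `x` in the domain, this places `T ψ` in the domain of the adjoint, which is
  -- `D` itself, with value `T D ψ + C ψ`.
  have h2 : ∀ x : D.domain, inner ℂ (T (D ψ) + C ψ) (x : V) = inner ℂ (T (ψ : V)) (D x) := by
    intro x
    have := h1 (D.mem_graph x) (D.mem_graph ψ)
    rw [← inner_conj_symm, ← inner_conj_symm (T (ψ : V)), inner_add_right, ← this]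
    congr 1
    abel
  have hsa := LinearPMap.isSelfAdjoint_def.1 h.isSelfAdjoint
  have hmem : T (ψ : V) ∈ D.adjoint.domain := LinearPMap.mem_adjoint_domain_of_exists _ ⟨_, h2⟩
  have happ := LinearPMap.adjoint_apply_eq h.dense_domain ⟨_, hmem⟩ h2
  have hgr := D.adjoint.mem_graph ⟨_, hmem⟩
  rw [happ] at hgr
  have e : D.adjoint.graph = D.graph := by rw [hsa]
  have hgr' : (T (ψ : V), T (D ψ) + C ψ) ∈ D.graph := by rw [← e]; exact hgr
  obtain ⟨h3, h4⟩ := exists_domain_of_mem_graph hgr'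
  exact ⟨h3, by rw [h4]; abel⟩

end IsClosureOf

end CoreOperator

end MoyalOscillator

namespace MoyalOscillator

open MeasureTheory

/-! ### Operators with bounded commutators with the generators of an oscillator -/

section Oscillator

set_option linter.unusedSectionVars false

variable {V : Type*} [NormedAddCommGroup V] [InnerProductSpace ℂ V] [CompleteSpace V]
  {𝒮 : Type*} [AddCommGroup 𝒮] [Module ℂ 𝒮] {κ : Type*} [Fintype κ]

/-- The square of `D₀` is `∑ X_k² + N` for symmetric operators `X_k` that satisfy canonical
commutation relations, and a bounded operator `N` that commutes with them. -/
structure IsOscillator (j : 𝒮 →ₗ[ℂ] V) (D₀ : 𝒮 →ₗ[ℂ] 𝒮) (D : V →ₗ.[ℂ] V)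
    (X : κ → 𝒮 →ₗ[ℂ] 𝒮) (c : κ → κ → ℂ) (N₀ : 𝒮 →ₗ[ℂ] 𝒮) (N : V →L[ℂ] V) : Prop
    extends IsClosureOf j D₀ D where
  symm_gen : ∀ k φ ψ, inner ℂ (j (X k φ)) (j ψ) = inner ℂ (j φ) (j (X k ψ))
  comm_gen : ∀ i k ψ, X i (X k ψ) - X k (X i ψ) = c i k • ψ
  sq_eq : ∀ ψ, D₀ (D₀ ψ) = (∑ k, X k (X k ψ)) + N₀ ψ
  comm_pot : ∀ k ψ, N₀ (X k ψ) = X k (N₀ ψ)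
  pot_eq : ∀ ψ, j (N₀ ψ) = N (j ψ)

/-- `T'` is the weak commutator `[X, T]` on the core. -/
def IsWeakCommutator (j : 𝒮 →ₗ[ℂ] V) (X : 𝒮 →ₗ[ℂ] 𝒮) (T T' : V →L[ℂ] V) : Prop :=
  ∀ φ ψ, inner ℂ (j (X φ)) (T (j ψ)) - inner ℂ (j φ) (T (j (X ψ))) = inner ℂ (j φ) (T' (j ψ))

/-- The bounded operator `X (D² + 1)^{-1/2}`. -/
noncomputable def genBracketInv (j : 𝒮 →ₗ[ℂ] V) (D₀ X : 𝒮 →ₗ[ℂ] 𝒮) : V →L[ℂ] V :=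
  (j ∘ₗ X).extendOfNorm ((bracketInv j D₀).toLinearMap ∘ₗ j ∘ₗ (D₀ * D₀ + 1))

/-- The bounded operator `(D² + 1)^{-1/2} X`. -/
noncomputable def bracketInvGen (j : 𝒮 →ₗ[ℂ] V) (D₀ X : 𝒮 →ₗ[ℂ] 𝒮) : V →L[ℂ] V :=
  ContinuousLinearMap.adjoint (genBracketInv j D₀ X)

namespace IsOscillator

variable {j : 𝒮 →ₗ[ℂ] V} {D₀ : 𝒮 →ₗ[ℂ] 𝒮} {D : V →ₗ.[ℂ] V} {X : κ → 𝒮 →ₗ[ℂ] 𝒮}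
  {c : κ → κ → ℂ} {N₀ : 𝒮 →ₗ[ℂ] 𝒮} {N : V →L[ℂ] V}

/-- By symmetry `∑ ‖X_i ψ‖² = ‖D₀ ψ‖² - ⟨ψ, N ψ⟩`, and one summand is at most the sum. -/
theorem norm_gen_sq_le (h : IsOscillator j D₀ D X c N₀ N) (k : κ) (ψ : 𝒮) :
    ‖j (X k ψ)‖ ^ 2 ≤ ‖j (D₀ ψ)‖ ^ 2 + ‖N‖ * ‖j ψ‖ ^ 2 := by
  have h1 : ∑ i, inner ℂ (j (X i ψ)) (j (X i ψ)) =
      inner ℂ (j (D₀ ψ)) (j (D₀ ψ)) - inner ℂ (j ψ) (N (j ψ)) := by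
    simp_rw [h.symm_gen, h.symm]
    rw [← inner_sum, ← map_sum, h.sq_eq, map_add, inner_add_right, h.pot_eq]
    ring
  have h2 : ∑ i, ‖j (X i ψ)‖ ^ 2 = ‖j (D₀ ψ)‖ ^ 2 - (inner ℂ (j ψ) (N (j ψ))).re := by
    have := congr(Complex.re $h1)
    rw [Complex.re_sum, Complex.sub_re] at this
    simpa only [inner_self_eq_norm_sq_to_K, ← Complex.ofReal_pow, Complex.ofReal_re,
      Complex.coe_algebraMap] using this
  have h3 : -(inner ℂ (j ψ) (N (j ψ))).re ≤ ‖N‖ * ‖j ψ‖ ^ 2 := by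
    have h4 := (Complex.abs_re_le_norm _).trans (norm_inner_le_norm (𝕜 := ℂ) (j ψ) (N (j ψ)))
    have h5 := N.le_opNorm (j ψ)
    have h6 := neg_abs_le (inner ℂ (j ψ) (N (j ψ))).re
    nlinarith [norm_nonneg (j ψ)]
  have h4 := Finset.single_le_sum (f := fun i => ‖j (X i ψ)‖ ^ 2) (fun i _ => by positivity)
    (Finset.mem_univ k)
  linarith

/-- The vector inside the norm is `⟨D⟩ ψ`. Together with the bound on `X_k ψ`, this makes `X_k
⟨D⟩⁻¹` bounded. -/
theorem norm_bracketInv_sq (h : IsOscillator j D₀ D X c N₀ N) (ψ : 𝒮) :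
    ‖bracketInv j D₀ (j (D₀ (D₀ ψ) + ψ))‖ ^ 2 = ‖j (D₀ ψ)‖ ^ 2 + ‖j ψ‖ ^ 2 := by
  have h1 := IsClosureOf.inner_bracketInv (j := j) (D₀ := D₀)
    (bracketInv j D₀ (j (D₀ (D₀ ψ) + ψ))) (j (D₀ (D₀ ψ) + ψ))
  rw [h.bracketInv_apply_apply, h.sqResolvent_apply, h.inner_sq_add_one,
    inner_self_eq_norm_sq_to_K] at h1
  exact Complex.ofReal_injective (by rw [Complex.ofReal_pow]; exact h1.symm)

theorem norm_gen_le (h : IsOscillator j D₀ D X c N₀ N) (k : κ) (ψ : 𝒮) :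
    ‖(j ∘ₗ X k) ψ‖ ≤ (1 + ‖N‖) *
      ‖((bracketInv j D₀).toLinearMap ∘ₗ j ∘ₗ (D₀ * D₀ + 1)) ψ‖ := by
  have h1 := h.norm_gen_sq_le k ψ
  have h2 := h.norm_bracketInv_sq ψ
  change ‖j (X k ψ)‖ ≤ (1 + ‖N‖) * ‖bracketInv j D₀ (j (D₀ (D₀ ψ) + ψ))‖
  refine le_of_sq_le_sq ?_ (by positivity)
  rw [mul_pow, h2]
  have := norm_nonneg N
  have h3 := sq_nonneg ‖j (D₀ ψ)‖
  have h4 := sq_nonneg ‖j ψ‖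
  nlinarith [mul_nonneg this h3, mul_nonneg this h4, mul_nonneg (sq_nonneg ‖N‖) h3,
    mul_nonneg (sq_nonneg ‖N‖) h4]

theorem dense_bracketInv_sq (h : IsOscillator j D₀ D X c N₀ N) :
    DenseRange ((bracketInv j D₀).toLinearMap ∘ₗ j ∘ₗ (D₀ * D₀ + 1)) :=
  h.denseRange_bracketInv.comp h.dense_sq (bracketInv j D₀).continuous

theorem genBracketInv_apply (h : IsOscillator j D₀ D X c N₀ N) (k : κ) (ψ : 𝒮) :
    genBracketInv j D₀ (X k) (bracketInv j D₀ (j (D₀ (D₀ ψ) + ψ))) = j (X k ψ) :=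
  LinearMap.extendOfNorm_eq h.dense_bracketInv_sq ⟨_, h.norm_gen_le k⟩ ψ

theorem inner_bracketInv_bracketInvGen (h : IsOscillator j D₀ D X c N₀ N) (k : κ) (φ : 𝒮) (v : V) :
    inner ℂ (bracketInv j D₀ (j (D₀ (D₀ φ) + φ))) (bracketInvGen j D₀ (X k) v) =
      inner ℂ (j (X k φ)) v := by
  rw [bracketInvGen, ContinuousLinearMap.adjoint_inner_right, h.genBracketInv_apply]

theorem bracketInvGen_apply (h : IsOscillator j D₀ D X c N₀ N) (k : κ) (ψ : 𝒮) :
    bracketInvGen j D₀ (X k) (j ψ) = bracketInv j D₀ (j (X k ψ)) := by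
  refine h.dense_bracketInv_sq.eq_of_inner_left ℂ ?_
  intro φ
  change inner ℂ _ (bracketInv j D₀ (j (D₀ (D₀ φ) + φ))) =
    inner ℂ _ (bracketInv j D₀ (j (D₀ (D₀ φ) + φ)))
  rw [← inner_conj_symm, h.inner_bracketInv_bracketInvGen, h.symm_gen,
    IsClosureOf.inner_bracketInv, h.bracketInv_apply_apply, h.sqResolvent_apply, inner_conj_symm]

/-- The commutators `[X_i, X_k]` are scalars and `N` commutes with the generators, so `[D², X_k]` is
linear in the generators: no term of second order appears. -/
theorem sq_gen (h : IsOscillator j D₀ D X c N₀ N) (k : κ) (ψ : 𝒮) :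
    D₀ (D₀ (X k ψ)) = X k (D₀ (D₀ ψ)) + ∑ i, (2 * c i k) • X i ψ := by
  have e : ∀ i, X i (X i (X k ψ)) = X k (X i (X i ψ)) + (2 * c i k) • X i ψ := fun i => by
    have h1 := h.comm_gen i k ψ
    have h2 := h.comm_gen i k (X i ψ)
    have h3 : X i (X k ψ) = X k (X i ψ) + c i k • ψ := by rw [← h1]; abel
    have h4 : X i (X k (X i ψ)) = X k (X i (X i ψ)) + c i k • X i ψ := by rw [← h2]; abel
    rw [h3, map_add, map_smul, h4]
    module
  rw [h.sq_eq, h.sq_eq, map_add, map_sum, h.comm_pot]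
  simp_rw [e]
  rw [Finset.sum_add_distrib]
  abel

/-- Since `A⁻¹` commutes with `A²`, one has `[A², A⁻¹ X_k] = A⁻¹ [D², X_k]`, a combination of the
`A⁻¹ X_i`; the remaining `A⁻¹` is the factor in front. -/
theorem isOrderOneCommutator_bracketInvGen (h : IsOscillator j D₀ D X c N₀ N) (k : κ) :
    IsOrderOneCommutator (bracketInv j D₀) (bracketInvGen j D₀ (X k))
      (bracketInv j D₀ * ∑ i, (2 * c i k) • bracketInvGen j D₀ (X i)) := by
  rw [IsOrderOneCommutator, h.bracketInv_mul_self]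
  refine ContinuousLinearMap.coeFn_injective
    (h.dense_sq'.equalizer (by fun_prop) (by fun_prop) (funext fun ψ => ?_))
  have hc : ∀ v, sqResolvent j D₀ (bracketInv j D₀ v) = bracketInv j D₀ (sqResolvent j D₀ v) :=
    fun v => by rw [← h.bracketInv_apply_apply, ← h.bracketInv_apply_apply]
  simp only [Function.comp_apply, sub_apply, mul_apply_eq_comp, h.sqResolvent_apply,
    h.bracketInvGen_apply, sum_apply, smul_apply]
  have e : X k (D₀ (D₀ ψ) + ψ) = (D₀ (D₀ (X k ψ)) + X k ψ) - ∑ i, (2 * c i k) • X i ψ := by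
    rw [h.sq_gen, map_add]; abel
  rw [e, map_sub, hc, map_sub, h.sqResolvent_apply, map_sub, sub_sub_cancel,
    h.bracketInv_apply_apply, ← hc, map_sum, map_sum]
  simp only [map_smul]

theorem isSmoothFor_bracketInvGen (h : IsOscillator j D₀ D X c N₀ N) (k : κ) :
    IsSmoothFor (bracketInv j D₀) (bracketInvGen j D₀ (X k)) := by
  set S := bracketInv j D₀
  set W := Submodule.span ℂ (Set.range fun k => bracketInvGen j D₀ (X k))
  have hW : ∀ b ∈ W, ∃ b' ∈ W, IsOrderOneCommutator S b (S * b') := by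
    intro b hb
    induction hb using Submodule.span_induction with
    | mem b hb =>
      obtain ⟨k, rfl⟩ := hb
      exact ⟨_, sum_mem fun i _ => Submodule.smul_mem _ _ (Submodule.subset_span ⟨i, rfl⟩),
        h.isOrderOneCommutator_bracketInvGen k⟩
    | zero => exact ⟨0, zero_mem _, by simp [IsOrderOneCommutator]⟩
    | add a b _ _ ha hb =>
      obtain ⟨a', ha', ha⟩ := ha
      obtain ⟨b', hb', hb⟩ := hb
      exact ⟨a' + b', add_mem ha' hb', by rw [mul_add]; exact ha.add hb⟩
    | smul z b _ hb =>
      obtain ⟨b', hb', hb⟩ := hb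
      refine ⟨z • b', Submodule.smul_mem _ _ hb', ?_⟩
      rw [IsOrderOneCommutator] at hb ⊢
      simp only [smul_mul_assoc, mul_smul_comm, ← smul_sub, hb]
  refine isSmoothFor_of_invariant (𝒜 := {T | ∃ n : ℕ, ∃ b ∈ W, T = S ^ n * b}) ?_
    ⟨0, _, Submodule.subset_span ⟨k, rfl⟩, by simp⟩
  rintro _ ⟨n, b, hb, rfl⟩
  obtain ⟨b', hb', hbb'⟩ := hW b hb
  refine ⟨_, ⟨n + 1, b', hb', rfl⟩, ?_⟩
  rw [IsOrderOneCommutator] at hbb' ⊢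
  have e : S * S * S ^ n = S ^ n * (S * S) := by rw [← sq, ← pow_add, ← pow_add, add_comm]
  calc S ^ n * b * (S * S) - S * S * (S ^ n * b)
      = S ^ n * (b * (S * S) - S * S * b) := by rw [← mul_assoc (S * S), e]; noncomm_ring
    _ = _ := by rw [hbb', pow_succ']; simp only [← mul_assoc, (Commute.self_pow S n).eq]

/-- On the core `N` equals `D₀² - ∑ X_k²`, which is symmetric. -/
theorem inner_pot (h : IsOscillator j D₀ D X c N₀ N) (φ : 𝒮) (v : V) :
    inner ℂ (N (j φ)) v = inner ℂ (j φ) (N v) := by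
  refine h.dense.induction_on (p := fun v => inner ℂ (N (j φ)) v = inner ℂ (j φ) (N v)) v
    (isClosed_eq (by fun_prop) (by fun_prop)) fun ψ => ?_
  have e : ∀ ψ, N (j ψ) = j (D₀ (D₀ ψ)) - ∑ k, j (X k (X k ψ)) := fun ψ => by
    rw [h.sq_eq, map_add, h.pot_eq, map_sum]; abel
  rw [e, e, inner_sub_left, inner_sub_right, sum_inner, inner_sum]
  simp_rw [h.symm, h.symm_gen]

/-- This is `[X², T] = 2 X [X, T] - [X, [X, T]]`, summed over the generators. The unbounded `X` is
kept on the left, where `A⁻¹` makes it bounded. -/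
theorem isOrderOneCommutator_of_weak (h : IsOscillator j D₀ D X c N₀ N) {T : V →L[ℂ] V}
    {T' T'' : κ → V →L[ℂ] V} (hT' : ∀ k, IsWeakCommutator j (X k) T (T' k))
    (hT'' : ∀ k, IsWeakCommutator j (X k) (T' k) (T'' k)) :
    IsOrderOneCommutator (bracketInv j D₀) T
      ((∑ k, (2 : ℂ) • (bracketInvGen j D₀ (X k) * T' k)) +
        bracketInv j D₀ * ((N * T - T * N) - ∑ k, T'' k)) := by
  rw [IsOrderOneCommutator, h.bracketInv_mul_self]
  refine ContinuousLinearMap.coeFn_injective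
    (h.dense_sq'.equalizer (by fun_prop) (by fun_prop) (funext fun ψ => ?_))
  refine h.dense_sq'.eq_of_inner_right ℂ ?_
  intro φ
  -- Testing against vectors `(D₀² + 1) φ` and `(D₀² + 1) ψ` removes the resolvents and reduces the
  -- claim to an identity of forms on the core.
  have hR : ∀ v, inner ℂ (j (D₀ (D₀ φ) + φ)) (sqResolvent j D₀ v) = inner ℂ (j φ) v := fun v => by
    rw [← h.bracketInv_apply_apply, ← IsClosureOf.inner_bracketInv, ← IsClosureOf.inner_bracketInv,
      h.bracketInv_apply_apply, h.sqResolvent_apply]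
  have hS : ∀ v, inner ℂ (j (D₀ (D₀ φ) + φ)) (bracketInv j D₀ (bracketInv j D₀ v)) =
      inner ℂ (j φ) v := fun v => by rw [h.bracketInv_apply_apply, hR]
  simp only [Function.comp_apply, sub_apply, mul_apply_eq_comp, h.sqResolvent_apply,
    sum_apply, smul_apply, add_apply,
    map_add (bracketInv j D₀), inner_sub_right, inner_add_right, hR, hS]
  rw [← IsClosureOf.inner_bracketInv, inner_sum, inner_sum]
  have e1 : ∀ k, inner ℂ (bracketInv j D₀ (j (D₀ (D₀ φ) + φ)))
      ((2 : ℂ) • bracketInvGen j D₀ (X k) (T' k (j ψ))) =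
      2 * inner ℂ (j (X k φ)) (T' k (j ψ)) := fun k => by
    rw [inner_smul_right, h.inner_bracketInv_bracketInvGen]
  simp_rw [e1]
  have e2 : ∀ k, inner ℂ (j (X k (X k φ))) (T (j ψ)) - inner ℂ (j φ) (T (j (X k (X k ψ)))) =
      2 * inner ℂ (j (X k φ)) (T' k (j ψ)) - inner ℂ (j φ) (T'' k (j ψ)) := fun k => by
    have h1 := hT' k (X k φ) ψ
    have h2 := hT' k φ (X k ψ)
    have h3 := hT'' k φ ψ
    linear_combination h1 + h2 - h3
  have e3 : ∑ k, (inner ℂ (j (X k (X k φ))) (T (j ψ)) - inner ℂ (j φ) (T (j (X k (X k ψ))))) =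
      ∑ k, (2 * inner ℂ (j (X k φ)) (T' k (j ψ)) - inner ℂ (j φ) (T'' k (j ψ))) :=
    Finset.sum_congr rfl fun k _ => e2 k
  rw [Finset.sum_sub_distrib, Finset.sum_sub_distrib] at e3
  have e4 := h.inner_pot φ (T (j ψ))
  simp only [h.sq_eq, map_add, map_sum, h.pot_eq, inner_add_left, inner_add_right, sum_inner,
    inner_sum]
  linear_combination e3 + e4

/-- A family of bounded operators that is stable under weak commutators with the generators and
under commutators with the potential consists of operators that are smooth for `⟨D⟩`. -/
theorem isSmoothFor_of_weak (h : IsOscillator j D₀ D X c N₀ N) {𝒢 : Set (V →L[ℂ] V)}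
    (hX : ∀ T ∈ 𝒢, ∀ k, ∃ T' ∈ 𝒢, IsWeakCommutator j (X k) T T')
    (hN : ∀ T ∈ 𝒢, N * T - T * N ∈ 𝒢) {T : V →L[ℂ] V} (hT : T ∈ Submodule.span ℂ 𝒢) :
    IsSmoothFor (bracketInv j D₀) T := by
  have hS := IsClosureOf.bracketInv_nonneg (j := j) (D₀ := D₀)
  let 𝒦 := smoothSubalgebra hS h.bracketInv_cancel
  have hmul : ∀ {K X : V →L[ℂ] V}, K ∈ 𝒦 → X ∈ Submodule.span 𝒦 𝒢 → K * X ∈ Submodule.span 𝒦 𝒢 :=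
    fun {K X} hK hX => Submodule.smul_mem _ (⟨K, hK⟩ : 𝒦) hX
  have hS𝒦 : bracketInv j D₀ ∈ 𝒦 := isSmoothFor_of_commute (mul_assoc _ _ _).symm
  refine isSmoothFor_of_mem_span hS h.bracketInv_cancel (𝒢 := 𝒢) (fun G hG => ?_) ?_
  · choose T' hT' hT'w using hX G hG
    choose T'' hT'' hT''w using fun k => hX (T' k) (hT' k) k
    refine ⟨_, ?_, h.isOrderOneCommutator_of_weak hT'w hT''w⟩
    refine add_mem (sum_mem fun k _ => ?_) (hmul hS𝒦 (sub_mem (Submodule.subset_span (hN G hG))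
      (sum_mem fun k _ => Submodule.subset_span (hT'' k))))
    rw [← smul_mul_assoc]
    exact hmul (Subalgebra.smul_mem _ (h.isSmoothFor_bracketInvGen k) 2)
      (Submodule.subset_span (hT' k))
  · induction hT using Submodule.span_induction with
    | mem T hT => exact Submodule.subset_span hT
    | zero => exact zero_mem _
    | add a b _ _ ha hb => exact add_mem ha hb
    | smul z a _ ha =>
      have := hmul (Subalgebra.algebraMap_mem 𝒦 z) ha
      rwa [← Algebra.smul_def] at this

end IsOscillator

end Oscillator

end MoyalOscillator

namespace MoyalOscillator

open MeasureTheory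

/-! ### Canonical anticommutation relations -/

section Fermions

variable {d : ℕ}

theorem annih_apply (μ : Fin d) (v : Fock d) (J : Finset (Fin d)) :
    annih μ v J = if μ ∈ J then 0 else fermiSign μ J * v (insert μ J) := rfl

theorem creat_apply (μ : Fin d) (v : Fock d) (J : Finset (Fin d)) :
    creat μ v J = if μ ∈ J then fermiSign μ J * v (J.erase μ) else 0 := rfl

theorem fermiSign_insert {μ ν : Fin d} {J : Finset (Fin d)} (hν : ν ∉ J) :
    fermiSign μ (insert ν J) = (if ν < μ then -1 else 1) * fermiSign μ J := by
  unfold fermiSign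
  rw [Finset.filter_insert]
  split_ifs with h
  · rw [Finset.card_insert_of_notMem (by simp [hν]), pow_succ]
    ring
  · rw [one_mul]

theorem fermiSign_erase {μ ν : Fin d} {J : Finset (Fin d)} (hν : ν ∈ J) :
    fermiSign μ (J.erase ν) = (if ν < μ then -1 else 1) * fermiSign μ J := by
  have h := fermiSign_insert (μ := μ) (Finset.notMem_erase ν J)
  rw [Finset.insert_erase hν] at h
  rw [h, ← mul_assoc]
  split_ifs <;> simp

theorem fermiSign_mul_self (μ : Fin d) (J : Finset (Fin d)) :
    fermiSign μ J * fermiSign μ J = 1 := by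
  unfold fermiSign
  rw [← mul_pow]
  simp

theorem conj_fermiSign (μ : Fin d) (J : Finset (Fin d)) :
    (starRingEnd ℂ) (fermiSign μ J) = fermiSign μ J := by
  simp [fermiSign]

/-- Exactly one of the two comparisons holds. This is the sign by which fermionic operators with
different indices anticommute. -/
theorem sign_lt_add_sign_lt {μ ν : Fin d} (h : μ ≠ ν) :
    (if μ < ν then (-1 : ℂ) else 1) + (if ν < μ then (-1 : ℂ) else 1) = 0 := by
  rcases lt_or_gt_of_ne h with h | h
  · simp [h, h.not_gt]
  · simp [h, h.not_gt]

theorem annih_mul_annih_add (μ ν : Fin d) : annih μ * annih ν + annih ν * annih μ = 0 := by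
  ext v J
  change annih μ (annih ν v) J + annih ν (annih μ v) J = 0
  simp only [annih_apply, Finset.mem_insert]
  by_cases hμν : μ = ν
  · subst hμν; simp
  · by_cases hμ : μ ∈ J
    · simp [hμ]
    · by_cases hν : ν ∈ J
      · simp [hν]
      · have h1 : ¬ (ν = μ ∨ ν ∈ J) := by tauto
        have h2 : ¬ (μ = ν ∨ μ ∈ J) := by tauto
        rw [if_neg hμ, if_neg hν, if_neg h1, if_neg h2, fermiSign_insert hμ, fermiSign_insert hν,
          Finset.insert_comm ν μ]
        have := sign_lt_add_sign_lt hμν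
        linear_combination fermiSign μ J * fermiSign ν J * v (insert μ (insert ν J)) * this

theorem annih_mul_creat_add (μ ν : Fin d) :
    annih μ * creat ν + creat ν * annih μ = if μ = ν then 1 else 0 := by
  ext v J
  change annih μ (creat ν v) J + creat ν (annih μ v) J = _
  simp only [annih_apply, creat_apply, Finset.mem_insert, Finset.mem_erase]
  by_cases hμν : μ = ν
  · subst hμν
    by_cases hμ : μ ∈ J
    · simp only [hμ, if_true, ne_eq, not_true_eq_false, false_and, if_false,
        Finset.insert_erase hμ, fermiSign_erase hμ, lt_irrefl]
      have := fermiSign_mul_self μ J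
      simp
      linear_combination v J * this
    · simp only [hμ, if_true, true_or, if_false, Finset.erase_insert hμ, fermiSign_insert hμ,
        lt_irrefl]
      have := fermiSign_mul_self μ J
      simp
      linear_combination v J * this
  · by_cases hμ : μ ∈ J
    · simp [hμ, hμν]
    · by_cases hν : ν ∈ J
      · have h1 : (ν = μ ∨ ν ∈ J) := Or.inr hν
        have h2 : ¬ (μ ≠ ν ∧ μ ∈ J) := by tauto
        rw [if_neg hμ, if_pos h1, if_pos hν, if_neg h2, if_neg hμν, fermiSign_insert hμ,
          fermiSign_erase hν, Finset.erase_insert_of_ne (Ne.symm (Ne.symm hμν))]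
        have := sign_lt_add_sign_lt hμν
        simp only [zero_apply, PiLp.zero_apply]
        linear_combination fermiSign μ J * fermiSign ν J * v (insert μ (J.erase ν)) * this
      · have h1 : ¬ (ν = μ ∨ ν ∈ J) := by tauto
        simp only [if_neg hμ, if_neg hν, if_neg h1, hμν, if_false, mul_zero, add_zero]
        rfl

theorem inner_creat_left (μ : Fin d) (v w : Fock d) :
    inner ℂ (creat μ v) w = inner ℂ v (annih μ w) := by
  simp only [PiLp.inner_apply, annih_apply, creat_apply, RCLike.inner_apply]
  have e1 : ∀ J, w J * (starRingEnd ℂ) (if μ ∈ J then fermiSign μ J * v (J.erase μ) else 0) =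
      if μ ∈ J then w J * (fermiSign μ J * (starRingEnd ℂ) (v (J.erase μ))) else 0 := fun J => by
    split_ifs <;> simp [conj_fermiSign]
  have e2 : ∀ J, (if μ ∈ J then 0 else fermiSign μ J * w (insert μ J)) * (starRingEnd ℂ) (v J) =
      if μ ∉ J then fermiSign μ J * w (insert μ J) * (starRingEnd ℂ) (v J) else 0 := fun J => by
    split_ifs <;> simp_all
  simp_rw [e1, e2]
  rw [← Finset.sum_filter, ← Finset.sum_filter]
  -- Removing `μ` matches the index sets that contain `μ` with those that do not.
  refine Finset.sum_nbij' (fun J => J.erase μ) (fun J => insert μ J) ?_ ?_ ?_ ?_ ?_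
  · intro J hJ; simp
  · intro J hJ; simp
  · intro J hJ; simp only [Finset.mem_filter, Finset.mem_univ, true_and] at hJ
    exact Finset.insert_erase hJ
  · intro J hJ; simp only [Finset.mem_filter, Finset.mem_univ, true_and] at hJ
    exact Finset.erase_insert hJ
  · intro J hJ; simp only [Finset.mem_filter, Finset.mem_univ, true_and] at hJ
    rw [Finset.insert_erase hJ, fermiSign_erase hJ]
    simp only [lt_irrefl, if_false]
    ring

theorem inner_annih_left (μ : Fin d) (v w : Fock d) :
    inner ℂ (annih μ v) w = inner ℂ v (creat μ w) := by
  rw [← inner_conj_symm, ← inner_creat_left, inner_conj_symm]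

theorem creat_mul_creat_add (μ ν : Fin d) : creat μ * creat ν + creat ν * creat μ = 0 := by
  ext1 v
  refine ext_inner_right ℂ fun w => ?_
  have := congr(inner ℂ v ($(annih_mul_annih_add ν μ) w))
  change inner ℂ v (annih ν (annih μ w) + annih μ (annih ν w)) = inner ℂ v 0 at this
  change inner ℂ (creat μ (creat ν v) + creat ν (creat μ v)) w = inner ℂ 0 w
  simpa only [inner_add_left, inner_add_right, inner_creat_left, inner_zero_left,
    inner_zero_right] using this

/-- Self-adjoint matrices satisfying the Clifford relations. -/
structure IsClifford {κ : Type*} [DecidableEq κ] (Γ : κ → Fock d →L[ℂ] Fock d) : Prop where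
  symm : ∀ k v w, inner ℂ (Γ k v) w = inner ℂ v (Γ k w)
  rel : ∀ i k, Γ i * Γ k + Γ k * Γ i = if i = k then (2 : ℂ) • 1 else 0

/-- The field operator `z b_μ^* + z̄ b_μ`. -/
noncomputable def fermiField (z : ℂ) (μ : Fin d) : Fock d →L[ℂ] Fock d :=
  z • creat μ + (starRingEnd ℂ) z • annih μ

theorem inner_fermiField_left (z : ℂ) (μ : Fin d) (v w : Fock d) :
    inner ℂ (fermiField z μ v) w = inner ℂ v (fermiField z μ w) := by
  simp only [fermiField, smul_apply, add_apply, inner_add_left, inner_smul_left, inner_add_right,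
    inner_smul_right, inner_creat_left, inner_annih_left, Complex.conj_conj]
  ring

theorem fermiField_mul_fermiField_add (z w : ℂ) (μ ν : Fin d) :
    fermiField z μ * fermiField w ν + fermiField w ν * fermiField z μ =
      if μ = ν then (z * (starRingEnd ℂ) w + (starRingEnd ℂ) z * w) • 1 else 0 := by
  have h1 := annih_mul_annih_add μ ν
  have h2 := creat_mul_creat_add μ ν
  have h3 := annih_mul_creat_add μ ν
  have h4 := annih_mul_creat_add ν μ
  calc fermiField z μ * fermiField w ν + fermiField w ν * fermiField z μ
      = (z * w) • (creat μ * creat ν + creat ν * creat μ) +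
        ((starRingEnd ℂ) z * (starRingEnd ℂ) w) • (annih μ * annih ν + annih ν * annih μ) +
        ((starRingEnd ℂ) z * w) • (annih μ * creat ν + creat ν * annih μ) +
        (z * (starRingEnd ℂ) w) • (annih ν * creat μ + creat μ * annih ν) := by
        simp only [fermiField, mul_add, add_mul, smul_mul_assoc, mul_smul_comm]
        module
    _ = _ := by
        rw [h1, h2, h3, h4]
        by_cases h : μ = ν
        · simp only [h, if_true]; module
        · simp only [h, Ne.symm h, if_false]; module

/-- The matrices `z₁ b_μ^* + z̄₁ b_μ` and `z₂ b_μ^* + z̄₂ b_μ`. -/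
noncomputable def clifford (z₁ z₂ : ℂ) : Fin d ⊕ Fin d → Fock d →L[ℂ] Fock d
  | .inl μ => fermiField z₁ μ
  | .inr μ => fermiField z₂ μ

/-- The hypotheses say that `z₁` and `z₂` are orthogonal unit vectors in the real plane `ℂ`; the
anticommutator of two field operators with equal index is twice their real scalar product. -/
theorem isClifford_clifford {z₁ z₂ : ℂ} (h₁ : z₁ * (starRingEnd ℂ) z₁ = 1)
    (h₂ : z₂ * (starRingEnd ℂ) z₂ = 1)
    (h₁₂ : z₁ * (starRingEnd ℂ) z₂ + (starRingEnd ℂ) z₁ * z₂ = 0) :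
    IsClifford (clifford (d := d) z₁ z₂) where
  symm k v w := by cases k <;> exact inner_fermiField_left _ _ _ _
  rel i k := by
    have e₁ : z₁ * (starRingEnd ℂ) z₁ + (starRingEnd ℂ) z₁ * z₁ = 2 := by
      linear_combination 2 * h₁
    have e₂ : z₂ * (starRingEnd ℂ) z₂ + (starRingEnd ℂ) z₂ * z₂ = 2 := by
      linear_combination 2 * h₂
    have e₃ : z₂ * (starRingEnd ℂ) z₁ + (starRingEnd ℂ) z₂ * z₁ = 0 := by
      linear_combination h₁₂
    have h0 : (0 : ℂ) • (1 : Fock d →L[ℂ] Fock d) = 0 := by module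
    rcases i with μ | μ <;> rcases k with ν | ν <;>
    simp [clifford, fermiField_mul_fermiField_add, e₁, e₂, e₃, h₁₂, h0]

end Fermions

end MoyalOscillator

namespace MoyalOscillator

open MeasureTheory

/-! ### The generators of the oscillator on Schwartz spinors -/

section Generators

variable {d : ℕ}

/-- The embedding of Schwartz spinors into the Hilbert space. -/
noncomputable def toHilb : Spinor d →ₗ[ℂ] Hilb d :=
  (SchwartzMap.toLpCLM ℂ (Fock d) 2 (volume : Measure (Pt d))).toLinearMap

theorem denseRange_toHilb : DenseRange (toHilb (d := d)) :=
  SchwartzMap.denseRange_toLpCLM (by norm_num)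

theorem coeFn_toHilb (ψ : Spinor d) : toHilb ψ =ᵐ[volume] ψ := ψ.coeFn_toLp 2 volume

theorem inner_toHilb (φ ψ : Spinor d) :
    inner ℂ (toHilb φ) (toHilb ψ) = ∫ x, inner ℂ (φ x) (ψ x) :=
  SchwartzMap.inner_toL2_toL2_eq φ ψ volume

theorem hasTemperateGrowth_coord (μ : Fin d) :
    Function.HasTemperateGrowth fun x : Pt d => ((x μ : ℝ) : ℂ) :=
  (Complex.ofRealCLM ∘L EuclideanSpace.proj (𝕜 := ℝ) μ).hasTemperateGrowth

theorem positionOp_apply (μ : Fin d) (ψ : Spinor d) (x : Pt d) :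
    positionOp μ ψ x = ((x μ : ℝ) : ℂ) • ψ x :=
  SchwartzMap.smulLeftCLM_apply_apply (hasTemperateGrowth_coord μ) ψ x

theorem partialOp_apply (μ : Fin d) (ψ : Spinor d) (x : Pt d) :
    partialOp μ ψ x = fderiv ℝ ψ x (EuclideanSpace.single μ 1) :=
  SchwartzMap.lineDerivOp_apply_eq_fderiv _ _ _

theorem fiberOp_apply (B : Fock d →L[ℂ] Fock d) (ψ : Spinor d) (x : Pt d) :
    fiberOp B ψ x = B (ψ x) := rfl

theorem fiberOp_fiberOp (B C : Fock d →L[ℂ] Fock d) (ψ : Spinor d) :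
    fiberOp B (fiberOp C ψ) = fiberOp (B * C) ψ := rfl

theorem positionOp_comm (μ ν : Fin d) (ψ : Spinor d) :
    positionOp μ (positionOp ν ψ) = positionOp ν (positionOp μ ψ) := by
  ext1 x
  simp only [positionOp_apply, smul_smul, mul_comm]

theorem partialOp_comm (μ ν : Fin d) (ψ : Spinor d) :
    partialOp μ (partialOp ν ψ) = partialOp ν (partialOp μ ψ) := by
  ext1 x
  have h : ∀ μ ν : Fin d, partialOp μ (partialOp ν ψ) x =
      fderiv ℝ (fderiv ℝ ψ) x (EuclideanSpace.single μ 1) (EuclideanSpace.single ν 1) := by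
    intro μ ν
    have e : (partialOp ν ψ : Pt d → Fock d) = fun y => fderiv ℝ ψ y (EuclideanSpace.single ν 1) :=
      funext fun y => partialOp_apply ν ψ y
    have hd : DifferentiableAt ℝ (fderiv ℝ ψ) x :=
      ((ψ.smooth 2).fderiv_right (m := 1) (by norm_num)).differentiable (by norm_num) x
    rw [partialOp_apply, e, fderiv_clm_apply hd (by fun_prop)]
    simp
  rw [h, h]
  exact ((ψ.smooth 2).contDiffAt.isSymmSndFDerivAt (by simp)) _ _

theorem partialOp_positionOp (μ ν : Fin d) (ψ : Spinor d) :
    partialOp μ (positionOp ν ψ) - positionOp ν (partialOp μ ψ) = if μ = ν then ψ else 0 := by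
  ext1 x
  have hc : HasFDerivAt (fun x : Pt d => ((x ν : ℝ) : ℂ))
      (Complex.ofRealCLM ∘L EuclideanSpace.proj (𝕜 := ℝ) ν) x :=
    (Complex.ofRealCLM ∘L EuclideanSpace.proj (𝕜 := ℝ) ν).hasFDerivAt
  have e : (positionOp ν ψ : Pt d → Fock d) = fun x => ((x ν : ℝ) : ℂ) • ψ x :=
    funext fun x => positionOp_apply ν ψ x
  have h := (hc.smul (ψ.differentiableAt (x := x)).hasFDerivAt).fderiv
  rw [sub_apply, partialOp_apply, positionOp_apply, partialOp_apply, e]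
  change fderiv ℝ ((fun x : Pt d => ((x ν : ℝ) : ℂ)) • (ψ : Pt d → Fock d)) x _ - _ = _
  rw [h]
  by_cases hμν : μ = ν
  · subst hμν; simp
  · simp [hμν, Ne.symm hμν]

theorem fiberOp_positionOp (B : Fock d →L[ℂ] Fock d) (μ : Fin d) (ψ : Spinor d) :
    fiberOp B (positionOp μ ψ) = positionOp μ (fiberOp B ψ) := by
  ext1 x
  simp only [fiberOp_apply, positionOp_apply, map_smul]

theorem fiberOp_partialOp (B : Fock d →L[ℂ] Fock d) (μ : Fin d) (ψ : Spinor d) :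
    fiberOp B (partialOp μ ψ) = partialOp μ (fiberOp B ψ) := by
  ext1 x
  have e : (fiberOp B ψ : Pt d → Fock d) = (B.restrictScalars ℝ) ∘ ψ := rfl
  rw [fiberOp_apply, partialOp_apply, partialOp_apply, e,
    ((B.restrictScalars ℝ).hasFDerivAt.comp x ψ.differentiableAt.hasFDerivAt).fderiv]
  rfl

theorem inner_positionOp (μ : Fin d) (φ ψ : Spinor d) :
    inner ℂ (toHilb (positionOp μ φ)) (toHilb ψ) = inner ℂ (toHilb φ) (toHilb (positionOp μ ψ)) := by
  rw [inner_toHilb, inner_toHilb]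
  congr 1 with x
  rw [positionOp_apply, positionOp_apply, inner_smul_left, inner_smul_right, Complex.conj_ofReal]

theorem inner_partialOp (μ : Fin d) (φ ψ : Spinor d) :
    inner ℂ (toHilb (partialOp μ φ)) (toHilb ψ) = -inner ℂ (toHilb φ) (toHilb (partialOp μ ψ)) := by
  rw [inner_toHilb, inner_toHilb]
  have := SchwartzMap.integral_bilinear_lineDerivOp_right_eq_neg_left (μ := volume) φ ψ
    (isBoundedBilinearMap_inner (𝕜 := ℂ) (E := Fock d)).toContinuousLinearMap
    (EuclideanSpace.single μ (1 : ℝ))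
  rw [eq_neg_iff_add_eq_zero, add_comm, ← eq_neg_iff_add_eq_zero]
  exact this

theorem inner_fiberOp {B B' : Fock d →L[ℂ] Fock d}
    (h : ∀ v w, inner ℂ (B v) w = inner ℂ v (B' w)) (φ ψ : Spinor d) :
    inner ℂ (toHilb (fiberOp B φ)) (toHilb ψ) = inner ℂ (toHilb φ) (toHilb (fiberOp B' ψ)) := by
  rw [inner_toHilb, inner_toHilb]
  congr 1 with x
  exact h _ _

/-- The operator `1 ⊗ B` on the Hilbert space. -/
noncomputable def fiberHilb (B : Fock d →L[ℂ] Fock d) : Hilb d →L[ℂ] Hilb d :=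
  ContinuousLinearMap.compLpL 2 (volume : Measure (Pt d)) B

theorem toHilb_fiberOp (B : Fock d →L[ℂ] Fock d) (ψ : Spinor d) :
    toHilb (fiberOp B ψ) = fiberHilb B (toHilb ψ) := by
  apply Lp.ext
  filter_upwards [coeFn_toHilb (fiberOp B ψ), coeFn_toHilb ψ,
    ContinuousLinearMap.coeFn_compLpL (p := 2) (μ := volume) B (toHilb ψ)] with x h1 h2 h3
  exact h1.trans ((congrArg B h2.symm).trans h3.symm)

/-- The momenta `-i ∂_μ` and the scaled positions `Ω x_μ`. -/
noncomputable def gen (Ω : ℝ) : Fin d ⊕ Fin d → Spinor d →L[ℂ] Spinor d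
  | .inl μ => (-Complex.I) • partialOp μ
  | .inr μ => (Ω : ℂ) • positionOp μ

/-- The scalar commutators of the operators `gen`. -/
noncomputable def genComm (Ω : ℝ) : Fin d ⊕ Fin d → Fin d ⊕ Fin d → ℂ
  | .inl μ, .inr ν => if μ = ν then -Complex.I * Ω else 0
  | .inr μ, .inl ν => if ν = μ then Complex.I * Ω else 0
  | _, _ => 0

theorem gen_comm (Ω : ℝ) (i k : Fin d ⊕ Fin d) (ψ : Spinor d) :
    gen Ω i (gen Ω k ψ) - gen Ω k (gen Ω i ψ) = genComm Ω i k • ψ := by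
  have key : ∀ μ ν : Fin d, gen Ω (.inl μ) (gen Ω (.inr ν) ψ) - gen Ω (.inr ν) (gen Ω (.inl μ) ψ)
      = (if μ = ν then -Complex.I * Ω else 0) • ψ := by
    intro μ ν
    have h := partialOp_positionOp μ ν ψ
    simp only [gen, smul_apply, map_smul]
    rw [smul_comm (Ω : ℂ) (-Complex.I), ← smul_sub, ← smul_sub, h]
    split_ifs
    · rw [smul_smul]
    · simp
  rcases i with μ | μ <;> rcases k with ν | ν
  · simp only [gen, smul_apply, map_smul, genComm]
    rw [partialOp_comm, sub_self, zero_smul]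
  · exact key μ ν
  · rw [← neg_sub, key, genComm, ← neg_smul]
    split_ifs <;> simp
  · simp only [gen, smul_apply, map_smul, genComm]
    rw [positionOp_comm, sub_self, zero_smul]

theorem inner_gen (Ω : ℝ) (k : Fin d ⊕ Fin d) (φ ψ : Spinor d) :
    inner ℂ (toHilb (gen Ω k φ)) (toHilb ψ) = inner ℂ (toHilb φ) (toHilb (gen Ω k ψ)) := by
  rcases k with μ | μ
  · simp only [gen, smul_apply, map_smul, inner_smul_left, inner_smul_right, inner_partialOp]
    simp
  · simp only [gen, smul_apply, map_smul, inner_smul_left, inner_smul_right, inner_positionOp]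
    simp

theorem fiberOp_gen (Ω : ℝ) (B : Fock d →L[ℂ] Fock d) (k : Fin d ⊕ Fin d) (ψ : Spinor d) :
    fiberOp B (gen Ω k ψ) = gen Ω k (fiberOp B ψ) := by
  rcases k with μ | μ
  · simp only [gen, smul_apply, map_smul, fiberOp_partialOp]
  · simp only [gen, smul_apply, map_smul, fiberOp_positionOp]

/-- The Dirac operator `∑_k X_k ⊗ Γ_k`. -/
noncomputable def diracOf (Ω : ℝ) (Γ : Fin d ⊕ Fin d → Fock d →L[ℂ] Fock d) :
    Spinor d →L[ℂ] Spinor d :=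
  ∑ k, gen Ω k ∘L fiberOp (Γ k)

theorem diracOf_apply (Ω : ℝ) (Γ : Fin d ⊕ Fin d → Fock d →L[ℂ] Fock d) (ψ : Spinor d) :
    diracOf Ω Γ ψ = ∑ k, gen Ω k (fiberOp (Γ k) ψ) := by
  simp [diracOf, sum_apply]

/-- The zeroth order part of the square of `diracOf Ω Γ`. -/
noncomputable def diracPot (Ω : ℝ) (Γ : Fin d ⊕ Fin d → Fock d →L[ℂ] Fock d) :
    Fock d →L[ℂ] Fock d :=
  ∑ i, ∑ k, (-(genComm Ω i k) / 2) • (Γ k * Γ i)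

theorem fiberOp_sum {ι : Type*} (s : Finset ι) (B : ι → Fock d →L[ℂ] Fock d) (ψ : Spinor d) :
    fiberOp (∑ i ∈ s, B i) ψ = ∑ i ∈ s, fiberOp (B i) ψ := by
  ext1 x
  simp [fiberOp_apply, sum_apply]

theorem fiberOp_add (B C : Fock d →L[ℂ] Fock d) (ψ : Spinor d) :
    fiberOp (B + C) ψ = fiberOp B ψ + fiberOp C ψ := rfl

theorem fiberOp_smul (c : ℂ) (B : Fock d →L[ℂ] Fock d) (ψ : Spinor d) :
    fiberOp (c • B) ψ = c • fiberOp B ψ := rfl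

/-- The double sum is symmetrised in its two indices. Then the Clifford relations leave only the
squares `X_k²`, and the reordering of `X_i X_k` leaves scalars times matrices. -/
theorem diracOf_diracOf (Ω : ℝ) {Γ : Fin d ⊕ Fin d → Fock d →L[ℂ] Fock d} (hΓ : IsClifford Γ)
    (ψ : Spinor d) :
    diracOf Ω Γ (diracOf Ω Γ ψ) = (∑ k, gen Ω k (gen Ω k ψ)) + fiberOp (diracPot Ω Γ) ψ := by
  let a : Fin d ⊕ Fin d → Fin d ⊕ Fin d → Spinor d := fun i k =>
    gen Ω i (gen Ω k (fiberOp (Γ i * Γ k) ψ))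
  have h1 : diracOf Ω Γ (diracOf Ω Γ ψ) = ∑ i, ∑ k, a i k := by
    simp only [diracOf_apply, map_sum]
    simp only [a, fiberOp_gen, fiberOp_fiberOp]
    exact Finset.sum_comm
  have h2 : ∀ i k, a i k + a k i =
      (if i = k then (2 : ℂ) • gen Ω i (gen Ω i ψ) else 0) +
        (-genComm Ω i k) • fiberOp (Γ k * Γ i) ψ := by
    intro i k
    have e1 : a i k + a k i = gen Ω i (gen Ω k (fiberOp (Γ i * Γ k + Γ k * Γ i) ψ)) -
        (gen Ω i (gen Ω k (fiberOp (Γ k * Γ i) ψ)) -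
          gen Ω k (gen Ω i (fiberOp (Γ k * Γ i) ψ))) := by
      simp only [a, fiberOp_add, map_add]
      abel
    rw [e1, gen_comm, hΓ.rel, neg_smul, ← sub_eq_add_neg]
    split_ifs with h
    · subst h
      rw [fiberOp_smul, map_smul, map_smul]
      rfl
    · have : fiberOp (0 : Fock d →L[ℂ] Fock d) ψ = 0 := rfl
      rw [this, map_zero, map_zero]
  have h3 : (2 : ℂ) • ∑ i, ∑ k, a i k = ∑ i, ∑ k, (a i k + a k i) := by
    simp only [Finset.sum_add_distrib, two_smul]
    rw [Finset.sum_comm (f := fun i k => a k i)]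
  have h4 : (2 : ℂ) • ∑ i, ∑ k, a i k =
      (2 : ℂ) • ((∑ k, gen Ω k (gen Ω k ψ)) + fiberOp (diracPot Ω Γ) ψ) := by
    rw [h3]
    simp only [h2, Finset.sum_add_distrib, Finset.sum_ite_eq, Finset.mem_univ, if_true]
    rw [smul_add, ← Finset.smul_sum, diracPot, fiberOp_sum]
    congr 1
    rw [Finset.smul_sum]
    refine Finset.sum_congr rfl fun i _ => ?_
    rw [fiberOp_sum, Finset.smul_sum]
    refine Finset.sum_congr rfl fun k _ => ?_
    rw [fiberOp_smul, smul_smul]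
    congr 1
    ring
  rw [h1]
  exact smul_right_injective _ (two_ne_zero (α := ℂ)) h4

theorem inner_diracOf (Ω : ℝ) {Γ : Fin d ⊕ Fin d → Fock d →L[ℂ] Fock d} (hΓ : IsClifford Γ)
    (φ ψ : Spinor d) :
    inner ℂ (toHilb (diracOf Ω Γ φ)) (toHilb ψ) = inner ℂ (toHilb φ) (toHilb (diracOf Ω Γ ψ)) := by
  simp only [diracOf_apply, map_sum, sum_inner, inner_sum]
  refine Finset.sum_congr rfl fun k _ => ?_
  rw [inner_gen, inner_fiberOp (hΓ.symm k), fiberOp_gen]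

/-- Sorted by `∂_μ` and `x_μ`, the coefficient of `-i ∂_μ` is `i b_μ^* - i b_μ` and that of `Ω x_μ`
is `b_μ^* + b_μ`. -/
theorem diracCore₁_eq (Ω : ℝ) :
    diracCore₁ (d := d) Ω = diracOf Ω (clifford Complex.I 1) := by
  ext1 ψ
  simp only [diracOf_apply, Fintype.sum_sum_type, clifford, gen, diracCore₁, bosonA, bosonAStar,
    fermiField, fiberOp_add, fiberOp_smul, add_apply, sum_apply, ContinuousLinearMap.comp_apply,
    smul_apply, neg_apply, map_add, map_smul, ← Finset.sum_add_distrib]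
  refine Finset.sum_congr rfl fun μ _ => ?_
  simp only [Complex.conj_I, map_one]
  linear_combination (norm := module) Complex.I_mul_I • partialOp μ (fiberOp (creat μ) ψ) -
    Complex.I_mul_I • partialOp μ (fiberOp (annih μ) ψ)

theorem diracCore₂_eq (Ω : ℝ) :
    diracCore₂ (d := d) Ω = diracOf Ω (clifford (-1) (-Complex.I)) := by
  ext1 ψ
  simp only [diracOf_apply, Fintype.sum_sum_type, clifford, gen, diracCore₂, bosonA, bosonAStar,
    fermiField, fiberOp_add, fiberOp_smul, add_apply, sub_apply, sum_apply,
    ContinuousLinearMap.comp_apply,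
    smul_apply, neg_apply, map_add, map_smul, ← Finset.sum_add_distrib, Finset.smul_sum,
    ← Finset.sum_sub_distrib]
  refine Finset.sum_congr rfl fun μ _ => ?_
  simp only [Complex.conj_I, map_one, map_neg]
  module

theorem mem_graph_ofCore_iff (D : Spinor d →L[ℂ] Spinor d) (p : Hilb d × Hilb d) :
    p ∈ (ofCore D).graph ↔ ∃ ψ, (toHilb ψ, toHilb (D ψ)) = p := by
  have key : ∀ ψ (h : toHilb ψ ∈ (ofCore D).domain), ofCore D ⟨toHilb ψ, h⟩ = toHilb (D ψ) := by
    intro ψ h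
    change toHilb (D ((LinearEquiv.ofInjective toHilb _).symm ⟨toHilb ψ, h⟩)) = _
    congr 2
    exact (LinearEquiv.symm_apply_eq _).2 (Subtype.ext rfl)
  rw [LinearPMap.mem_graph_iff]
  constructor
  · rintro ⟨⟨x, ψ, rfl⟩, h1, h2⟩
    exact ⟨ψ, Prod.ext h1 ((key ψ _).symm.trans h2)⟩
  · rintro ⟨ψ, rfl⟩
    exact ⟨⟨toHilb ψ, ⟨ψ, rfl⟩⟩, rfl, key ψ _⟩

theorem isClosureOf_ofCore {D : Spinor d →L[ℂ] Spinor d}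
    (hsymm : ∀ φ ψ, inner ℂ (toHilb (D φ)) (toHilb ψ) = inner ℂ (toHilb φ) (toHilb (D ψ)))
    (hdense : DenseRange (toHilb ∘ₗ (D.toLinearMap * D.toLinearMap + 1))) :
    IsClosureOf toHilb D.toLinearMap (ofCore D).closure where
  dense := denseRange_toHilb
  symm := hsymm
  dense_sq := hdense
  graph_eq := by
    have hgraph : ((ofCore D).graph : Set (Hilb d × Hilb d)) =
        Set.range fun ψ => (toHilb ψ, toHilb (D ψ)) :=
      Set.ext fun p => mem_graph_ofCore_iff D p
    have hdom : Dense ((ofCore D).domain : Set (Hilb d)) := denseRange_toHilb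
    have hformal : (ofCore D).IsFormalAdjoint (ofCore D) := by
      intro x y
      have hx := (mem_graph_ofCore_iff D _).1 ((ofCore D).mem_graph x)
      have hy := (mem_graph_ofCore_iff D _).1 ((ofCore D).mem_graph y)
      obtain ⟨φ, hφ⟩ := hx
      obtain ⟨ψ, hψ⟩ := hy
      simp only [Prod.mk.injEq] at hφ hψ
      rw [← hφ.1, ← hφ.2, ← hψ.1, ← hψ.2]
      exact hsymm φ ψ
    -- A densely defined symmetric operator is contained in its adjoint, which is closed.
    have hclosable : (ofCore D).IsClosable :=
      LinearPMap.isClosable_iff_exists_closed_extension.2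
        ⟨_, LinearPMap.adjoint_isClosed hdom, hformal.le_adjoint hdom⟩
    rw [← hclosable.graph_closure_eq_closure_graph, Submodule.topologicalClosure_coe, hgraph]
    rfl

theorem isOscillator_diracOf (Ω : ℝ) {Γ : Fin d ⊕ Fin d → Fock d →L[ℂ] Fock d}
    (hΓ : IsClifford Γ)
    (hdense : DenseRange
      (toHilb ∘ₗ ((diracOf Ω Γ).toLinearMap * (diracOf Ω Γ).toLinearMap + 1))) :
    IsOscillator toHilb (diracOf Ω Γ).toLinearMap (ofCore (diracOf Ω Γ)).closure
      (fun k => (gen Ω k).toLinearMap) (genComm Ω) (fiberOp (diracPot Ω Γ)).toLinearMap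
      (fiberHilb (diracPot Ω Γ)) where
  toIsClosureOf := isClosureOf_ofCore (inner_diracOf Ω hΓ) hdense
  symm_gen := inner_gen Ω
  comm_gen := gen_comm Ω
  sq_eq := diracOf_diracOf Ω hΓ
  comm_pot := fiberOp_gen Ω _
  pot_eq := toHilb_fiberOp _

end Generators

end MoyalOscillator

namespace MoyalOscillator

open MeasureTheory

/-! ### Gaussians -/

section Gaussian

variable {E : Type*} [NormedAddCommGroup E] [InnerProductSpace ℝ E]

theorem pow_mul_exp_neg_sq_le {a : ℝ} (ha : 0 < a) (N : ℕ) :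
    ∃ C : ℝ, ∀ r : ℝ, 0 ≤ r → (1 + r) ^ N * Real.exp (-a * r ^ 2) ≤ C := by
  refine ⟨N.factorial * Real.exp (1 + 1 / (4 * a)), fun r hr => ?_⟩
  have h1 : (1 + r) ^ N ≤ N.factorial * Real.exp (1 + r) := by
    have := Real.pow_div_factorial_le_exp (1 + r) (by positivity) N
    rwa [div_le_iff₀ (by positivity), mul_comm] at this
  have h2 : 1 + r + -a * r ^ 2 ≤ 1 + 1 / (4 * a) := by
    have : 1 / (4 * a) - r + a * r ^ 2 = a * (r - 1 / (2 * a)) ^ 2 := by field_simp; ring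
    have h3 : 0 ≤ a * (r - 1 / (2 * a)) ^ 2 := by positivity
    linarith
  calc (1 + r) ^ N * Real.exp (-a * r ^ 2)
      ≤ N.factorial * Real.exp (1 + r) * Real.exp (-a * r ^ 2) := by gcongr
    _ = N.factorial * Real.exp (1 + r + -a * r ^ 2) := by rw [mul_assoc, ← Real.exp_add]
    _ ≤ _ := by gcongr

/-- The Gaussian `exp (-a |x|²)` as a Schwartz function. -/
noncomputable def gaussian (a : ℝ) (ha : 0 < a) : 𝓢(E, ℝ) where
  toFun x := Real.exp (-a * ‖x‖ ^ 2)
  smooth' := Real.contDiff_exp.comp (contDiff_const.mul (contDiff_norm_sq ℝ))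
  decay' k n := by
    have hf : Function.HasTemperateGrowth fun x : E => -a * ‖x‖ ^ 2 :=
      (Function.HasTemperateGrowth.const (-a)).mul (Function.hasTemperateGrowth_norm_sq E)
    obtain ⟨m, K, hK, hbound⟩ := hf.norm_iteratedFDeriv_le_uniform n
    obtain ⟨C, hC⟩ := pow_mul_exp_neg_sq_le ha (k + m * n)
    refine ⟨n.factorial * (1 + K) ^ n * C, fun x => ?_⟩
    have h1 : ‖iteratedFDeriv ℝ n (Real.exp ∘ fun x : E => -a * ‖x‖ ^ 2) x‖ ≤
        n.factorial * Real.exp (-a * ‖x‖ ^ 2) * ((1 + K) * (1 + ‖x‖) ^ m) ^ n := by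
      refine norm_iteratedFDeriv_comp_le (N := ∞) Real.contDiff_exp (contDiff_const.mul (contDiff_norm_sq ℝ))
        (by exact_mod_cast le_top) x ?_ ?_
      · intro i _
        rw [norm_iteratedFDeriv_eq_norm_iteratedDeriv, iteratedDeriv_eq_iterate,
          Real.iter_deriv_exp, Real.norm_of_nonneg (Real.exp_pos _).le]
      · intro i hi hin
        -- The estimate for derivatives of a composition wants the `i`-th inner derivative below an
        -- `i`-th power; enlarging `K` to `1 + K` makes the base at least one, so the first power
        -- suffices.
        have h2 : 1 ≤ (1 + K) * (1 + ‖x‖) ^ m :=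
          one_le_mul_of_one_le_of_one_le (by linarith)
            (one_le_pow₀ (by linarith [norm_nonneg x]))
        calc _ ≤ K * (1 + ‖x‖) ^ m := hbound i hin x
          _ ≤ (1 + K) * (1 + ‖x‖) ^ m := by gcongr; linarith
          _ ≤ _ := le_self_pow₀ h2 (by omega)
    calc ‖x‖ ^ k * ‖iteratedFDeriv ℝ n (fun x : E => Real.exp (-a * ‖x‖ ^ 2)) x‖
        ≤ (1 + ‖x‖) ^ k *
          (n.factorial * Real.exp (-a * ‖x‖ ^ 2) * ((1 + K) * (1 + ‖x‖) ^ m) ^ n) := by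
          gcongr
          · linarith
          · exact h1
      _ = n.factorial * (1 + K) ^ n * ((1 + ‖x‖) ^ (k + m * n) * Real.exp (-a * ‖x‖ ^ 2)) := by
          rw [mul_pow, pow_add, pow_mul]; ring
      _ ≤ _ := by gcongr; exact hC _ (norm_nonneg x)

theorem gaussian_apply {a : ℝ} (ha : 0 < a) (x : E) :
    gaussian a ha x = Real.exp (-a * ‖x‖ ^ 2) := rfl

end Gaussian

/-! ### Density of the Hermite functions -/

section Hermite

variable {d : ℕ}

/-- The ground states `exp (-Ω |x|² / 2) v` of the oscillator. -/
noncomputable def groundState (Ω : ℝ) (hΩ : 0 < Ω) : Fock d →ₗ[ℂ] Spinor d where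
  toFun v := SchwartzMap.postcompCLM (𝕜 := ℝ) (ContinuousLinearMap.toSpanSingleton ℝ v)
    (gaussian (Ω / 2) (half_pos hΩ))
  map_add' v w := by ext1 x; exact smul_add (gaussian (Ω / 2) (half_pos hΩ) x) v w
  map_smul' c v := by ext1 x; exact smul_comm (gaussian (Ω / 2) (half_pos hΩ) x) c v

theorem groundState_apply {Ω : ℝ} (hΩ : 0 < Ω) (v : Fock d) (x : Pt d) :
    groundState Ω hΩ v x = Real.exp (-(Ω / 2) * ‖x‖ ^ 2) • v := rfl

theorem bosonA_groundState {Ω : ℝ} (hΩ : 0 < Ω) (μ : Fin d) (v : Fock d) :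
    bosonA Ω μ (groundState Ω hΩ v) = 0 := by
  ext1 x
  have h1 : HasFDerivAt (fun x : Pt d => Real.exp (-(Ω / 2) * ‖x‖ ^ 2) • v)
      ((Real.exp (-(Ω / 2) * ‖x‖ ^ 2) • (-(Ω / 2)) • ((2 : ℕ) • (innerSL ℝ x))).smulRight v) x := by
    have := (((hasStrictFDerivAt_norm_sq x).hasFDerivAt.const_mul (-(Ω / 2))).exp).smul_const v
    simpa using this
  have h2 : (groundState Ω hΩ v : Pt d → Fock d) =
      fun x : Pt d => Real.exp (-(Ω / 2) * ‖x‖ ^ 2) • v := rfl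
  change partialOp μ (groundState Ω hΩ v) x + (Ω : ℂ) • positionOp μ (groundState Ω hΩ v) x = 0
  rw [partialOp_apply, positionOp_apply, h2, h1.fderiv]
  have h3 : (inner ℝ x (EuclideanSpace.single μ (1 : ℝ)) : ℝ) = x μ := by
    simp [EuclideanSpace.inner_single_right]
  simp only [ContinuousLinearMap.smulRight_apply, smul_apply, innerSL_apply_apply, h3, smul_eq_mul,
    smul_smul, nsmul_eq_mul]
  rw [← Complex.ofReal_mul, RCLike.real_smul_eq_coe_smul (K := ℂ),
    RCLike.real_smul_eq_coe_smul (K := ℂ) (Real.exp _), smul_smul, ← add_smul]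
  convert zero_smul ℂ v
  push_cast
  simp only [Complex.coe_algebraMap]
  push_cast
  ring

theorem bosonA_positionOp (Ω : ℝ) (μ ν : Fin d) (ψ : Spinor d) :
    bosonA Ω μ (positionOp ν ψ) = positionOp ν (bosonA Ω μ ψ) + if μ = ν then ψ else 0 := by
  rw [← partialOp_positionOp]
  simp only [bosonA, add_apply, smul_apply, map_add, map_smul, positionOp_comm μ ν]
  abel

/-- Polynomials of degree at most `n` times the Gaussian. -/
noncomputable def hermite (Ω : ℝ) (hΩ : 0 < Ω) : ℕ → Submodule ℂ (Spinor d)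
  | 0 => LinearMap.range (groundState Ω hΩ)
  | n + 1 => hermite Ω hΩ n ⊔ ⨆ μ : Fin d, (hermite Ω hΩ n).map (positionOp μ).toLinearMap

variable {Ω : ℝ} (hΩ : 0 < Ω)

theorem hermite_le_succ (n : ℕ) : hermite (d := d) Ω hΩ n ≤ hermite Ω hΩ (n + 1) := le_sup_left

theorem positionOp_mem_hermite {n : ℕ} {ψ : Spinor d} (hψ : ψ ∈ hermite Ω hΩ n) (μ : Fin d) :
    positionOp μ ψ ∈ hermite Ω hΩ (n + 1) :=
  Submodule.mem_sup_right (Submodule.mem_iSup_of_mem μ (Submodule.mem_map_of_mem hψ))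

theorem hermite_succ_induction {n : ℕ} {P : Submodule ℂ (Spinor d)}
    (h1 : ∀ ψ ∈ hermite Ω hΩ n, ψ ∈ P) (h2 : ∀ ψ ∈ hermite Ω hΩ n, ∀ μ, positionOp μ ψ ∈ P) :
    ∀ ψ ∈ hermite Ω hΩ (n + 1), ψ ∈ P := by
  change hermite Ω hΩ (n + 1) ≤ P
  refine sup_le h1 (iSup_le fun μ => Submodule.map_le_iff_le_comap.2 fun ψ hψ => h2 ψ hψ μ)

instance finiteDimensional_hermite (n : ℕ) :
    FiniteDimensional ℂ (hermite (d := d) Ω hΩ n) := by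
  induction n with
  | zero => exact inferInstanceAs (FiniteDimensional ℂ (LinearMap.range (groundState Ω hΩ)))
  | succ n ih =>
    exact inferInstanceAs (FiniteDimensional ℂ ↥(hermite Ω hΩ n ⊔
      ⨆ μ : Fin d, (hermite Ω hΩ n).map (positionOp μ).toLinearMap))

theorem fiberOp_mem_hermite (B : Fock d →L[ℂ] Fock d) (n : ℕ) :
    ∀ ψ ∈ hermite Ω hΩ n, fiberOp B ψ ∈ hermite Ω hΩ n := by
  induction n with
  | zero =>
    rintro _ ⟨v, rfl⟩
    exact ⟨B v, by ext1 x; simp [fiberOp_apply, groundState_apply]⟩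
  | succ n ih =>
    refine hermite_succ_induction hΩ
      (P := (hermite Ω hΩ (n + 1)).comap (fiberOp B).toLinearMap) ?_ ?_
    · exact fun ψ hψ => hermite_le_succ hΩ n (ih ψ hψ)
    · intro ψ hψ μ
      change fiberOp B (positionOp μ ψ) ∈ hermite Ω hΩ (n + 1)
      rw [fiberOp_positionOp]
      exact positionOp_mem_hermite hΩ (ih ψ hψ) μ

/-- The operator `a_μ` kills the Gaussian and satisfies `[a_μ, x_ν] = δ_{μν}`, so it differentiates
the polynomial factor and lowers the degree. -/
theorem bosonA_mem_hermite (μ : Fin d) (n : ℕ) :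
    (∀ ψ ∈ hermite (d := d) Ω hΩ 0, bosonA Ω μ ψ = 0) ∧
      ∀ ψ ∈ hermite Ω hΩ (n + 1), bosonA Ω μ ψ ∈ hermite Ω hΩ n := by
  have h0 : ∀ ψ ∈ hermite (d := d) Ω hΩ 0, bosonA Ω μ ψ = 0 := by
    rintro _ ⟨v, rfl⟩
    exact bosonA_groundState hΩ μ v
  refine ⟨h0, ?_⟩
  have key : ∀ n, (∀ ψ ∈ hermite Ω hΩ n, bosonA Ω μ ψ ∈ hermite Ω hΩ n) →
      (∀ ψ ∈ hermite Ω hΩ n, ∀ ν, positionOp ν (bosonA Ω μ ψ) ∈ hermite Ω hΩ n) →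
      ∀ ψ ∈ hermite Ω hΩ (n + 1), bosonA Ω μ ψ ∈ hermite Ω hΩ n := by
    intro n h1 h2
    refine hermite_succ_induction hΩ (P := (hermite Ω hΩ n).comap (bosonA Ω μ).toLinearMap) h1 ?_
    intro ψ hψ ν
    change bosonA Ω μ (positionOp ν ψ) ∈ hermite Ω hΩ n
    rw [bosonA_positionOp]
    refine add_mem (h2 ψ hψ ν) ?_
    split_ifs
    · exact hψ
    · exact zero_mem _
  induction n with
  | zero =>
    refine key 0 (fun ψ hψ => ?_) (fun ψ hψ ν => ?_) <;> simp [h0 ψ hψ]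
  | succ n ih =>
    exact key (n + 1) (fun ψ hψ => hermite_le_succ hΩ n (ih ψ hψ))
      fun ψ hψ ν => positionOp_mem_hermite hΩ (ih ψ hψ) ν

/-- The oscillator `-∂² + Ω² x²` is arranged so that every multiplication by `x` is preceded by a
lowering operator; hence it does not raise the degree. -/
theorem gen_sq_add_gen_sq (μ : Fin d) (ψ : Spinor d) :
    gen Ω (.inl μ) (gen Ω (.inl μ) ψ) + gen Ω (.inr μ) (gen Ω (.inr μ) ψ) =
      (2 * Ω : ℂ) • positionOp μ (bosonA Ω μ ψ) - bosonA Ω μ (bosonA Ω μ ψ) + (Ω : ℂ) • ψ := by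
  have h := partialOp_positionOp μ μ ψ
  rw [if_pos rfl, sub_eq_iff_eq_add] at h
  simp only [gen, bosonA, add_apply, smul_apply, map_add, map_smul, h]
  linear_combination (norm := module) (-(Complex.I_mul_I) + Complex.I_mul_I + Complex.I_mul_I) •
    partialOp μ (partialOp μ ψ)

theorem diracOf_diracOf_mem_hermite {Γ : Fin d ⊕ Fin d → Fock d →L[ℂ] Fock d}
    (hΓ : IsClifford Γ) (n : ℕ) (ψ : Spinor d) (hψ : ψ ∈ hermite Ω hΩ n) :
    diracOf Ω Γ (diracOf Ω Γ ψ) ∈ hermite Ω hΩ n := by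
  rw [diracOf_diracOf Ω hΓ, Fintype.sum_sum_type, ← Finset.sum_add_distrib]
  refine add_mem (Submodule.sum_mem _ fun μ _ => ?_) (fiberOp_mem_hermite hΩ _ n ψ hψ)
  rw [gen_sq_add_gen_sq]
  refine add_mem ?_ (Submodule.smul_mem _ _ hψ)
  cases n with
  | zero => simp [(bosonA_mem_hermite hΩ μ 0).1 ψ hψ]
  | succ n =>
    have h := (bosonA_mem_hermite hΩ μ n).2 ψ hψ
    refine sub_mem (Submodule.smul_mem _ _ (positionOp_mem_hermite hΩ h μ)) ?_
    exact hermite_le_succ hΩ n ((bosonA_mem_hermite hΩ μ n).2 _ (hermite_le_succ hΩ n h))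

/-- On the finite-dimensional invariant space, `D² + 1` is injective because `⟨φ, (D² + 1) φ⟩ = ‖D
φ‖² + ‖φ‖²`, and therefore surjective. -/
theorem exists_diracOf_sq_add_one_eq {Γ : Fin d ⊕ Fin d → Fock d →L[ℂ] Fock d}
    (hΓ : IsClifford Γ) (n : ℕ) (ψ : Spinor d) (hψ : ψ ∈ hermite Ω hΩ n) :
    ∃ φ, diracOf Ω Γ (diracOf Ω Γ φ) + φ = ψ := by
  let A : Spinor d →ₗ[ℂ] Spinor d :=
    (diracOf Ω Γ).toLinearMap * (diracOf Ω Γ).toLinearMap + 1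
  have hA : ∀ φ ∈ hermite Ω hΩ n, A φ ∈ hermite Ω hΩ n := fun φ hφ =>
    add_mem (diracOf_diracOf_mem_hermite hΩ hΓ n φ hφ) hφ
  have hinj : Function.Injective (A.restrict hA) := by
    rw [injective_iff_map_eq_zero]
    rintro ⟨φ, hφ⟩ h
    have h1 : diracOf Ω Γ (diracOf Ω Γ φ) + φ = 0 := congrArg Subtype.val h
    have h2 : inner ℂ (toHilb φ) (toHilb (diracOf Ω Γ (diracOf Ω Γ φ) + φ)) = 0 := by
      rw [h1, map_zero, inner_zero_right]
    rw [map_add, inner_add_right, ← inner_diracOf Ω hΓ] at h2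
    have h3 := congrArg Complex.re h2
    simp only [inner_self_eq_norm_sq_to_K, Complex.add_re] at h3
    have h4 : ‖toHilb (diracOf Ω Γ φ)‖ ^ 2 + ‖toHilb φ‖ ^ 2 = 0 := by exact_mod_cast h3
    have h5 : toHilb φ = 0 := by
      rw [← norm_eq_zero]; nlinarith [sq_nonneg ‖toHilb (diracOf Ω Γ φ)‖, sq_nonneg ‖toHilb φ‖]
    refine Subtype.ext (SchwartzMap.injective_toLp 2 (volume : Measure (Pt d)) ?_)
    change toHilb φ = toHilb 0
    rw [h5, map_zero]
  obtain ⟨⟨φ, hφ⟩, h⟩ := (LinearMap.injective_iff_surjective.1 hinj) ⟨ψ, hψ⟩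
  exact ⟨φ, congrArg Subtype.val h⟩

end Hermite

end MoyalOscillator

namespace MoyalOscillator

open MeasureTheory

/-! ### Uniqueness for the Fourier transform, and density of the Hermite functions -/

section HermiteDensity

open FourierTransform

variable {d : ℕ}

/-- Every test function is the Fourier transform of a Schwartz function, and the transform can be
moved across the pairing onto `h`. -/
theorem ae_eq_zero_of_fourier_eq_zero {h : Pt d → ℂ} (hh : Integrable h)
    (h0 : ∀ ξ : Pt d, 𝓕 h ξ = 0) : ∀ᵐ x, h x = 0 := by
  refine ae_eq_zero_of_integral_contDiff_smul_eq_zero hh.locallyIntegrable fun g hg hg' => ?_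
  let G : 𝓢(Pt d, ℂ) := SchwartzMap.postcompCLM (𝕜 := ℝ) Complex.ofRealCLM (hg'.toSchwartzMap hg)
  have hG : 𝓕 (𝓕⁻ G) = G := FourierTransform.fourier_fourierInv_eq G
  have h1 := VectorFourier.integral_fourierIntegral_smul_eq_flip (L := innerₗ (Pt d))
    (μ := volume) (ν := volume) Real.continuous_fourierChar continuous_inner hh
    (𝓕⁻ G).integrable
  have h2 : ∀ x, VectorFourier.fourierIntegral Real.fourierChar volume (innerₗ (Pt d)).flip
      (𝓕⁻ G : 𝓢(Pt d, ℂ)) x = g x := by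
    intro x
    have h3 : (𝓕 (𝓕⁻ G) : 𝓢(Pt d, ℂ)) x = g x := by rw [hG]; rfl
    rw [SchwartzMap.fourier_coe] at h3
    rw [← h3, flip_innerₗ]
    rfl
  have h4 : ∀ ξ, VectorFourier.fourierIntegral Real.fourierChar volume (innerₗ (Pt d)) h ξ = 0 :=
    fun ξ => h0 ξ
  simp only [h2, h4, zero_smul, integral_zero] at h1
  rw [h1]
  congr 1 with x
  simp [mul_comm]

/-- The exponential series is integrated term by term; `exp (c |x|) |h|` dominates it. -/
theorem integral_exp_mul_eq_zero {h z : Pt d → ℂ} (hm : AEStronglyMeasurable h)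
    {c : ℝ} (hexp : Integrable fun x => Real.exp (c * ‖x‖) * ‖h x‖) (hz : Continuous z)
    (hnz : ∀ x, ‖z x‖ ≤ c * ‖x‖) (h0 : ∀ n : ℕ, ∫ x, z x ^ n * h x = 0) :
    ∫ x, Complex.exp (z x) * h x = 0 := by
  have hzero : ∀ n : ℕ, ∫ x, z x ^ n / (n.factorial : ℂ) * h x = 0 := by
    intro n
    simp_rw [div_mul_eq_mul_div, integral_div, h0, zero_div]
  have hb : Integrable fun x => ∑' n : ℕ, (c * ‖x‖) ^ n / (n.factorial : ℝ) * ‖h x‖ := by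
    refine hexp.congr (ae_of_all _ fun x => ?_)
    simp only
    rw [tsum_mul_right, Real.exp_eq_exp_ℝ, NormedSpace.exp_eq_tsum_div]
  have hbound : ∀ (n : ℕ) (x : Pt d), ‖z x ^ n / (n.factorial : ℂ) * h x‖ ≤
      (c * ‖x‖) ^ n / (n.factorial : ℝ) * ‖h x‖ := by
    intro n x
    rw [norm_mul, norm_div, norm_pow, Complex.norm_natCast]
    exact mul_le_mul_of_nonneg_right (div_le_div_of_nonneg_right
      (pow_le_pow_left₀ (norm_nonneg _) (hnz x) n) (Nat.cast_nonneg _)) (norm_nonneg _)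
  have hlim : ∀ x, HasSum (fun n : ℕ => z x ^ n / (n.factorial : ℂ) * h x)
      (Complex.exp (z x) * h x) := by
    intro x
    have := NormedSpace.expSeries_div_hasSum_exp (z x)
    rw [← Complex.exp_eq_exp_ℂ] at this
    exact this.mul_right _
  have hmeas : ∀ n : ℕ, AEStronglyMeasurable (fun x => z x ^ n / (n.factorial : ℂ) * h x) :=
    fun n => ((hz.pow n).div_const _).aestronglyMeasurable.mul hm
  have hsummable : ∀ x : Pt d, Summable fun n : ℕ =>
      (c * ‖x‖) ^ n / (n.factorial : ℝ) * ‖h x‖ :=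
    fun x => (Real.summable_pow_div_factorial _).mul_right _
  have hsum := hasSum_integral_of_dominated_convergence _ hmeas
    (fun n => ae_of_all _ (hbound n)) (ae_of_all _ hsummable) hb (ae_of_all _ hlim)
  have hfun : (fun n : ℕ => ∫ x, z x ^ n / (n.factorial : ℂ) * h x) = fun _ => 0 := funext hzero
  rw [hfun] at hsum
  exact hsum.unique hasSum_zero

/-- A function of exponential decay all of whose moments vanish is zero. -/
theorem ae_eq_zero_of_moments_eq_zero {h : Pt d → ℂ} (hm : AEStronglyMeasurable h)
    (hexp : ∀ c : ℝ, 0 ≤ c → Integrable fun x => Real.exp (c * ‖x‖) * ‖h x‖)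
    (h0 : ∀ (ξ : Pt d) (n : ℕ), ∫ x, ((inner ℝ ξ x : ℝ) : ℂ) ^ n * h x = 0) :
    ∀ᵐ x, h x = 0 := by
  have hint : Integrable h := by
    refine (hexp 0 le_rfl).mono' hm (ae_of_all _ fun x => ?_)
    simp
  refine ae_eq_zero_of_fourier_eq_zero hint fun ξ => ?_
  have key := integral_exp_mul_eq_zero (z := fun x => ((-2 * Real.pi * inner ℝ ξ x : ℝ) : ℂ) * Complex.I)
    hm (hexp (2 * Real.pi * ‖ξ‖) (by positivity)) (by fun_prop) ?_ ?_
  · rw [Real.fourier_eq', ← key]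
    congr 1 with x
    rw [smul_eq_mul, real_inner_comm]
  · intro x
    rw [norm_mul, Complex.norm_I, mul_one, Complex.norm_real, Real.norm_eq_abs, abs_mul, abs_mul,
      abs_neg, abs_of_pos Real.pi_pos, Nat.abs_ofNat, mul_assoc _ ‖ξ‖]
    exact mul_le_mul_of_nonneg_left (abs_real_inner_le_norm ξ x) (by positivity)
  · intro n
    have : ∀ x : Pt d, (((-2 * Real.pi * inner ℝ ξ x : ℝ) : ℂ) * Complex.I) ^ n * h x =
        (-2 * Real.pi * Complex.I) ^ n * (((inner ℝ ξ x : ℝ) : ℂ) ^ n * h x) := by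
      intro x
      rw [← mul_assoc, ← mul_pow]
      congr 2
      push_cast
      ring
    simp_rw [this, integral_const_mul, h0, mul_zero]

variable {Ω : ℝ} (hΩ : 0 < Ω)

/-- Multiplication by the linear function `⟨ξ, ·⟩`. -/
noncomputable def linearOp (ξ : Pt d) : Spinor d →L[ℂ] Spinor d :=
  ∑ μ, ((ξ μ : ℝ) : ℂ) • positionOp μ

theorem linearOp_apply (ξ : Pt d) (ψ : Spinor d) (x : Pt d) :
    linearOp ξ ψ x = ((inner ℝ ξ x : ℝ) : ℂ) • ψ x := by
  simp only [linearOp, sum_apply, smul_apply, positionOp_apply]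
  have : (inner ℝ ξ x : ℝ) = ∑ μ, ξ μ * x μ := by
    simp [PiLp.inner_apply, mul_comm]
  rw [this, Complex.ofReal_sum, Finset.sum_smul]
  simp only [smul_smul, Complex.ofReal_mul]

theorem linearOp_pow_mem_hermite (ξ : Pt d) (n : ℕ) (v : Fock d) :
    (linearOp ξ)^[n] (groundState Ω hΩ v) ∈ hermite Ω hΩ n := by
  induction n with
  | zero => exact ⟨v, rfl⟩
  | succ n ih =>
    rw [Function.iterate_succ_apply', linearOp, sum_apply]
    exact Submodule.sum_mem _ fun μ _ => Submodule.smul_mem _ _ (positionOp_mem_hermite hΩ ih μ)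

theorem linearOp_pow_apply (ξ : Pt d) (n : ℕ) (ψ : Spinor d) (x : Pt d) :
    ((linearOp ξ)^[n] ψ) x = ((inner ℝ ξ x : ℝ) : ℂ) ^ n • ψ x := by
  induction n with
  | zero => simp
  | succ n ih => rw [Function.iterate_succ_apply', linearOp_apply, ih, smul_smul, pow_succ']

theorem exp_mul_gaussian_le {Ω : ℝ} (hΩ : 0 < Ω) {c : ℝ} (r : ℝ) :
    Real.exp (c * r) * Real.exp (-(Ω / 2) * r ^ 2) ≤
      Real.exp (c ^ 2 / Ω) * Real.exp (-(Ω / 4) * r ^ 2) := by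
  rw [← Real.exp_add, ← Real.exp_add, Real.exp_le_exp]
  have h1 : c ^ 2 / Ω - c * r + Ω / 4 * r ^ 2 = (Ω / 2 * r - c) ^ 2 / Ω := by
    field_simp; ring
  have h2 : 0 ≤ (Ω / 2 * r - c) ^ 2 / Ω := by positivity
  nlinarith

theorem eq_zero_of_orthogonal_hermite (φ : Hilb d)
    (h : ∀ n, ∀ ψ ∈ hermite Ω hΩ n, inner ℂ (toHilb ψ) φ = 0) : φ = 0 := by
  have key : ∀ v : Fock d, ∀ᵐ x, Real.exp (-(Ω / 2) * ‖x‖ ^ 2) * inner ℂ v (φ x) = 0 := by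
    intro v
    have hvm : AEStronglyMeasurable (fun x => inner ℂ v (φ x)) volume :=
      (Lp.aestronglyMeasurable φ).const_inner
    refine ae_eq_zero_of_moments_eq_zero ?_ ?_ ?_
    · exact (by fun_prop : Continuous fun x : Pt d =>
        ((Real.exp (-(Ω / 2) * ‖x‖ ^ 2) : ℝ) : ℂ)).aestronglyMeasurable.mul hvm
    -- Half of the Gaussian's exponent absorbs `exp (c |x|)`; the other half is square integrable
    -- and pairs with `φ`.
    · intro c hc
      have hL : MemLp (fun x => gaussian (E := Pt d) (Ω / 4) (by linarith) x) 2 volume :=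
        SchwartzMap.memLp _ 2 volume
      have hint : Integrable fun x => gaussian (E := Pt d) (Ω / 4) (by linarith) x * ‖φ x‖ :=
        hL.integrable_mul (Lp.memLp φ).norm
      refine (hint.const_mul (Real.exp (c ^ 2 / Ω) * ‖v‖)).mono' ?_ (ae_of_all _ fun x => ?_)
      · exact (by fun_prop : Continuous fun x : Pt d =>
          Real.exp (c * ‖x‖)).aestronglyMeasurable.mul
          ((by fun_prop : Continuous fun x : Pt d =>
          ((Real.exp (-(Ω / 2) * ‖x‖ ^ 2) : ℝ) : ℂ)).aestronglyMeasurable.mul hvm).norm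
      · rw [gaussian_apply, Real.norm_of_nonneg (by positivity), norm_mul, Complex.norm_real,
          Real.norm_of_nonneg (Real.exp_pos _).le, ← mul_assoc]
        calc _ ≤ Real.exp (c ^ 2 / Ω) * Real.exp (-(Ω / 4) * ‖x‖ ^ 2) * (‖v‖ * ‖φ x‖) := by
              exact mul_le_mul (exp_mul_gaussian_le hΩ _) (norm_inner_le_norm v (φ x))
                (norm_nonneg _) (by positivity)
          _ = _ := by ring
    · intro ξ n
      rw [← h n _ (linearOp_pow_mem_hermite hΩ ξ n v), L2.inner_def]
      refine integral_congr_ae ?_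
      filter_upwards [coeFn_toHilb ((linearOp ξ)^[n] (groundState Ω hΩ v))] with x hx
      rw [hx, linearOp_pow_apply, groundState_apply, inner_smul_left, inner_smul_left_eq_smul]
      simp
  have h1 : ∀ᵐ x, ∀ J, (φ x : Fock d) J = 0 := by
    rw [ae_all_iff]
    intro J
    filter_upwards [key (EuclideanSpace.single J 1)] with x hx
    simpa [EuclideanSpace.inner_single_left, Real.exp_ne_zero] using hx
  refine (Lp.eq_zero_iff_ae_eq_zero).2 ?_
  filter_upwards [h1] with x hx
  ext J
  exact hx J

theorem denseRange_diracOf_sq_add_one (Ω : ℝ) (hΩ : 0 < Ω)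
    {Γ : Fin d ⊕ Fin d → Fock d →L[ℂ] Fock d} (hΓ : IsClifford Γ) :
    DenseRange (toHilb ∘ₗ ((diracOf Ω Γ).toLinearMap * (diracOf Ω Γ).toLinearMap + 1)) := by
  let A := toHilb ∘ₗ ((diracOf Ω Γ).toLinearMap * (diracOf Ω Γ).toLinearMap + 1)
  change Dense (LinearMap.range A : Set (Hilb d))
  rw [Submodule.dense_iff_topologicalClosure_eq_top, Submodule.topologicalClosure_eq_top_iff,
    Submodule.eq_bot_iff]
  intro φ hφ
  refine eq_zero_of_orthogonal_hermite hΩ φ fun n ψ hψ => ?_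
  obtain ⟨χ, rfl⟩ := exists_diracOf_sq_add_one_eq hΩ hΓ n ψ hψ
  exact (Submodule.mem_orthogonal _ _).1 hφ _ ⟨χ, rfl⟩

end HermiteDensity

end MoyalOscillator

namespace MoyalOscillator

open MeasureTheory

/-! ### Smooth functions with bounded derivatives -/

section SmoothBounded

variable {d : ℕ}

namespace IsSmoothBounded

variable {f : Pt d → ℂ}

theorem hasTemperateGrowth (hf : IsSmoothBounded f) : f.HasTemperateGrowth :=
  ⟨hf.1, fun n => (hf.2 n).elim fun C hC => ⟨0, C, by simpa using hC⟩⟩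

theorem exists_bound (hf : IsSmoothBounded f) : ∃ C, 0 ≤ C ∧ ∀ x, ‖f x‖ ≤ C := by
  obtain ⟨C, hC⟩ := hf.2 0
  have h : ∀ x, ‖f x‖ ≤ C := fun x => by simpa using hC x
  exact ⟨C, (norm_nonneg _).trans (h 0), h⟩

theorem continuous (hf : IsSmoothBounded f) : Continuous f := hf.1.continuous

theorem differentiable (hf : IsSmoothBounded f) : Differentiable ℝ f :=
  hf.1.differentiable (by simp)

theorem const_smul (hf : IsSmoothBounded f) (c : ℂ) : IsSmoothBounded (fun x => c • f x) := by
  refine ⟨hf.1.const_smul c, fun n => ?_⟩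
  obtain ⟨C, hC⟩ := hf.2 n
  refine ⟨‖c‖ * C, fun x => ?_⟩
  have h : ContDiffAt ℝ n f x := (hf.1.of_le (by exact_mod_cast le_top)).contDiffAt
  have := iteratedFDeriv_const_smul_apply (a := c) h
  change ‖iteratedFDeriv ℝ n (c • f) x‖ ≤ _
  rw [this, norm_smul]
  exact mul_le_mul_of_nonneg_left (hC x) (norm_nonneg _)

theorem fderiv_apply (hf : IsSmoothBounded f) (m : Pt d) :
    IsSmoothBounded (fun x => fderiv ℝ f x m) := by
  have hd : ContDiff ℝ ∞ (fderiv ℝ f) := hf.1.fderiv_right (by simp)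
  refine ⟨hd.clm_apply contDiff_const, fun n => ?_⟩
  obtain ⟨C, hC⟩ := hf.2 (n + 1)
  refine ⟨‖ContinuousLinearMap.apply ℝ ℂ m‖ * C, fun x => ?_⟩
  have h := (ContinuousLinearMap.apply ℝ ℂ m).norm_iteratedFDeriv_comp_left (n := n) (N := ∞) (x := x)
    hd.contDiffAt (by exact_mod_cast le_top)
  refine h.trans (mul_le_mul_of_nonneg_left ?_ (norm_nonneg _))
  rw [norm_iteratedFDeriv_fderiv]
  exact hC x

end IsSmoothBounded

end SmoothBounded

/-! ### Operators with symbol `f (x + B ξ)` -/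

section SymbolOp

open FourierTransform

variable {d : ℕ}

/-- The pseudodifferential operator with symbol `f (x + B ξ)`. -/
noncomputable def symbolOp (B : Pt d →L[ℝ] Pt d) (f : Pt d → ℂ) (ψ : Spinor d) (x : Pt d) :
    Fock d :=
  ∫ ξ : Pt d, Real.fourierChar (inner ℝ ξ x) • f (x + B ξ) • 𝓕 ψ ξ

variable {B : Pt d →L[ℝ] Pt d} {f : Pt d → ℂ}

theorem IsSmoothBounded.hasTemperateGrowth_symbol (hf : IsSmoothBounded f) (B : Pt d →L[ℝ] Pt d)
    (x : Pt d) : Function.HasTemperateGrowth fun ξ : Pt d => f (x + B ξ) :=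
  hf.hasTemperateGrowth.comp
    ((Function.HasTemperateGrowth.const x).add B.hasTemperateGrowth)

/-- With `x` frozen in the symbol this is an ordinary Fourier multiplier evaluated at that same `x`,
so the rules for Schwartz functions become available. -/
theorem symbolOp_eq_fourierInv (hf : IsSmoothBounded f) (ψ : Spinor d) (x : Pt d) :
    symbolOp B f ψ x = 𝓕⁻ (SchwartzMap.smulLeftCLM (Fock d) (fun ξ => f (x + B ξ)) (𝓕 ψ)) x := by
  rw [SchwartzMap.fourierInv_coe, Real.fourierInv_eq]
  simp only [SchwartzMap.smulLeftCLM_apply_apply (hf.hasTemperateGrowth_symbol B x)]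
  rfl

theorem norm_symbolOp_integrand (ψ : Spinor d) (x ξ : Pt d) :
    ‖Real.fourierChar (inner ℝ ξ x) • f (x + B ξ) • 𝓕 ψ ξ‖ = ‖f (x + B ξ)‖ * ‖𝓕 ψ ξ‖ := by
  rw [Circle.norm_smul, norm_smul]

theorem continuous_symbolOp_integrand (hf : IsSmoothBounded f) (ψ : Spinor d) :
    Continuous fun p : Pt d × Pt d =>
      Real.fourierChar (inner ℝ p.2 p.1) • f (p.1 + B p.2) • 𝓕 ψ p.2 := by
  have h1 := hf.continuous
  have h2 := (𝓕 ψ).continuous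
  have h3 : Continuous fun p : Pt d × Pt d => Real.fourierChar (inner ℝ p.2 p.1) :=
    Real.continuous_fourierChar.comp (by fun_prop)
  fun_prop

theorem integrable_symbolOp_integrand (hf : IsSmoothBounded f) (ψ : Spinor d) (x : Pt d) :
    Integrable fun ξ : Pt d => Real.fourierChar (inner ℝ ξ x) • f (x + B ξ) • 𝓕 ψ ξ := by
  obtain ⟨C, hC0, hC⟩ := hf.exists_bound
  refine ((𝓕 ψ).integrable.norm.const_mul C).mono'
    ((continuous_symbolOp_integrand hf ψ).comp (by fun_prop :
      Continuous fun ξ : Pt d => (x, ξ))).aestronglyMeasurable (ae_of_all _ fun ξ => ?_)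
  rw [norm_symbolOp_integrand]
  exact mul_le_mul_of_nonneg_right (hC _) (norm_nonneg _)

theorem exists_norm_symbolOp_le (hf : IsSmoothBounded f) (B : Pt d →L[ℝ] Pt d) (ψ : Spinor d) :
    ∃ C, ∀ x, ‖symbolOp B f ψ x‖ ≤ C := by
  obtain ⟨C, hC0, hC⟩ := hf.exists_bound
  refine ⟨∫ ξ, C * ‖𝓕 ψ ξ‖, fun x => norm_integral_le_of_norm_le
    ((𝓕 ψ).integrable.norm.const_mul C) (ae_of_all _ fun ξ => ?_)⟩
  rw [norm_symbolOp_integrand]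
  exact mul_le_mul_of_nonneg_right (hC _) (norm_nonneg _)

theorem continuous_symbolOp (hf : IsSmoothBounded f) (ψ : Spinor d) :
    Continuous (symbolOp B f ψ) := by
  obtain ⟨C, hC0, hC⟩ := hf.exists_bound
  have hmeas : ∀ x, AEStronglyMeasurable
      (fun ξ : Pt d => Real.fourierChar (inner ℝ ξ x) • f (x + B ξ) • 𝓕 ψ ξ) volume :=
    fun x => (integrable_symbolOp_integrand hf ψ x).aestronglyMeasurable
  have hbound : ∀ x ξ : Pt d, ‖Real.fourierChar (inner ℝ ξ x) • f (x + B ξ) • 𝓕 ψ ξ‖ ≤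
      C * ‖𝓕 ψ ξ‖ := by
    intro x ξ
    rw [norm_symbolOp_integrand]
    exact mul_le_mul_of_nonneg_right (hC _) (norm_nonneg _)
  have hcont' : ∀ ξ : Pt d, Continuous fun x : Pt d =>
      Real.fourierChar (inner ℝ ξ x) • f (x + B ξ) • 𝓕 ψ ξ := by
    intro ξ
    have h1 := hf.continuous
    have h2 : Continuous fun x : Pt d => Real.fourierChar (inner ℝ ξ x) :=
      Real.continuous_fourierChar.comp (by fun_prop)
    fun_prop
  exact continuous_of_dominated hmeas (fun x => ae_of_all _ (hbound x))
    ((𝓕 ψ).integrable.norm.const_mul C) (ae_of_all _ hcont')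

theorem symbolOp_add (hf : IsSmoothBounded f) (ψ₁ ψ₂ : Spinor d) (x : Pt d) :
    symbolOp B f (ψ₁ + ψ₂) x = symbolOp B f ψ₁ x + symbolOp B f ψ₂ x := by
  unfold symbolOp
  rw [← integral_add (integrable_symbolOp_integrand hf ψ₁ x)
    (integrable_symbolOp_integrand hf ψ₂ x)]
  congr 1 with ξ : 1
  rw [FourierTransform.fourier_add, add_apply, smul_add, smul_add]

theorem symbolOp_smul (c : ℂ) (ψ : Spinor d) (x : Pt d) :
    symbolOp B f (c • ψ) x = c • symbolOp B f ψ x := by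
  unfold symbolOp
  rw [← integral_smul]
  congr 1 with ξ : 1
  rw [FourierTransform.fourier_smul, smul_apply, smul_comm (f _) c, smul_comm _ c]

theorem symbolOp_const_smul (c : ℂ) (ψ : Spinor d) (x : Pt d) :
    symbolOp B (fun y => c • f y) ψ x = c • symbolOp B f ψ x := by
  unfold symbolOp
  rw [← integral_smul]
  congr 1 with ξ : 1
  rw [smul_assoc, smul_comm _ c]

theorem symbolOp_sum (hf : IsSmoothBounded f) {ι : Type*} (s : Finset ι) (ψ : ι → Spinor d)
    (x : Pt d) : symbolOp B f (∑ i ∈ s, ψ i) x = ∑ i ∈ s, symbolOp B f (ψ i) x :=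
  map_sum (⟨⟨fun ψ => symbolOp B f ψ x, by simpa using symbolOp_smul (B := B) (f := f) 0 0 x⟩,
    fun ψ₁ ψ₂ => symbolOp_add hf ψ₁ ψ₂ x⟩ : Spinor d →+ Fock d) ψ s

theorem fourier_fiberOp (M : Fock d →L[ℂ] Fock d) (ψ : Spinor d) (ξ : Pt d) :
    𝓕 (fiberOp M ψ) ξ = M (𝓕 ψ ξ) := by
  rw [SchwartzMap.fourier_coe, SchwartzMap.fourier_coe, Real.fourier_eq, Real.fourier_eq,
    ← M.integral_comp_comm]
  · congr 1 with y : 1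
    rw [fiberOp_apply]
    exact (map_smul M ((Real.fourierChar _ : Circle) : ℂ) _).symm
  · exact (Real.fourierIntegral_convergent_iff ξ).2 ψ.integrable

theorem symbolOp_fiberOp (hf : IsSmoothBounded f) (M : Fock d →L[ℂ] Fock d) (ψ : Spinor d)
    (x : Pt d) : symbolOp B f (fiberOp M ψ) x = M (symbolOp B f ψ x) := by
  unfold symbolOp
  rw [← M.integral_comp_comm (integrable_symbolOp_integrand hf ψ x)]
  congr 1 with ξ : 1
  rw [fourier_fiberOp]
  rw [← map_smul]
  exact (map_smul M ((Real.fourierChar _ : Circle) : ℂ) _).symm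

/-- The derivative `(2πi)⁻¹ ∂_{B m} f`. -/
noncomputable def symbolDeriv (B : Pt d →L[ℝ] Pt d) (m : Pt d) (f : Pt d → ℂ) (x : Pt d) : ℂ :=
  (2 * Real.pi * Complex.I)⁻¹ • fderiv ℝ f x (B m)

theorem IsSmoothBounded.symbolDeriv (hf : IsSmoothBounded f) (B : Pt d →L[ℝ] Pt d) (m : Pt d) :
    IsSmoothBounded (symbolDeriv B m f) :=
  (hf.fderiv_apply (B m)).const_smul _

theorem positionOp_eq (μ : Fin d) (ψ : Spinor d) :
    positionOp μ ψ =
      SchwartzMap.smulLeftCLM (Fock d) (inner ℝ · (EuclideanSpace.single μ (1 : ℝ))) ψ := by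
  ext1 x
  rw [positionOp_apply, SchwartzMap.smulLeftCLM_apply_apply (by fun_prop)]
  simp [EuclideanSpace.inner_single_right]

open LineDeriv in
-- On the Fourier side multiplication by `x_μ` is differentiation. Taking the derivative off `𝓕 ψ`
-- and applying the product rule gives the factor `x_μ` outside and a derivative of `ξ ↦ f (x + B
-- ξ)`, that is, of `f` along `B e_μ`.
theorem symbolOp_positionOp (hf : IsSmoothBounded f) (μ : Fin d) (ψ : Spinor d) (x : Pt d) :
    symbolOp B f (positionOp μ ψ) x = ((x μ : ℝ) : ℂ) • symbolOp B f ψ x +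
      symbolOp B (symbolDeriv B (EuclideanSpace.single μ 1) f) ψ x := by
  set m : Pt d := EuclideanSpace.single μ (1 : ℝ)
  have hc : (2 * Real.pi * Complex.I) ≠ 0 := by
    simp [Real.pi_ne_zero]
  have ht := hf.hasTemperateGrowth_symbol B x
  have ht' := (hf.symbolDeriv B m).hasTemperateGrowth_symbol B x
  have h1 : ∂_{m} (SchwartzMap.smulLeftCLM (Fock d) (fun ξ => f (x + B ξ)) (𝓕 ψ)) =
      (2 * Real.pi * Complex.I) • (SchwartzMap.smulLeftCLM (Fock d)
        (fun ξ => symbolDeriv B m f (x + B ξ)) (𝓕 ψ) -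
        SchwartzMap.smulLeftCLM (Fock d) (fun ξ => f (x + B ξ)) (𝓕 (positionOp μ ψ))) := by
    have h2 : (2 * Real.pi * Complex.I) • 𝓕 (positionOp μ ψ) = -∂_{m} (𝓕 ψ) := by
      rw [SchwartzMap.lineDerivOp_fourier_eq, ← positionOp_eq, FourierTransform.fourier_smul,
        neg_smul, neg_neg]
    ext1 ξ
    have h2' : (2 * Real.pi * Complex.I) • (𝓕 (positionOp μ ψ) ξ) = -(∂_{m} (𝓕 ψ) ξ) :=
      congr($h2 ξ)
    rw [SchwartzMap.lineDerivOp_apply_eq_fderiv, smul_apply, sub_apply, smul_sub,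
      SchwartzMap.smulLeftCLM_apply_apply ht', SchwartzMap.smulLeftCLM_apply_apply ht,
      smul_comm _ (f _), h2',
      SchwartzMap.lineDerivOp_apply_eq_fderiv, smul_neg, sub_neg_eq_add, smul_smul]
    have e : (SchwartzMap.smulLeftCLM (Fock d) (fun ξ => f (x + B ξ)) (𝓕 ψ) : Pt d → Fock d) =
        (fun ξ => f (x + B ξ)) • ((𝓕 ψ : Spinor d) : Pt d → Fock d) :=
      funext fun ξ => SchwartzMap.smulLeftCLM_apply_apply ht _ ξ
    have hB : HasFDerivAt (fun ξ => x + B ξ) B ξ := B.hasFDerivAt.const_add x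
    have hfB : HasFDerivAt (fun ξ => f (x + B ξ)) (fderiv ℝ f (x + B ξ) ∘L B) ξ :=
      (hf.differentiable (x + B ξ)).hasFDerivAt.comp ξ hB
    rw [e, (hfB.smul (𝓕 ψ).differentiableAt.hasFDerivAt).fderiv]
    simp only [symbolDeriv, smul_eq_mul, mul_inv_cancel_left₀ hc]
    simp [add_comm]
  have h3 := congr($(SchwartzMap.fourierInv_lineDerivOp_eq
    (SchwartzMap.smulLeftCLM (Fock d) (fun ξ => f (x + B ξ)) (𝓕 ψ)) m) x)
  have hsub : ∀ φ₁ φ₂ : Spinor d, 𝓕⁻ (φ₁ - φ₂) = 𝓕⁻ φ₁ - 𝓕⁻ φ₂ := fun φ₁ φ₂ =>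
    map_sub (FourierTransform.fourierCLE ℂ (Spinor d)).symm φ₁ φ₂
  rw [h1, FourierTransform.fourierInv_smul, hsub, smul_apply, sub_apply,
    smul_apply, SchwartzMap.smulLeftCLM_apply_apply (by fun_prop), ← symbolOp_eq_fourierInv hf,
    ← symbolOp_eq_fourierInv hf, ← symbolOp_eq_fourierInv (hf.symbolDeriv B m), neg_smul,
    ← smul_neg] at h3
  have h4 := smul_right_injective _ hc h3
  have h5 : (inner ℝ x m : ℝ) = x μ := by simp [m, EuclideanSpace.inner_single_right]
  rw [h5, sub_eq_iff_eq_add] at h4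
  rw [h4]
  simp

end SymbolOp

end MoyalOscillator

namespace MoyalOscillator

open MeasureTheory

/-! ### Localised bounds for operators with symbol `f (x + B ξ)` -/

section LocalBound

open FourierTransform

variable {d : ℕ} {B : Pt d →L[ℝ] Pt d} {f : Pt d → ℂ}

theorem norm_toHilb_sq (ψ : Spinor d) : ‖toHilb ψ‖ ^ 2 = ∫ x, ‖ψ x‖ ^ 2 := by
  have h := inner_toHilb ψ ψ
  rw [inner_self_eq_norm_sq_to_K] at h
  simp only [inner_self_eq_norm_sq_to_K] at h
  have h1 : (((‖toHilb ψ‖ ^ 2 : ℝ)) : ℂ) = ((∫ x, ‖ψ x‖ ^ 2 : ℝ) : ℂ) := by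
    rw [← integral_complex_ofReal]
    push_cast
    exact h
  exact_mod_cast h1

theorem integrable_norm_sq (ψ : Spinor d) : Integrable fun x => ‖ψ x‖ ^ 2 :=
  (ψ.memLp 2 volume).integrable_norm_pow (by norm_num)

theorem integrable_add_mul {𝕜 : Type*} [RCLike 𝕜] {w p : Pt d → 𝕜} (hw : Integrable w)
    (hp : Integrable p) :
    Integrable (Function.uncurry fun s x => w (x + s) * p x) (volume.prod volume) := by
  have h := (measurePreserving_prod_add_swap (volume : Measure (Pt d)) volume).integrable_comp_of_integrable
    (hp.mul_prod hw)
  refine h.congr (ae_of_all _ fun z => ?_)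
  exact mul_comm _ _

theorem integral_integral_add_mul {𝕜 : Type*} [RCLike 𝕜] {w p : Pt d → 𝕜} (hw : Integrable w)
    (hp : Integrable p) :
    ∫ s, ∫ x, w (x + s) * p x = (∫ x, w x) * ∫ x, p x := by
  rw [integral_integral_swap (integrable_add_mul hw hp), ← integral_const_mul]
  congr 1 with x
  rw [integral_mul_const, integral_add_left_eq_self w x]

theorem integrable_uncurry_inner_symbolOp (hf : IsSmoothBounded f) {q : Pt d → ℂ}
    (hq : Continuous q) {K : ℝ} (hK : ∀ x, ‖q x‖ ≤ K) (φ ψ : Spinor d) :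
    Integrable (Function.uncurry fun x ξ : Pt d =>
      (inner ℂ (φ x) (q x • Real.fourierChar (inner ℝ ξ x) • f (x + B ξ) • 𝓕 ψ ξ) : ℂ))
      (volume.prod volume) := by
  obtain ⟨C, hC0, hC⟩ := hf.exists_bound
  have hcont : Continuous (Function.uncurry fun x ξ : Pt d =>
      (inner ℂ (φ x) (q x • Real.fourierChar (inner ℝ ξ x) • f (x + B ξ) • 𝓕 ψ ξ) : ℂ)) := by
    have h2 := continuous_symbolOp_integrand (B := B) hf ψ
    have h3 := φ.continuous
    exact Continuous.inner (h3.comp continuous_fst) ((hq.comp continuous_fst).smul h2)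
  refine ((φ.integrable.norm.mul_prod (𝓕 ψ).integrable.norm).const_mul (K * C)).mono'
    hcont.aestronglyMeasurable (ae_of_all _ fun z => ?_)
  obtain ⟨x, ξ⟩ := z
  simp only [Function.uncurry_apply_pair]
  refine (norm_inner_le_norm _ _).trans ?_
  rw [norm_smul, norm_symbolOp_integrand]
  have hK0 : 0 ≤ K := (norm_nonneg _).trans (hK x)
  calc ‖φ x‖ * (‖q x‖ * (‖f (x + B ξ)‖ * ‖𝓕 ψ ξ‖)) ≤ ‖φ x‖ * (K * (C * ‖𝓕 ψ ξ‖)) := by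
        gcongr
        · exact hK x
        · exact hC _
    _ = _ := by ring

theorem integral_inner_symbolOp (hf : IsSmoothBounded f) {q : Pt d → ℂ} (hq : Continuous q)
    {K : ℝ} (hK : ∀ x, ‖q x‖ ≤ K) (φ ψ : Spinor d) :
    ∫ x, inner ℂ (φ x) (q x • symbolOp B f ψ x) =
      ∫ ξ, ∫ x, inner ℂ (φ x) (q x • Real.fourierChar (inner ℝ ξ x) • f (x + B ξ) • 𝓕 ψ ξ) := by
  have h1 : ∀ x, inner ℂ (φ x) (q x • symbolOp B f ψ x) =
      ∫ ξ, inner ℂ (φ x) (q x • Real.fourierChar (inner ℝ ξ x) • f (x + B ξ) • 𝓕 ψ ξ) := by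
    intro x
    have h2 : Integrable fun ξ : Pt d =>
        q x • Real.fourierChar (inner ℝ ξ x) • f (x + B ξ) • 𝓕 ψ ξ :=
      (integrable_symbolOp_integrand hf ψ x).smul (q x)
    rw [symbolOp, ← integral_smul, integral_inner h2]
  simp_rw [h1]
  exact integral_integral_swap (integrable_uncurry_inner_symbolOp hf hq hK φ ψ)

theorem exists_integral_iteratedFDeriv_le (χ : 𝓢(Pt d, ℂ)) (hf : IsSmoothBounded f) (n : ℕ) :
    ∃ K, ∀ c : Pt d, ∫ x, ‖iteratedFDeriv ℝ n (fun x => f (x + c) • χ x) x‖ ≤ K := by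
  choose F hF using hf.2
  let b : Pt d → ℝ := fun x =>
    ∑ i ∈ Finset.range (n + 1), (n.choose i : ℝ) * F i * ‖iteratedFDeriv ℝ (n - i) χ x‖
  have hb : Integrable b := by
    refine integrable_finsetSum _ fun i _ => Integrable.const_mul ?_ _
    simpa using χ.integrable_pow_mul_iteratedFDeriv volume 0 (n - i)
  refine ⟨∫ x, b x, fun c => ?_⟩
  refine integral_mono_of_nonneg (ae_of_all _ fun x => norm_nonneg _) hb (ae_of_all _ fun x => ?_)
  have h1 : ContDiff ℝ ∞ fun x => f (x + c) := hf.1.comp (contDiff_id.add contDiff_const)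
  refine (norm_iteratedFDeriv_smul_le (N := ∞) h1 (χ.smooth ⊤) x
    (by exact_mod_cast le_top)).trans (Finset.sum_le_sum fun i _ => ?_)
  rw [iteratedFDeriv_comp_add_right]
  gcongr
  exact hF i _

/-- Uniform decay of the Fourier transforms of the localised translates of `f`. -/
theorem exists_fourier_bound (χ : 𝓢(Pt d, ℂ)) (hf : IsSmoothBounded f) :
    ∃ w : Pt d → ℝ, Integrable w ∧ (∀ η, 0 ≤ w η) ∧
      ∀ c η : Pt d, ‖∫ x, Real.fourierChar (inner ℝ x η) • (f (x + c) • χ x)‖ ≤ w η := by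
  choose K hK using fun n => exists_integral_iteratedFDeriv_le χ hf n
  let l := (volume : Measure (Pt d)).integrablePower
  have hbound : ∀ (n : ℕ) (c η : Pt d), ‖η‖ ^ n *
      ‖∫ x, Real.fourierChar (inner ℝ x η) • (f (x + c) • χ x)‖ ≤
        2 ^ n * ∑ p ∈ Finset.range (n + 1), K p := by
    intro n c η
    have ht : Function.HasTemperateGrowth fun x => f (x + c) :=
      hf.hasTemperateGrowth.comp (by fun_prop)
    let h : 𝓢(Pt d, ℂ) := SchwartzMap.smulLeftCLM ℂ (fun x => f (x + c)) χ
    have hh : (h : Pt d → ℂ) = fun x => f (x + c) • χ x :=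
      funext fun x => SchwartzMap.smulLeftCLM_apply_apply ht χ x
    -- The frequency is `-η`, since the integral in the claim has the opposite sign in the phase.
    have h1 := Real.pow_mul_norm_iteratedFDeriv_fourier_le (K := ⊤) (N := ⊤) (f := h) (h.smooth ⊤)
      (fun k n _ _ => h.integrable_pow_mul_iteratedFDeriv volume k n) (k := 0) (n := n) le_top le_top
      (-η)
    simp only [norm_neg, norm_iteratedFDeriv_zero, pow_zero, one_mul, Nat.cast_zero, mul_zero,
      zero_add, Finset.range_one, Finset.singleton_product, Finset.sum_map] at h1
    rw [Real.fourier_eq, hh] at h1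
    simp only [inner_neg_right, neg_neg, Function.Embedding.coeFn_mk, pow_zero, one_mul] at h1
    refine h1.trans ?_
    gcongr with p hp
    exact hK p c
  -- Decay of orders `0` and `l` suffices, where `l` is large enough for `(1 + |η|)^{-l}` to be
  -- integrable.
  refine ⟨fun η => 2 ^ l * ((2 ^ 0 * ∑ p ∈ Finset.range (0 + 1), K p) +
    2 ^ l * ∑ p ∈ Finset.range (l + 1), K p) * (1 + ‖η‖) ^ (-(l : ℝ)), ?_, ?_, ?_⟩
  · exact (Measure.integrable_pow_neg_integrablePower volume).const_mul _
  · intro η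
    have hK0 : ∀ n, 0 ≤ K n := fun n =>
      (integral_nonneg fun _ => norm_nonneg _).trans (hK n 0)
    have h2 : ∀ n, 0 ≤ ∑ p ∈ Finset.range n, K p := fun n => Finset.sum_nonneg fun p _ => hK0 p
    have := h2 (0 + 1)
    have := h2 (l + 1)
    positivity
  · intro c η
    have h0 := hbound 0 c η
    rw [pow_zero, one_mul] at h0
    have := pow_mul_le_of_le_of_pow_mul_le (k := 0) (l := l)
      (C₂ := 2 ^ l * ∑ p ∈ Finset.range (l + 1), K p) (norm_nonneg η) (norm_nonneg _) h0
      (by rw [zero_add]; exact hbound l c η)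
    rwa [pow_zero, one_mul] at this

/-- Translating `x` by `s` turns the integral, up to a phase, into the transform at `ζ + ξ` of `χ`
times the translate of `f` by `B ξ - s`. The bound `w` is uniform in the translate, so neither `s`
nor `B ξ` matters. -/
theorem norm_fourierInv_localized_le {χ : 𝓢(Pt d, ℂ)} {w : Pt d → ℝ}
    (hw : ∀ c η : Pt d, ‖∫ x, Real.fourierChar (inner ℝ x η) • (f (x + c) • χ x)‖ ≤ w η)
    (s ξ ζ : Pt d) (v : Fock d) :
    ‖∫ x : Pt d, Real.fourierChar (inner ℝ x ζ) •
      (χ (x + s) • Real.fourierChar (inner ℝ ξ x) • f (x + B ξ) • v)‖ ≤ w (ζ + ξ) * ‖v‖ := by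
  have h1 : ∀ x : Pt d, Real.fourierChar (inner ℝ x ζ) •
      (χ (x + s) • Real.fourierChar (inner ℝ ξ x) • f (x + B ξ) • v) =
      (((Real.fourierChar (inner ℝ x (ζ + ξ)) : Circle) : ℂ) * (f (x + B ξ) * χ (x + s))) • v := by
    intro x
    rw [inner_add_right, AddChar.map_add_eq_mul, real_inner_comm x ξ]
    simp only [Circle.smul_def, smul_smul, Circle.coe_mul]
    congr 1
    ring
  simp_rw [h1]
  rw [integral_smul_const, norm_smul]
  refine mul_le_mul_of_nonneg_right ?_ (norm_nonneg v)
  have h2 := integral_sub_right_eq_self (μ := (volume : Measure (Pt d))) (fun x =>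
    ((Real.fourierChar (inner ℝ x (ζ + ξ)) : Circle) : ℂ) * (f (x + B ξ) * χ (x + s))) s
  rw [← h2]
  have h3 : ∀ x : Pt d, ((Real.fourierChar (inner ℝ (x - s) (ζ + ξ)) : Circle) : ℂ) *
      (f (x - s + B ξ) * χ (x - s + s)) = ((Real.fourierChar (-inner ℝ s (ζ + ξ)) : Circle) : ℂ) *
        (Real.fourierChar (inner ℝ x (ζ + ξ)) • (f (x + (B ξ - s)) • χ x)) := by
    intro x
    rw [inner_sub_left, sub_eq_add_neg, AddChar.map_add_eq_mul, sub_add_cancel,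
      show x - s + B ξ = x + (B ξ - s) by abel]
    simp only [Circle.smul_def, smul_eq_mul, Circle.coe_mul]
    ring
  simp_rw [h3]
  rw [integral_const_mul, norm_mul, Circle.norm_coe, one_mul]
  exact hw _ _

theorem integral_inner_eq_fourierInv (φ : Spinor d) {G : Pt d → Fock d} (hG : Integrable G) :
    ∫ x, inner ℂ (φ x) (G x) =
      ∫ ζ, inner ℂ (𝓕⁻ φ ζ) (∫ x : Pt d, Real.fourierChar (inner ℝ x ζ) • G x) := by
  have h := VectorFourier.integral_sesq_fourierIntegral_eq_neg_flip (L := innerₗ (Pt d))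
    (μ := volume) (ν := volume) (innerSL ℂ (E := Fock d)) Real.continuous_fourierChar
    continuous_inner (𝓕⁻ φ).integrable hG
  have h1 : ∀ x, VectorFourier.fourierIntegral Real.fourierChar volume (innerₗ (Pt d))
      (𝓕⁻ φ : Spinor d) x = φ x := by
    intro x
    have h3 : (𝓕 (𝓕⁻ φ) : Spinor d) x = φ x := by rw [FourierTransform.fourier_fourierInv_eq]
    rw [SchwartzMap.fourier_coe] at h3
    exact h3
  simp only [h1, innerSL_apply_apply] at h
  rw [h]
  congr 1 with ζ
  congr 1
  simp only [VectorFourier.fourierIntegral, LinearMap.neg_apply, neg_neg, flip_innerₗ,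
    innerₗ_apply_apply]

/-- Between `𝓕⁻ φ` and `𝓕 ψ` the localised operator has a kernel dominated by `w (ζ + ξ)` with `w`
integrable. Schur's test, in the form `a b ≤ (a² + b²) / 2`, and Plancherel give a constant
independent of `s`. -/
theorem exists_local_bound (χ : 𝓢(Pt d, ℂ)) (hf : IsSmoothBounded f) (B : Pt d →L[ℝ] Pt d) :
    ∃ C, ∀ (s : Pt d) (φ ψ : Spinor d),
      ‖∫ x, inner ℂ (φ x) (χ (x + s) • symbolOp B f ψ x)‖ ≤
        C * (‖toHilb φ‖ ^ 2 + ‖toHilb ψ‖ ^ 2) := by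
  obtain ⟨w, hwi, hw0, hw⟩ := exists_fourier_bound χ hf
  obtain ⟨F, hF0, hF⟩ := hf.exists_bound
  refine ⟨(∫ x, w x) / 2, fun s φ ψ => ?_⟩
  obtain ⟨K, hK⟩ : ∃ K, ∀ x, ‖χ (x + s)‖ ≤ K :=
    ⟨‖χ.toBoundedContinuousFunction‖, fun x =>
      χ.toBoundedContinuousFunction.norm_coe_le_norm (x + s)⟩
  have hχc : Continuous fun x => χ (x + s) := χ.continuous.comp (by fun_prop)
  rw [integral_inner_symbolOp hf hχc hK]
  have hP := integrable_add_mul hwi (integrable_norm_sq (𝓕⁻ φ))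
  have hPlanch : ∀ φ : Spinor d, ∫ x, ‖𝓕 φ x‖ ^ 2 = ‖toHilb φ‖ ^ 2 := fun φ => by
    rw [norm_toHilb_sq, SchwartzMap.integral_norm_sq_fourier]
  have hPlanch' : ∫ x, ‖𝓕⁻ φ x‖ ^ 2 = ‖toHilb φ‖ ^ 2 := by
    rw [← norm_toHilb_sq, ← hPlanch, FourierTransform.fourier_fourierInv_eq, norm_toHilb_sq]
  have hH : Integrable fun ξ => ((∫ ζ, w (ζ + ξ) * ‖𝓕⁻ φ ζ‖ ^ 2) +
      (∫ x, w x) * ‖𝓕 ψ ξ‖ ^ 2) / 2 :=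
    (hP.integral_prod_left.add ((integrable_norm_sq (𝓕 ψ)).const_mul _)).div_const 2
  have hint : ∫ ξ, ((∫ ζ, w (ζ + ξ) * ‖𝓕⁻ φ ζ‖ ^ 2) + (∫ x, w x) * ‖𝓕 ψ ξ‖ ^ 2) / 2 =
      (∫ x, w x) / 2 * (‖toHilb φ‖ ^ 2 + ‖toHilb ψ‖ ^ 2) := by
    have hP1 : Integrable fun ξ => ∫ ζ, w (ζ + ξ) * ‖𝓕⁻ φ ζ‖ ^ 2 := hP.integral_prod_left
    rw [integral_div, integral_add hP1
      ((integrable_norm_sq (𝓕 ψ)).const_mul _), integral_const_mul, hPlanch,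
      integral_integral_add_mul hwi (integrable_norm_sq (𝓕⁻ φ)), hPlanch']
    ring
  rw [← hint]
  refine norm_integral_le_of_norm_le hH ?_
  filter_upwards [hP.prod_right_ae] with ξ hξ
  let G : Pt d → Fock d := fun x =>
    χ (x + s) • Real.fourierChar (inner ℝ ξ x) • f (x + B ξ) • 𝓕 ψ ξ
  have hG : Integrable G := by
    have h1 := hf.continuous
    have h2 : Continuous fun x : Pt d => Real.fourierChar (inner ℝ ξ x) :=
      Real.continuous_fourierChar.comp (by fun_prop)
    have h3 : Continuous G := by fun_prop
    refine ((χ.integrable.comp_add_right s).norm.mul_const (F * ‖𝓕 ψ ξ‖)).mono'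
      h3.aestronglyMeasurable (ae_of_all _ fun x => ?_)
    rw [norm_smul, norm_symbolOp_integrand]
    gcongr
    exact hF _
  change ‖∫ x, inner ℂ (φ x) (G x)‖ ≤ _
  rw [integral_inner_eq_fourierInv φ hG]
  have hwξ : Integrable fun ζ => w (ζ + ξ) * ‖𝓕 ψ ξ‖ ^ 2 := (hwi.comp_add_right ξ).mul_const _
  have hξ' : Integrable fun ζ => w (ζ + ξ) * ‖𝓕⁻ φ ζ‖ ^ 2 := hξ
  have hsum : Integrable fun ζ => (w (ζ + ξ) * ‖𝓕⁻ φ ζ‖ ^ 2 + w (ζ + ξ) * ‖𝓕 ψ ξ‖ ^ 2) / 2 :=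
    (hξ'.add hwξ).div_const 2
  have hle := norm_integral_le_of_norm_le
    (f := fun ζ => inner ℂ (𝓕⁻ φ ζ) (∫ x : Pt d, Real.fourierChar (inner ℝ x ζ) • G x))
    hsum
    (ae_of_all _ fun ζ => by
      have h1 := norm_fourierInv_localized_le (B := B) hw s ξ ζ (𝓕 ψ ξ)
      have h2 := norm_inner_le_norm (𝕜 := ℂ) (𝓕⁻ φ ζ)
        (∫ x : Pt d, Real.fourierChar (inner ℝ x ζ) • G x)
      have h3 := hw0 (ζ + ξ)
      calc _ ≤ _ := h2
        _ ≤ ‖𝓕⁻ φ ζ‖ * (w (ζ + ξ) * ‖𝓕 ψ ξ‖) := mul_le_mul_of_nonneg_left h1 (norm_nonneg _)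
        _ ≤ (w (ζ + ξ) * ‖𝓕⁻ φ ζ‖ ^ 2 + w (ζ + ξ) * ‖𝓕 ψ ξ‖ ^ 2) / 2 := by
          nlinarith [mul_nonneg h3 (sq_nonneg (‖𝓕⁻ φ ζ‖ - ‖𝓕 ψ ξ‖))])
  refine hle.trans (le_of_eq ?_)
  rw [integral_div, integral_add hξ' hwξ, integral_mul_const, integral_add_right_eq_self w ξ]

end LocalBound

end MoyalOscillator

namespace MoyalOscillator

open MeasureTheory

/-! ### `L²` bounds for operators with symbol `f (x + B ξ)` -/

section Weights

variable {d : ℕ} {B : Pt d →L[ℝ] Pt d} {f : Pt d → ℂ}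

/-- Multiplication by `x_μ + s_μ`. -/
noncomputable def shiftOp (s : Pt d) (μ : Fin d) : Spinor d →L[ℂ] Spinor d :=
  positionOp μ + ((s μ : ℝ) : ℂ) • ContinuousLinearMap.id ℂ (Spinor d)

/-- Multiplication by `1 + |x + s|²`. -/
noncomputable def weightOp (s : Pt d) : Spinor d →L[ℂ] Spinor d :=
  ContinuousLinearMap.id ℂ (Spinor d) + ∑ μ, shiftOp s μ ∘L shiftOp s μ

theorem shiftOp_apply (s : Pt d) (μ : Fin d) (ψ : Spinor d) (x : Pt d) :
    shiftOp s μ ψ x = (((x + s) μ : ℝ) : ℂ) • ψ x := by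
  change positionOp μ ψ x + ((s μ : ℝ) : ℂ) • ψ x = _
  rw [positionOp_apply, ← add_smul, ← Complex.ofReal_add]
  rfl

theorem symbolOp_shiftOp (hf : IsSmoothBounded f) (s : Pt d) (μ : Fin d) (ψ : Spinor d)
    (x : Pt d) : symbolOp B f (shiftOp s μ ψ) x = (((x + s) μ : ℝ) : ℂ) • symbolOp B f ψ x +
      symbolOp B (symbolDeriv B (EuclideanSpace.single μ 1) f) ψ x := by
  change symbolOp B f (positionOp μ ψ + ((s μ : ℝ) : ℂ) • ψ) x = _
  rw [symbolOp_add hf, symbolOp_smul, symbolOp_positionOp hf, PiLp.add_apply, Complex.ofReal_add,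
    add_smul]
  abel

theorem weightOp_apply (s : Pt d) (ψ : Spinor d) (x : Pt d) :
    weightOp s ψ x = (1 + ‖x + s‖ ^ 2) • ψ x := by
  have h : weightOp s ψ x = ψ x + ∑ μ, shiftOp s μ (shiftOp s μ ψ) x := by
    simp [weightOp, sum_apply, add_apply]
  rw [h, EuclideanSpace.real_norm_sq_eq, add_smul, one_smul, Finset.sum_smul]
  congr 1
  refine Finset.sum_congr rfl fun μ _ => ?_
  rw [shiftOp_apply, shiftOp_apply, smul_smul, ← Complex.ofReal_mul, ← sq]
  exact (RCLike.real_smul_eq_coe_smul (K := ℂ) _ _).symm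

theorem weightOp_iterate_apply (s : Pt d) (M : ℕ) (ψ : Spinor d) (x : Pt d) :
    ((weightOp s)^[M] ψ) x = (1 + ‖x + s‖ ^ 2) ^ M • ψ x := by
  induction M with
  | zero => simp
  | succ M ih => rw [Function.iterate_succ_apply', weightOp_apply, ih, smul_smul, pow_succ' (1 + _)]

theorem symbolOp_weightOp (hf : IsSmoothBounded f) (s : Pt d) (ψ : Spinor d) (x : Pt d) :
    symbolOp B f (weightOp s ψ) x = ((1 + ‖x + s‖ ^ 2 : ℝ) : ℂ) • symbolOp B f ψ x +
      ∑ μ, ((2 * (((x + s) μ : ℝ) : ℂ)) •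
          symbolOp B (symbolDeriv B (EuclideanSpace.single μ 1) f) ψ x +
        symbolOp B (symbolDeriv B (EuclideanSpace.single μ 1)
          (symbolDeriv B (EuclideanSpace.single μ 1) f)) ψ x) := by
  have h : weightOp s ψ = ψ + ∑ μ, shiftOp s μ (shiftOp s μ ψ) := by
    simp [weightOp, sum_apply, add_apply]
  rw [h, symbolOp_add hf, symbolOp_sum hf, EuclideanSpace.real_norm_sq_eq, Complex.ofReal_add,
    Complex.ofReal_one, add_smul, one_smul, add_assoc, Complex.ofReal_sum, Finset.sum_smul,
    ← Finset.sum_add_distrib]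
  congr 1
  refine Finset.sum_congr rfl fun μ _ => ?_
  have hf' := hf.symbolDeriv B (EuclideanSpace.single μ 1)
  rw [symbolOp_shiftOp hf, symbolOp_shiftOp hf, symbolOp_shiftOp hf']
  push_cast
  module

theorem integrable_inner_symbolOp (hf : IsSmoothBounded f) {q : Pt d → ℂ} (hq : Continuous q)
    {K : ℝ} (hK : ∀ x, ‖q x‖ ≤ K) (φ ψ : Spinor d) :
    Integrable fun x => inner ℂ (φ x) (q x • symbolOp B f ψ x) := by
  obtain ⟨C, hC⟩ := exists_norm_symbolOp_le hf B ψ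
  have h1 := continuous_symbolOp (B := B) hf ψ
  refine (φ.integrable.norm.mul_const (K * C)).mono'
    (φ.continuous.inner (hq.smul h1)).aestronglyMeasurable (ae_of_all _ fun x => ?_)
  refine (norm_inner_le_norm _ _).trans (mul_le_mul_of_nonneg_left ?_ (norm_nonneg _))
  rw [norm_smul]
  exact mul_le_mul (hK x) (hC x) (norm_nonneg _) ((norm_nonneg _).trans (hK x))

theorem integrable_inner_localized (hf : IsSmoothBounded f) (χ : 𝓢(Pt d, ℂ)) (s : Pt d)
    (φ ψ : Spinor d) : Integrable fun x => inner ℂ (φ x) (χ (x + s) • symbolOp B f ψ x) :=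
  integrable_inner_symbolOp hf (χ.continuous.comp (by fun_prop)) (fun x =>
    χ.toBoundedContinuousFunction.norm_coe_le_norm (x + s)) φ ψ

/-- A weight on the input can be pulled out of the operator: it multiplies `χ` by polynomials and
replaces `f` by derivatives. The induction therefore runs over all `χ` and `f` at once. -/
theorem exists_weighted_local_bound (B : Pt d →L[ℝ] Pt d) (M : ℕ) :
    ∀ (χ : 𝓢(Pt d, ℂ)) (f : Pt d → ℂ), IsSmoothBounded f → ∃ C, ∀ (s : Pt d) (φ ψ : Spinor d),
      ‖∫ x, inner ℂ (φ x) (χ (x + s) • symbolOp B f ((weightOp s)^[M] ψ) x)‖ ≤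
        C * (‖toHilb φ‖ ^ 2 + ‖toHilb ψ‖ ^ 2) := by
  induction M with
  | zero => exact fun χ f hf => exists_local_bound χ hf B
  | succ M ih =>
    intro χ f hf
    let e : Fin d → Pt d := fun μ => EuclideanSpace.single μ 1
    have hf1 : ∀ μ, IsSmoothBounded (symbolDeriv B (e μ) f) := fun μ => hf.symbolDeriv B _
    have hf2 : ∀ μ, IsSmoothBounded (symbolDeriv B (e μ) (symbolDeriv B (e μ) f)) :=
      fun μ => (hf1 μ).symbolDeriv B _
    have ht0 : Function.HasTemperateGrowth fun x : Pt d => ((1 + ‖x‖ ^ 2 : ℝ) : ℂ) :=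
      Complex.ofRealCLM.hasTemperateGrowth.comp
        ((Function.HasTemperateGrowth.const 1).add (Function.hasTemperateGrowth_norm_sq (Pt d)))
    have ht1 : ∀ μ, Function.HasTemperateGrowth fun x : Pt d => 2 * ((x μ : ℝ) : ℂ) :=
      fun μ => (Function.HasTemperateGrowth.const 2).mul (hasTemperateGrowth_coord μ)
    let χ0 : 𝓢(Pt d, ℂ) := SchwartzMap.smulLeftCLM ℂ (fun x : Pt d => ((1 + ‖x‖ ^ 2 : ℝ) : ℂ)) χ
    let χ1 : Fin d → 𝓢(Pt d, ℂ) := fun μ =>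
      SchwartzMap.smulLeftCLM ℂ (fun x : Pt d => 2 * ((x μ : ℝ) : ℂ)) χ
    obtain ⟨C0, hC0⟩ := ih χ0 f hf
    choose C1 hC1 using fun μ => ih (χ1 μ) _ (hf1 μ)
    choose C2 hC2 using fun μ => ih χ _ (hf2 μ)
    refine ⟨C0 + ∑ μ, (C1 μ + C2 μ), fun s φ ψ => ?_⟩
    set ψ' := (weightOp s)^[M] ψ with hψ'
    have hexp : ∀ x, inner ℂ (φ x) (χ (x + s) • symbolOp B f ((weightOp s)^[M + 1] ψ) x) =
        inner ℂ (φ x) (χ0 (x + s) • symbolOp B f ψ' x) +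
        ∑ μ, (inner ℂ (φ x) (χ1 μ (x + s) • symbolOp B (symbolDeriv B (e μ) f) ψ' x) +
          inner ℂ (φ x)
            (χ (x + s) • symbolOp B (symbolDeriv B (e μ) (symbolDeriv B (e μ) f)) ψ' x)) := by
      intro x
      rw [Function.iterate_succ_apply', ← hψ', symbolOp_weightOp hf, smul_add, Finset.smul_sum,
        inner_add_right, inner_sum, SchwartzMap.smulLeftCLM_apply_apply ht0, smul_smul,
        smul_eq_mul, mul_comm (χ _)]
      congr 1
      refine Finset.sum_congr rfl fun μ _ => ?_
      rw [smul_add, inner_add_right, SchwartzMap.smulLeftCLM_apply_apply (ht1 μ), smul_smul,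
        smul_eq_mul, mul_comm (χ _)]
    have hi0 := integrable_inner_localized (B := B) hf χ0 s φ ψ'
    have hi1 := fun μ => integrable_inner_localized (B := B) (hf1 μ) (χ1 μ) s φ ψ'
    have hi2 := fun μ => integrable_inner_localized (B := B) (hf2 μ) χ s φ ψ'
    have hi12 : ∀ μ ∈ Finset.univ, Integrable fun x =>
        inner ℂ (φ x) (χ1 μ (x + s) • symbolOp B (symbolDeriv B (e μ) f) ψ' x) +
          inner ℂ (φ x)
            (χ (x + s) • symbolOp B (symbolDeriv B (e μ) (symbolDeriv B (e μ) f)) ψ' x) :=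
      fun μ _ => (hi1 μ).add (hi2 μ)
    simp_rw [hexp]
    rw [integral_add hi0 (integrable_finsetSum _ hi12), integral_finsetSum _ hi12, add_mul,
      Finset.sum_mul]
    refine (norm_add_le _ _).trans (add_le_add (hC0 s φ ψ) ((norm_sum_le _ _).trans
      (Finset.sum_le_sum fun μ _ => ?_)))
    rw [integral_add (hi1 μ) (hi2 μ), add_mul]
    exact (norm_add_le _ _).trans (add_le_add (hC1 μ s φ ψ) (hC2 μ s φ ψ))

end Weights

/-! ### The global bound, by averaging the localised ones. -/

section CalderonVaillancourt

variable {d : ℕ} {f : Pt d → ℂ}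

/-- The form is averaged over translates `|χ(x + s)|²`. One factor `χ` localises `φ`, the other the
operator; `ψ` is localised by writing it as `M` weights applied to `u(· + s) ψ`. The local bounds
are uniform in `s`, and by Fubini the squared norms of the pieces integrate to multiples of `‖φ‖²`
and `‖ψ‖²`. -/
theorem exists_quadratic_bound (hf : IsSmoothBounded f) (B : Pt d →L[ℝ] Pt d) :
    ∃ C, 0 ≤ C ∧ ∀ φ ψ : Spinor d, ‖∫ x, inner ℂ (φ x) (symbolOp B f ψ x)‖ ≤
      C * (‖toHilb φ‖ ^ 2 + ‖toHilb ψ‖ ^ 2) := by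
  let χ : 𝓢(Pt d, ℂ) :=
    SchwartzMap.postcompCLM (𝕜 := ℝ) Complex.ofRealCLM (gaussian 1 one_pos)
  have hχ : ∀ x, ‖χ x‖ ^ 2 = Real.exp (-2 * ‖x‖ ^ 2) := by
    intro x
    have : χ x = ((Real.exp (-1 * ‖x‖ ^ 2) : ℝ) : ℂ) := rfl
    rw [this, Complex.norm_real, Real.norm_of_nonneg (Real.exp_pos _).le, ← Real.exp_nat_mul]
    congr 1
    push_cast
    ring
  have hχi : Integrable fun x => ‖χ x‖ ^ 2 :=
    (χ.memLp 2 volume).integrable_norm_pow (by norm_num)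
  set κ := ∫ x, ‖χ x‖ ^ 2 with hκ
  have hκ0 : 0 < κ := by
    rw [hκ, integral_pos_iff_support_of_nonneg (fun x => by positivity) hχi]
    have : Function.support (fun x => ‖χ x‖ ^ 2) = Set.univ := by
      ext x; simp [hχ, Real.exp_ne_zero]
    rw [this]
    exact isOpen_univ.measure_pos volume Set.univ_nonempty
  -- Square integrability of `(1 + |x|²)^{-M}` needs `4 M > d`.
  let M := d + 1
  let u : Pt d → ℝ := fun x => (1 + ‖x‖ ^ 2) ^ (-(M : ℝ))
  have hu : ∀ x, (1 + ‖x‖ ^ 2) ^ M * u x = 1 := by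
    intro x
    have : 0 < 1 + ‖x‖ ^ 2 := by positivity
    simp only [u, Real.rpow_neg this.le, Real.rpow_natCast]
    exact mul_inv_cancel₀ (by positivity)
  have hui : Integrable fun x => u x ^ 2 := by
    have h1 := integrable_rpow_neg_one_add_norm_sq (E := Pt d) (μ := volume)
      (r := 4 * (M : ℝ)) (by
        simp only [finrank_euclideanSpace, Fintype.card_fin, M]
        push_cast
        have : (0 : ℝ) ≤ d := Nat.cast_nonneg d
        linarith)
    refine h1.congr (ae_of_all _ fun x => ?_)
    simp only [u]
    rw [← Real.rpow_natCast (_ ^ (-(M : ℝ))), ← Real.rpow_mul (by positivity)]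
    congr 1
    push_cast
    ring
  have hut : Function.HasTemperateGrowth u := Function.hasTemperateGrowth_one_add_norm_sq_rpow _ _
  set κ' := ∫ x, u x ^ 2 with hκ'
  have hκ'0 : 0 ≤ κ' := integral_nonneg fun x => sq_nonneg _
  obtain ⟨C, hC⟩ := exists_weighted_local_bound B M χ f hf
  refine ⟨κ⁻¹ * (|C| * (κ + κ')), by positivity, fun φ ψ => ?_⟩
  have hbase : Integrable fun x => inner ℂ (φ x) (symbolOp B f ψ x) := by
    simpa using integrable_inner_symbolOp (B := B) hf (q := fun _ => 1) continuous_const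
      (K := 1) (by simp) φ ψ
  have hχc : Integrable fun x => ((‖χ x‖ ^ 2 : ℝ) : ℂ) := hχi.ofReal
  have havg : (κ : ℂ) * ∫ x, inner ℂ (φ x) (symbolOp B f ψ x) =
      ∫ s, ∫ x, ((‖χ (x + s)‖ ^ 2 : ℝ) : ℂ) * inner ℂ (φ x) (symbolOp B f ψ x) := by
    rw [integral_integral_add_mul hχc hbase, hκ, integral_complex_ofReal]
  have hshift : ∀ s : Pt d, Function.HasTemperateGrowth fun x : Pt d => x + s := fun s => by
    fun_prop
  have htχ : ∀ s, Function.HasTemperateGrowth fun x => χ (x + s) := fun s =>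
    χ.hasTemperateGrowth.comp (hshift s)
  have htu : ∀ s, Function.HasTemperateGrowth fun x => u (x + s) := fun s => hut.comp (hshift s)
  let φs : Pt d → Spinor d := fun s => SchwartzMap.smulLeftCLM (Fock d) (fun x => χ (x + s)) φ
  let θs : Pt d → Spinor d := fun s => SchwartzMap.smulLeftCLM (Fock d) (fun x => u (x + s)) ψ
  have hθ : ∀ s, (weightOp s)^[M] (θs s) = ψ := by
    intro s
    ext1 x
    rw [weightOp_iterate_apply, SchwartzMap.smulLeftCLM_apply_apply (htu s), smul_smul, hu,
      one_smul]
  have hloc : ∀ s, ∫ x, ((‖χ (x + s)‖ ^ 2 : ℝ) : ℂ) * inner ℂ (φ x) (symbolOp B f ψ x) =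
      ∫ x, inner ℂ (φs s x) (χ (x + s) • symbolOp B f ((weightOp s)^[M] (θs s)) x) := by
    intro s
    rw [hθ]
    congr 1 with x
    rw [SchwartzMap.smulLeftCLM_apply_apply (htχ s), inner_smul_left, inner_smul_right, ← mul_assoc,
      mul_comm ((starRingEnd ℂ) _), Complex.mul_conj, Complex.normSq_eq_norm_sq]
  have hnφ : ∀ s, ‖toHilb (φs s)‖ ^ 2 = ∫ x, ‖χ (x + s)‖ ^ 2 * ‖φ x‖ ^ 2 := by
    intro s
    rw [norm_toHilb_sq]
    congr 1 with x
    rw [SchwartzMap.smulLeftCLM_apply_apply (htχ s), norm_smul, mul_pow]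
  have hnθ : ∀ s, ‖toHilb (θs s)‖ ^ 2 = ∫ x, u (x + s) ^ 2 * ‖ψ x‖ ^ 2 := by
    intro s
    rw [norm_toHilb_sq]
    congr 1 with x
    rw [SchwartzMap.smulLeftCLM_apply_apply (htu s), norm_smul, mul_pow, Real.norm_eq_abs, sq_abs]
  have hI1 : Integrable fun s => ‖toHilb (φs s)‖ ^ 2 := by
    simp_rw [hnφ]
    exact (integrable_add_mul hχi (integrable_norm_sq φ)).integral_prod_left
  have hI2 : Integrable fun s => ‖toHilb (θs s)‖ ^ 2 := by
    simp_rw [hnθ]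
    exact (integrable_add_mul hui (integrable_norm_sq ψ)).integral_prod_left
  have hJ1 : ∫ s, ‖toHilb (φs s)‖ ^ 2 = κ * ‖toHilb φ‖ ^ 2 := by
    simp_rw [hnφ]
    rw [integral_integral_add_mul hχi (integrable_norm_sq φ), norm_toHilb_sq]
  have hJ2 : ∫ s, ‖toHilb (θs s)‖ ^ 2 = κ' * ‖toHilb ψ‖ ^ 2 := by
    simp_rw [hnθ]
    rw [integral_integral_add_mul hui (integrable_norm_sq ψ), norm_toHilb_sq]
  have hle : ‖(κ : ℂ) * ∫ x, inner ℂ (φ x) (symbolOp B f ψ x)‖ ≤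
      |C| * (κ * ‖toHilb φ‖ ^ 2 + κ' * ‖toHilb ψ‖ ^ 2) := by
    rw [havg, ← hJ1, ← hJ2, ← integral_add hI1 hI2, ← integral_const_mul]
    refine norm_integral_le_of_norm_le ((hI1.add hI2).const_mul _) (ae_of_all _ fun s => ?_)
    rw [hloc]
    refine (hC s (φs s) (θs s)).trans ?_
    exact mul_le_mul_of_nonneg_right (le_abs_self C) (by positivity)
  rw [norm_mul, Complex.norm_real, Real.norm_of_nonneg hκ0.le] at hle
  rw [mul_assoc, ← div_eq_inv_mul, le_div_iff₀ hκ0, mul_comm]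
  refine hle.trans ?_
  rw [mul_assoc]
  refine mul_le_mul_of_nonneg_left ?_ (abs_nonneg C)
  nlinarith [mul_nonneg hκ0.le (sq_nonneg ‖toHilb ψ‖), mul_nonneg hκ'0 (sq_nonneg ‖toHilb φ‖)]

end CalderonVaillancourt

end MoyalOscillator

namespace MoyalOscillator

open MeasureTheory

/-! ### The bounded operators with symbol `f (x + B ξ)` -/

section BoundedSymbolOp

open FourierTransform

variable {d : ℕ} {B : Pt d →L[ℝ] Pt d} {f : Pt d → ℂ}

theorem norm_le_sum_abs (x : Pt d) : ‖x‖ ≤ ∑ μ, |x μ| := by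
  have h := (EuclideanSpace.basisFun (Fin d) ℝ).sum_repr x
  conv_lhs => rw [← h]
  refine (norm_sum_le _ _).trans (Finset.sum_le_sum fun μ _ => ?_)
  rw [norm_smul, OrthonormalBasis.norm_eq_one, mul_one]
  simp

/-- A factor `x_μ` is moved onto `ψ` at the cost of a derivative of `f`, so the induction needs all
`f` and `ψ`. The decay puts the function in `L²` before any operator bound is known. -/
theorem exists_pow_mul_norm_symbolOp_le (B : Pt d →L[ℝ] Pt d) (n : ℕ) :
    ∀ (f : Pt d → ℂ), IsSmoothBounded f → ∀ ψ : Spinor d,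
      ∃ C, ∀ x, ‖x‖ ^ n * ‖symbolOp B f ψ x‖ ≤ C := by
  induction n with
  | zero => exact fun f hf ψ => by simpa using exists_norm_symbolOp_le hf B ψ
  | succ n ih =>
    intro f hf ψ
    choose C hC using fun μ => ih f hf (positionOp μ ψ)
    choose K hK using fun μ => ih _ (hf.symbolDeriv B (EuclideanSpace.single μ 1)) ψ
    refine ⟨∑ μ, (C μ + K μ), fun x => ?_⟩
    calc ‖x‖ ^ (n + 1) * ‖symbolOp B f ψ x‖
        = ‖x‖ * (‖x‖ ^ n * ‖symbolOp B f ψ x‖) := by ring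
      _ ≤ (∑ μ, |x μ|) * (‖x‖ ^ n * ‖symbolOp B f ψ x‖) :=
        mul_le_mul_of_nonneg_right (norm_le_sum_abs x) (by positivity)
      _ = ∑ μ, ‖x‖ ^ n * ‖((x μ : ℝ) : ℂ) • symbolOp B f ψ x‖ := by
        rw [Finset.sum_mul]
        refine Finset.sum_congr rfl fun μ _ => ?_
        rw [norm_smul, Complex.norm_real, Real.norm_eq_abs]
        ring
      _ ≤ _ := Finset.sum_le_sum fun μ _ => by
        rw [eq_sub_of_add_eq (symbolOp_positionOp (B := B) hf μ ψ x).symm]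
        refine (mul_le_mul_of_nonneg_left (norm_sub_le _ _) (by positivity)).trans ?_
        rw [mul_add]
        exact add_le_add (hC μ x) (hK μ x)

theorem memLp_symbolOp (hf : IsSmoothBounded f) (B : Pt d →L[ℝ] Pt d) (ψ : Spinor d) :
    MemLp (symbolOp B f ψ) 2 (volume : Measure (Pt d)) := by
  have hmeas := (continuous_symbolOp (B := B) hf ψ).aestronglyMeasurable (μ := volume)
  rw [memLp_two_iff_integrable_sq_norm hmeas]
  obtain ⟨C₀, hC₀⟩ := exists_norm_symbolOp_le hf B ψ
  set l := (volume : Measure (Pt d)).integrablePower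
  obtain ⟨C₁, hC₁⟩ := exists_pow_mul_norm_symbolOp_le B l f hf ψ
  have h0 : 0 ≤ C₀ := (norm_nonneg _).trans (hC₀ 0)
  have h1 : ∀ x, ‖‖symbolOp B f ψ x‖ ^ 2‖ ≤ C₀ * C₀ := fun x => by
    rw [norm_pow, norm_norm, sq]
    exact mul_le_mul (hC₀ x) (hC₀ x) (norm_nonneg _) h0
  have h2 : ∀ x, ‖x‖ ^ (0 + l) * ‖‖symbolOp B f ψ x‖ ^ 2‖ ≤ C₁ * C₀ := fun x => by
    rw [norm_pow, norm_norm, sq, zero_add, ← mul_assoc]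
    exact mul_le_mul (hC₁ x) (hC₀ x) (norm_nonneg _) ((by positivity : (0:ℝ) ≤ _).trans (hC₁ x))
  have := integrable_of_le_of_pow_mul_le (k := 0) h1 h2 (hmeas.norm.pow 2)
  simpa using this

/-- The bounded operator `T` extends `symbolOp B f`. -/
def IsSymbolOp (B : Pt d →L[ℝ] Pt d) (f : Pt d → ℂ) (T : Hilb d →L[ℂ] Hilb d) : Prop :=
  ∀ ψ : Spinor d, T (toHilb ψ) =ᵐ[volume] symbolOp B f ψ

theorem inner_toHilb_eq_integral (φ : Spinor d) {v : Hilb d} {g : Pt d → Fock d}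
    (h : v =ᵐ[volume] g) : inner ℂ (toHilb φ) v = ∫ x, inner ℂ (φ x) (g x) := by
  rw [L2.inner_def]
  refine integral_congr_ae ?_
  filter_upwards [coeFn_toHilb φ, h] with x h1 h2
  rw [h1, h2]

theorem exists_isSymbolOp (hf : IsSmoothBounded f) (B : Pt d →L[ℝ] Pt d) :
    ∃ T, IsSymbolOp B f T := by
  let S : Spinor d →ₗ[ℂ] Hilb d :=
    { toFun := fun ψ => (memLp_symbolOp hf B ψ).toLp _
      map_add' := fun ψ₁ ψ₂ => by
        rw [← MemLp.toLp_add]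
        exact MemLp.toLp_congr _ _ (ae_of_all _ fun x => symbolOp_add hf ψ₁ ψ₂ x)
      map_smul' := fun c ψ => by
        rw [RingHom.id_apply, ← MemLp.toLp_const_smul]
        exact MemLp.toLp_congr _ _ (ae_of_all _ fun x => symbolOp_smul c ψ x) }
  have hS : ∀ ψ, S ψ =ᵐ[volume] symbolOp B f ψ := fun ψ =>
    MemLp.coeFn_toLp (memLp_symbolOp hf B ψ)
  obtain ⟨C, hC0, hC⟩ := exists_quadratic_bound hf B
  have hquad : ∀ (v : Hilb d) (ψ : Spinor d),
      ‖inner ℂ v (S ψ)‖ ≤ C * (‖v‖ ^ 2 + ‖toHilb ψ‖ ^ 2) := by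
    intro v ψ
    refine denseRange_toHilb.induction_on v
      (isClosed_le (by fun_prop) (by fun_prop)) fun φ => ?_
    rw [inner_toHilb_eq_integral φ (hS ψ)]
    exact hC φ ψ
  have hbound : ∀ ψ, ‖S ψ‖ ≤ (2 * (C + 1)) * ‖toHilb ψ‖ := by
    intro ψ
    -- The quadratic bound is tested at a multiple of `S ψ` small enough for its `‖S ψ‖²` term to be
    -- absorbed on the left; `C + 1` avoids division by zero.
    have h := hquad (((2 * (C + 1))⁻¹ : ℂ) • S ψ) ψ
    have hn : ‖((2 * (C + 1))⁻¹ : ℂ)‖ = (2 * (C + 1))⁻¹ := by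
      have : ((2 * (C + 1))⁻¹ : ℂ) = (((2 * (C + 1))⁻¹ : ℝ) : ℂ) := by push_cast; rfl
      rw [this, Complex.norm_real, Real.norm_of_nonneg (by positivity)]
    rw [inner_smul_left, norm_mul, RCLike.norm_conj, norm_smul, hn, inner_self_eq_norm_sq_to_K,
      norm_pow, RCLike.norm_ofReal, abs_norm] at h
    refine le_of_sq_le_sq ?_ (by positivity)
    have hC1 : 0 < C + 1 := by linarith
    rw [inv_mul_eq_div, inv_mul_eq_div, div_pow] at h
    field_simp at h
    nlinarith [sq_nonneg ‖S ψ‖, sq_nonneg ‖toHilb ψ‖, mul_nonneg hC0 (sq_nonneg ‖S ψ‖),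
      mul_nonneg hC0 (sq_nonneg ‖toHilb ψ‖)]
  refine ⟨S.extendOfNorm toHilb, fun ψ => ?_⟩
  rw [LinearMap.extendOfNorm_eq denseRange_toHilb ⟨_, hbound⟩]
  exact hS ψ

variable {T : Hilb d →L[ℂ] Hilb d}

theorem IsSymbolOp.inner_toHilb (h : IsSymbolOp B f T) (φ ψ : Spinor d) :
    inner ℂ (toHilb φ) (T (toHilb ψ)) = ∫ x, inner ℂ (φ x) (symbolOp B f ψ x) :=
  inner_toHilb_eq_integral φ (h ψ)

theorem IsSymbolOp.fiberHilb_apply (h : IsSymbolOp B f T) (hf : IsSmoothBounded f)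
    (M : Fock d →L[ℂ] Fock d) (v : Hilb d) : fiberHilb M (T v) = T (fiberHilb M v) := by
  refine denseRange_toHilb.induction_on v (isClosed_eq (by fun_prop) (by fun_prop)) fun ψ => ?_
  rw [← toHilb_fiberOp]
  apply Lp.ext
  filter_upwards [h ψ, h (fiberOp M ψ),
    ContinuousLinearMap.coeFn_compLpL (p := 2) (μ := volume) M (T (toHilb ψ))] with x h1 h2 h3
  rw [h2, symbolOp_fiberOp hf, ← h1]
  exact h3

theorem IsSymbolOp.const_smul (h : IsSymbolOp B f T) (c : ℂ) :
    IsSymbolOp B (fun x => c • f x) (c • T) := by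
  intro ψ
  rw [smul_apply]
  filter_upwards [h ψ, Lp.coeFn_smul c (T (toHilb ψ))] with x h1 h2
  rw [h2, Pi.smul_apply, h1, symbolOp_const_smul]

theorem isWeakCommutator_position (hf : IsSmoothBounded f) (h : IsSymbolOp B f T) (μ : Fin d)
    {T' : Hilb d →L[ℂ] Hilb d}
    (h' : IsSymbolOp B (symbolDeriv B (EuclideanSpace.single μ 1) f) T') :
    IsWeakCommutator toHilb (positionOp μ).toLinearMap T (-T') := by
  intro φ ψ
  rw [neg_apply, inner_neg_right]
  change inner ℂ (toHilb (positionOp μ φ)) _ - inner ℂ _ (T (toHilb (positionOp μ ψ))) = _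
  have hi := integrable_inner_symbolOp (B := B) hf continuous_one (K := 1) (by simp)
  have hi' := integrable_inner_symbolOp (B := B) (hf.symbolDeriv B (EuclideanSpace.single μ 1))
    continuous_one (K := 1) (by simp)
  simp only [Pi.one_apply, one_smul] at hi hi'
  rw [h.inner_toHilb, h.inner_toHilb, h'.inner_toHilb, ← integral_sub (hi _ _) (hi _ _),
    ← integral_neg]
  congr 1 with x
  rw [symbolOp_positionOp hf, positionOp_apply, inner_smul_left, inner_add_right,
    inner_smul_right, Complex.conj_ofReal]
  ring

open LineDeriv in
-- Differentiation under the integral: the phase yields `∂_μ ψ`, the symbol yields `∂_μ f`.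
theorem hasLineDerivAt_symbolOp (hf : IsSmoothBounded f) (μ : Fin d) (ψ : Spinor d) (x : Pt d) :
    HasLineDerivAt ℝ (symbolOp B f ψ) (symbolOp B f (partialOp μ ψ) x +
      symbolOp B (fun y => fderiv ℝ f y (EuclideanSpace.single μ 1)) ψ x) x
      (EuclideanSpace.single μ 1) := by
  set m : Pt d := EuclideanSpace.single μ (1 : ℝ)
  have hf' := hf.fderiv_apply m
  obtain ⟨C, hC0, hC⟩ := hf.exists_bound
  obtain ⟨C', hC'0, hC'⟩ := hf'.exists_bound
  have hF : ∀ ξ : Pt d, 𝓕 (partialOp μ ψ) ξ =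
      (2 * Real.pi * Complex.I * ((inner ℝ ξ m : ℝ) : ℂ)) • 𝓕 ψ ξ := by
    intro ξ
    have h : 𝓕 (partialOp μ ψ) = _ := SchwartzMap.fourier_lineDerivOp_eq ψ m
    rw [h, smul_apply, SchwartzMap.smulLeftCLM_apply_apply (by fun_prop),
      mul_smul (2 * Real.pi * Complex.I)]
    congr 1
  have hint1 := fun y => integrable_symbolOp_integrand (B := B) hf ψ y
  have hint2 := fun y => integrable_symbolOp_integrand (B := B) hf (partialOp μ ψ) y
  have hint3 := fun y => integrable_symbolOp_integrand (B := B) hf' ψ y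
  have hmeas : ∀ t : ℝ, AEStronglyMeasurable (fun ξ : Pt d =>
      Real.fourierChar (inner ℝ ξ (x + t • m)) • f (x + t • m + B ξ) • 𝓕 ψ ξ) volume :=
    fun t => (hint1 (x + t • m)).aestronglyMeasurable
  have hbound : ∀ (ξ : Pt d) (t : ℝ),
      ‖Real.fourierChar (inner ℝ ξ (x + t • m)) • f (x + t • m + B ξ) • 𝓕 (partialOp μ ψ) ξ +
        Real.fourierChar (inner ℝ ξ (x + t • m)) • fderiv ℝ f (x + t • m + B ξ) m • 𝓕 ψ ξ‖ ≤
      C * ‖𝓕 (partialOp μ ψ) ξ‖ + C' * ‖𝓕 ψ ξ‖ := by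
    intro ξ t
    refine (norm_add_le _ _).trans (add_le_add ?_ ?_)
    · rw [norm_symbolOp_integrand]
      exact mul_le_mul_of_nonneg_right (hC _) (norm_nonneg _)
    · rw [Circle.norm_smul, norm_smul]
      exact mul_le_mul_of_nonneg_right (hC' _) (norm_nonneg _)
  have hdiff : ∀ (ξ : Pt d) (t : ℝ), HasDerivAt (fun t : ℝ =>
      Real.fourierChar (inner ℝ ξ (x + t • m)) • f (x + t • m + B ξ) • 𝓕 ψ ξ)
      (Real.fourierChar (inner ℝ ξ (x + t • m)) • f (x + t • m + B ξ) • 𝓕 (partialOp μ ψ) ξ +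
        Real.fourierChar (inner ℝ ξ (x + t • m)) • fderiv ℝ f (x + t • m + B ξ) m • 𝓕 ψ ξ) t := by
    intro ξ t
    have h1 : HasDerivAt (fun t : ℝ => x + t • m) m t := by
      simpa using ((hasDerivAt_id t).smul_const m).const_add x
    have h2 : HasDerivAt (fun t : ℝ => x + t • m + B ξ) m t := h1.add_const _
    have h3 : HasDerivAt (fun t : ℝ => f (x + t • m + B ξ)) (fderiv ℝ f (x + t • m + B ξ) m) t :=
      (hf.differentiable _).hasFDerivAt.comp_hasDerivAt t h2
    have h4 : HasDerivAt (fun t : ℝ => inner ℝ ξ (x + t • m)) (inner ℝ ξ m) t :=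
      (innerSL ℝ ξ).hasFDerivAt.comp_hasDerivAt t h1
    have h5 : HasDerivAt (fun t : ℝ => (Real.fourierChar (inner ℝ ξ (x + t • m)) : ℂ))
        ((2 * Real.pi * Complex.I * ((inner ℝ ξ m : ℝ) : ℂ)) *
          Real.fourierChar (inner ℝ ξ (x + t • m))) t := by
      have := (Real.hasDerivAt_fourierChar (inner ℝ ξ (x + t • m))).scomp t h4
      refine this.congr_deriv ?_
      rw [Complex.real_smul]
      ring
    have h6 := (h5.mul h3).smul_const (𝓕 ψ ξ)
    rw [hF]
    have h7 : (fun t : ℝ => Real.fourierChar (inner ℝ ξ (x + t • m)) • f (x + t • m + B ξ) • 𝓕 ψ ξ) =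
        fun t : ℝ => ((Real.fourierChar (inner ℝ ξ (x + t • m)) : ℂ) * f (x + t • m + B ξ)) • 𝓕 ψ ξ :=
      funext fun t =>
        (mul_smul (Real.fourierChar (inner ℝ ξ (x + t • m)) : ℂ) (f (x + t • m + B ξ)) (𝓕 ψ ξ)).symm
    rw [h7]
    refine h6.congr_deriv ?_
    simp only [Circle.smul_def]
    module
  have hbi : Integrable fun ξ => C * ‖𝓕 (partialOp μ ψ) ξ‖ + C' * ‖𝓕 ψ ξ‖ :=
    ((𝓕 (partialOp μ ψ)).integrable.norm.const_mul C).add ((𝓕 ψ).integrable.norm.const_mul C')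
  have hmeas' : AEStronglyMeasurable (fun ξ : Pt d =>
      Real.fourierChar (inner ℝ ξ (x + (0 : ℝ) • m)) • f (x + (0 : ℝ) • m + B ξ) •
        𝓕 (partialOp μ ψ) ξ + Real.fourierChar (inner ℝ ξ (x + (0 : ℝ) • m)) •
        fderiv ℝ f (x + (0 : ℝ) • m + B ξ) m • 𝓕 ψ ξ) volume :=
    (hint2 (x + (0 : ℝ) • m)).aestronglyMeasurable.add
      (hint3 (x + (0 : ℝ) • m)).aestronglyMeasurable
  have key := (hasDerivAt_integral_of_dominated_loc_of_deriv_le (s := Set.univ) (x₀ := (0 : ℝ))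
    Filter.univ_mem (Filter.Eventually.of_forall hmeas) (hint1 (x + (0 : ℝ) • m)) hmeas'
    (ae_of_all _ fun ξ t _ => hbound ξ t) hbi (ae_of_all _ fun ξ t _ => hdiff ξ t)).2
  rw [integral_add (hint2 _) (hint3 _)] at key
  simp only [zero_smul, add_zero] at key
  exact key

theorem isWeakCommutator_partial (hf : IsSmoothBounded f) (h : IsSymbolOp B f T) (μ : Fin d)
    {T' : Hilb d →L[ℂ] Hilb d}
    (h' : IsSymbolOp B (fun y => fderiv ℝ f y (EuclideanSpace.single μ 1)) T') (φ ψ : Spinor d) :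
    inner ℂ (toHilb (partialOp μ φ)) (T (toHilb ψ)) +
      inner ℂ (toHilb φ) (T (toHilb (partialOp μ ψ))) =
      -inner ℂ (toHilb φ) (T' (toHilb ψ)) := by
  have hf' := hf.fderiv_apply (EuclideanSpace.single μ 1)
  have hi := integrable_inner_symbolOp (B := B) hf continuous_one (K := 1) (by simp)
  have hi' := integrable_inner_symbolOp (B := B) hf' continuous_one (K := 1) (by simp)
  simp only [Pi.one_apply, one_smul] at hi hi'
  have hsum : Integrable fun x => inner ℂ (φ x) (symbolOp B f (partialOp μ ψ) x +
      symbolOp B (fun y => fderiv ℝ f y (EuclideanSpace.single μ 1)) ψ x) := by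
    simp only [inner_add_right]
    exact (hi φ (partialOp μ ψ)).add (hi' φ ψ)
  have key := integral_bilinear_hasLineDerivAt_right_eq_neg_left_of_integrable (μ := volume)
    (B := (isBoundedBilinearMap_inner (𝕜 := ℂ) (E := Fock d)).toContinuousLinearMap)
    (f := φ) (f' := partialOp μ φ) (g := symbolOp B f ψ) (v := EuclideanSpace.single μ (1 : ℝ))
    (hi (partialOp μ φ) ψ) hsum (hi φ ψ)
    (fun x _ => (partialOp_apply μ φ x) ▸
      φ.differentiableAt.hasFDerivAt.hasLineDerivAt (EuclideanSpace.single μ (1 : ℝ)))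
    (fun x _ => hasLineDerivAt_symbolOp hf μ ψ x)
  change ∫ x, inner ℂ (φ x) (symbolOp B f (partialOp μ ψ) x +
      symbolOp B (fun y => fderiv ℝ f y (EuclideanSpace.single μ 1)) ψ x) =
    -∫ x, inner ℂ (partialOp μ φ x) (symbolOp B f ψ x) at key
  simp only [inner_add_right] at key
  rw [integral_add (hi _ _) (hi' _ _)] at key
  rw [h.inner_toHilb, h.inner_toHilb, h'.inner_toHilb]
  linear_combination key

end BoundedSymbolOp

end MoyalOscillator

namespace MoyalOscillator

open MeasureTheory

/-! ### Regularity of left Moyal multiplication -/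

section Regularity

variable {d : ℕ} {B : Pt d →L[ℝ] Pt d} {f : Pt d → ℂ} {T : Hilb d →L[ℂ] Hilb d}

open FourierTransform in
-- Substitute `k = -2 π ξ` and translate `y` by `x`. The Jacobian cancels `(2π)^{-d}`, and `½ Θ k`
-- becomes `-π Θ ξ`.
theorem moyal_eq_symbolOp (Θ : Matrix (Fin d) (Fin d) ℝ) (f : Pt d → ℂ) (ψ : Spinor d) :
    moyal Θ f ψ =
      symbolOp ((-Real.pi) • (Matrix.toEuclideanLin Θ).toContinuousLinearMap) f ψ := by
  ext1 x
  set G : Pt d → Fock d := fun k => f (x + (2⁻¹ : ℝ) • Matrix.toEuclideanLin Θ k) •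
      ∫ y : Pt d, Complex.exp (Complex.I * ((inner ℝ k y : ℝ) : ℂ)) • ψ (x + y) with hG
  have h1 := Measure.integral_comp_smul (volume : Measure (Pt d)) G (-(2 * Real.pi))
  have h2 : |((-(2 * Real.pi)) ^ Module.finrank ℝ (Pt d))⁻¹| = ((2 * Real.pi) ^ d)⁻¹ := by
    rw [finrank_euclideanSpace_fin, abs_inv, abs_pow, abs_neg, abs_of_pos (by positivity)]
  rw [h2] at h1
  rw [moyal, ← hG, ← h1, symbolOp]
  congr 1 with ξ : 1
  have h3 : x + (2⁻¹ : ℝ) • Matrix.toEuclideanLin Θ (-(2 * Real.pi) • ξ) =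
      x + ((-Real.pi) • (Matrix.toEuclideanLin Θ).toContinuousLinearMap) ξ := by
    rw [map_smul, smul_smul, smul_apply, LinearMap.coe_toContinuousLinearMap']
    congr 2
    ring
  have h4 : (∫ y : Pt d, Complex.exp (Complex.I * ((inner ℝ (-(2 * Real.pi) • ξ) y : ℝ) : ℂ)) •
      ψ (x + y)) = (Real.fourierChar (inner ℝ ξ x) : ℂ) • 𝓕 ψ ξ := by
    rw [SchwartzMap.fourier_coe, Real.fourier_eq', ← integral_smul]
    refine Eq.trans ?_ (integral_add_left_eq_self _ x)
    congr 1 with y : 1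
    rw [smul_smul, Real.fourierChar_apply, ← Complex.exp_add]
    congr 2
    rw [real_inner_smul_left, inner_add_left, real_inner_comm y ξ, real_inner_comm x ξ]
    push_cast
    ring
  rw [hG]
  simp only
  rw [h3, h4, smul_comm]
  rfl

theorem IsSymbolOp.exists_isWeakCommutator_gen (h : IsSymbolOp B f T) (hf : IsSmoothBounded f)
    (Ω : ℝ) (k : Fin d ⊕ Fin d) : ∃ f' T', IsSmoothBounded f' ∧ IsSymbolOp B f' T' ∧
      IsWeakCommutator toHilb (gen Ω k).toLinearMap T T' := by
  rcases k with μ | μ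
  · have hf' := hf.fderiv_apply (EuclideanSpace.single μ 1)
    obtain ⟨T', h'⟩ := exists_isSymbolOp hf' B
    refine ⟨_, _, hf'.const_smul (-Complex.I), h'.const_smul (-Complex.I), fun φ ψ => ?_⟩
    have key := isWeakCommutator_partial hf h μ h' φ ψ
    change inner ℂ (toHilb ((-Complex.I) • partialOp μ φ)) _ -
      inner ℂ _ (T (toHilb ((-Complex.I) • partialOp μ ψ))) = _
    rw [map_smul, map_smul, map_smul, smul_apply, inner_smul_left, inner_smul_right,
      inner_smul_right, map_neg, Complex.conj_I]
    linear_combination Complex.I * key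
  · have hf' := hf.symbolDeriv B (EuclideanSpace.single μ 1)
    obtain ⟨T', h'⟩ := exists_isSymbolOp hf' B
    refine ⟨_, _, hf'.const_smul (-Ω : ℂ), h'.const_smul (-Ω : ℂ), fun φ ψ => ?_⟩
    have key := isWeakCommutator_position hf h μ h' φ ψ
    rw [neg_apply, inner_neg_right] at key
    change inner ℂ (toHilb (positionOp μ φ)) _ -
      inner ℂ _ (T (toHilb (positionOp μ ψ))) = _ at key
    change inner ℂ (toHilb ((Ω : ℂ) • positionOp μ φ)) _ -
      inner ℂ _ (T (toHilb ((Ω : ℂ) • positionOp μ ψ))) = _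
    rw [map_smul, map_smul, map_smul, smul_apply, inner_smul_left, inner_smul_right,
      inner_smul_right, Complex.conj_ofReal]
    linear_combination (Ω : ℂ) * key

theorem fiberHilb_fiberHilb (M M' : Fock d →L[ℂ] Fock d) (v : Hilb d) :
    fiberHilb M (fiberHilb M' v) = fiberHilb (M * M') v := by
  refine denseRange_toHilb.induction_on v (isClosed_eq (by fun_prop) (by fun_prop)) fun ψ => ?_
  rw [← toHilb_fiberOp, ← toHilb_fiberOp, ← toHilb_fiberOp, fiberOp_fiberOp]

theorem inner_fiberHilb {M M' : Fock d →L[ℂ] Fock d}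
    (h : ∀ v w, inner ℂ (M v) w = inner ℂ v (M' w)) (φ : Spinor d) (v : Hilb d) :
    inner ℂ (toHilb (fiberOp M φ)) v = inner ℂ (toHilb φ) (fiberHilb M' v) := by
  refine denseRange_toHilb.induction_on v (isClosed_eq (by fun_prop) (by fun_prop)) fun ψ => ?_
  rw [← toHilb_fiberOp, inner_fiberOp h]

/-- The operators `T ⊗ M` with `T` the operator of a symbol `f (x + B ξ)` and `M` a matrix. -/
def symbolFamily (B : Pt d →L[ℝ] Pt d) : Set (Hilb d →L[ℂ] Hilb d) :=
  {S | ∃ f T M, IsSmoothBounded f ∧ IsSymbolOp B f T ∧ S = T * fiberHilb M}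

theorem exists_isWeakCommutator_mem_symbolFamily (Ω : ℝ) {S : Hilb d →L[ℂ] Hilb d}
    (hS : S ∈ symbolFamily B) (k : Fin d ⊕ Fin d) :
    ∃ S' ∈ symbolFamily B, IsWeakCommutator toHilb (gen Ω k).toLinearMap S S' := by
  obtain ⟨f, T, M, hf, h, rfl⟩ := hS
  obtain ⟨f', T', hf', h', hw⟩ := h.exists_isWeakCommutator_gen hf Ω k
  refine ⟨_, ⟨f', T', M, hf', h', rfl⟩, fun φ ψ => ?_⟩
  have key := hw φ (fiberOp M ψ)
  change inner ℂ _ (T (fiberHilb M (toHilb ψ))) -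
    inner ℂ _ (T (fiberHilb M (toHilb (gen Ω k ψ)))) = inner ℂ _ (T' (fiberHilb M (toHilb ψ)))
  rw [← toHilb_fiberOp, ← toHilb_fiberOp, fiberOp_gen]
  exact key

/-- Operators with scalar symbol commute with constant matrices, so only the matrix factor is
affected. This is why the family carries a matrix. -/
theorem commutator_fiberHilb_mem_symbolFamily (P : Fock d →L[ℂ] Fock d) {S : Hilb d →L[ℂ] Hilb d}
    (hS : S ∈ symbolFamily B) : fiberHilb P * S - S * fiberHilb P ∈ symbolFamily B := by
  obtain ⟨f, T, M, hf, h, rfl⟩ := hS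
  refine ⟨f, T, P * M - M * P, hf, h, ?_⟩
  ext1 v
  have hsub : fiberHilb (P * M - M * P) v = fiberHilb (P * M) v - fiberHilb (M * P) v := by
    refine denseRange_toHilb.induction_on v (isClosed_eq (by fun_prop) (by fun_prop)) fun ψ => ?_
    rw [← toHilb_fiberOp, ← toHilb_fiberOp, ← toHilb_fiberOp, ← map_sub]
    rfl
  change fiberHilb P (T (fiberHilb M v)) - T (fiberHilb M (fiberHilb P v)) =
    T (fiberHilb (P * M - M * P) v)
  rw [h.fiberHilb_apply hf, fiberHilb_fiberHilb, fiberHilb_fiberHilb, hsub, map_sub]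

theorem IsSymbolOp.mem_symbolFamily (h : IsSymbolOp B f T) (hf : IsSmoothBounded f) :
    T ∈ symbolFamily B := by
  refine ⟨f, T, 1, hf, h, ?_⟩
  ext1 v
  change T v = T (fiberHilb 1 v)
  congr 1
  refine denseRange_toHilb.induction_on v (isClosed_eq (by fun_prop) (by fun_prop)) fun ψ => ?_
  rw [← toHilb_fiberOp]
  rfl

/-- Operators with symbol `f (x + B ξ)` are regular for every Dirac operator `∑_k X_k ⊗ Γ_k`. -/
theorem IsSymbolOp.regular (h : IsSymbolOp B f T) (hf : IsSmoothBounded f) {Ω : ℝ} (hΩ : 0 < Ω)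
    {Γ : Fin d ⊕ Fin d → Fock d →L[ℂ] Fock d} (hΓ : IsClifford Γ) {D : Hilb d →ₗ.[ℂ] Hilb d}
    (hD : D = (ofCore (diracOf Ω Γ)).closure) :
    IsSelfAdjoint D ∧ (∃! A, IsBracket D A) ∧
      ∃ C : Hilb d →L[ℂ] Hilb d, IsCommutator D T C ∧
        ∀ A, IsBracket D A → ∀ n : ℕ, MemDomDeltaPow A n T ∧ MemDomDeltaPow A n C := by
  have hosc := isOscillator_diracOf Ω hΓ (denseRange_diracOf_sq_add_one Ω hΩ hΓ)
  rw [← hD] at hosc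
  refine ⟨hosc.isSelfAdjoint, hosc.existsUnique_isBracket, ?_⟩
  have hsmooth : ∀ {S}, S ∈ Submodule.span ℂ (symbolFamily B) →
      IsSmoothFor (bracketInv toHilb (diracOf Ω Γ).toLinearMap) S := fun {S} hS =>
    hosc.isSmoothFor_of_weak (fun S hS => exists_isWeakCommutator_mem_symbolFamily Ω hS)
      (fun S hS => commutator_fiberHilb_mem_symbolFamily _ hS) hS
  -- As `T` commutes with the `Γ_k`, the commutator with `∑ X_k ⊗ Γ_k` is `∑ [X_k, T] ⊗ Γ_k`, again
  -- in the span of the family.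
  choose f' T' hf' h' hw using fun k => h.exists_isWeakCommutator_gen hf Ω k
  have hC : (∑ k, T' k * fiberHilb (Γ k)) ∈ Submodule.span ℂ (symbolFamily B) :=
    Submodule.sum_mem _ fun k _ => Submodule.subset_span ⟨f' k, T' k, Γ k, hf' k, h' k, rfl⟩
  refine ⟨∑ k, T' k * fiberHilb (Γ k), hosc.isCommutator_of_core fun φ ψ => ?_, fun A hA n =>
    ⟨hosc.memDomDeltaPow_of_isSmoothFor hA n
      (hsmooth (Submodule.subset_span (h.mem_symbolFamily hf))),
      hosc.memDomDeltaPow_of_isSmoothFor hA n (hsmooth hC)⟩⟩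
  change inner ℂ (toHilb (diracOf Ω Γ φ)) _ - inner ℂ _ (T (toHilb (diracOf Ω Γ ψ))) = _
  rw [diracOf_apply, diracOf_apply, map_sum, map_sum, map_sum, sum_inner, inner_sum,
    ← Finset.sum_sub_distrib, sum_apply, inner_sum]
  refine Finset.sum_congr rfl fun k _ => ?_
  have key : inner ℂ (toHilb (gen Ω k (fiberOp (Γ k) φ))) (T (toHilb ψ)) -
      inner ℂ (toHilb (fiberOp (Γ k) φ)) (T (toHilb (gen Ω k ψ))) =
      inner ℂ (toHilb (fiberOp (Γ k) φ)) (T' k (toHilb ψ)) := hw k (fiberOp (Γ k) φ) ψ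
  rw [inner_fiberHilb (hΓ.symm k), inner_fiberHilb (hΓ.symm k), h.fiberHilb_apply hf,
    (h' k).fiberHilb_apply (hf' k), ← toHilb_fiberOp, fiberOp_gen] at key
  exact key

end Regularity

end MoyalOscillator

/-! ### Application to the two Dirac operators. -/

open MoyalOscillator in
theorem mainTheorem4 {d : ℕ} (Θ : Matrix (Fin d) (Fin d) ℝ) (hΘ : Θ.transpose = -Θ)
    (hΘ' : IsUnit Θ.det) (Ω : ℝ) (hΩ : 0 < Ω) (f : Pt d → ℂ) (hf : IsSmoothBounded f) :
    ∃ T : Hilb d →L[ℂ] Hilb d, IsLeftMoyal Θ f T ∧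
      ∀ D ∈ ({dirac₁ Ω, dirac₂ Ω} : Set (Hilb d →ₗ.[ℂ] Hilb d)),
        IsSelfAdjoint D ∧ (∃! A, IsBracket D A) ∧
        ∃ C : Hilb d →L[ℂ] Hilb d, IsCommutator D T C ∧
          ∀ A, IsBracket D A → ∀ n : ℕ, MemDomDeltaPow A n T ∧ MemDomDeltaPow A n C := by
  obtain ⟨T, hT⟩ := exists_isSymbolOp hf
    ((-Real.pi) • (Matrix.toEuclideanLin Θ).toContinuousLinearMap)
  refine ⟨T, fun ψ => ?_, ?_⟩
  · rw [moyal_eq_symbolOp]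
    exact hT ψ
  rintro D (rfl | rfl)
  · exact hT.regular hf hΩ (isClifford_clifford (z₁ := Complex.I) (z₂ := 1) (by simp) (by simp)
      (by simp)) (by rw [dirac₁, diracCore₁_eq])
  · exact hT.regular hf hΩ (isClifford_clifford (z₁ := -1) (z₂ := -Complex.I) (by simp) (by simp)
      (by simp)) (by rw [dirac₂, diracCore₂_eq])
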